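/- For real numbers $b_i$, $a_{ij}$, $c_{ijk}$ (indices in $\{1,\dots,n\}$, $n\ge 1$; $a_{ij}$ and $c_{ijk}$ depend only on the unordered pair, respectively triple, of distinct indices) and $x=(\xi_1,\dots,\xi_n)\in\{-1,1\}^n$ let $$f(x)=\sum_{i<j}a_{ij}\xi_i\xi_j+\sum_i b_i\xi_i ,\qquad g(x)=\sum_{i<j<k}c_{ijk}\xi_i\xi_j\xi_k+\sum_{i<j}a_{ij}\xi_i\xi_j+\sum_i b_i\xi_i .$$ Two non-zero complex numbers $w_1,w_2$ are said to approximate each other within relative error $\epsilon$ if $w_1=e^{z_1}$ and $w_2=e^{z_2}$ for some $z_1,z_2\in\mathbb C$ with $|z_1-z_2|\le\epsilon$. The model of computation is the real random access machine: a program with natural-number registers (addition, truncated subtraction, comparison, indirect addressing) and real registers (exact $+,-,\times,\div$, comparison, indirect addressing), with integer constants only, in which every instruction and every test costs one step. Let $0<\delta<1$ be fixed. (1) There are a program and a constant $C>0$, depending on $\delta$ only, such that for all $n\ge1$, all $0<\epsilon<1$, and all real $a_{ij}$, $b_i$ with $$\sum_{j:\,j\ne i}|a_{ij}|\le 1-\delta\qquad(i=1,\dots,n),$$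 the program, given $n$, $\epsilon$, the numbers $e^{b_i}$ and the numbers $a_{ij}$, halts after at most $C\,n^{C(\ln n-\ln\epsilon)}$ steps and outputs a real number that approximates $\sum_{x\in\{-1,1\}^n}e^{f(x)}$ within relative error $\epsilon$. (2) There are a program and a constant $C>0$, depending on $\delta$ only, such that for all $n\ge1$, all $0<\epsilon<1$, and all real $c_{ijk}$, $a_{ij}$, $b_i$ with $$\sum_{j<k:\ j,k\ne i}|c_{ijk}|+\sum_{j:\,j\ne i}|a_{ij}|\le 1-\delta\qquad(i=1,\dots,n),$$ the program, given $n$, $\epsilon$, the numbers $e^{b_i}$, $a_{ij}$ and $c_{ijk}$, halts after at most $C\,n^{C(\ln n-\ln\epsilon)}$ steps and outputs a real number that approximates $\sum_{x\in\{-1,1\}^n}e^{g(x)}$ within relative error $\epsilon$. -/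

import Mathlib

/-! ## Partition functions of quadratic and cubic polynomials on the cube `{-1, 1}ⁿ`

A point of the cube is a map `x : Fin n → ℤˣ`; the units of `ℤ` are exactly `1` and `-1`. -/

noncomputable section

/-- `∑_{i < j} a_ij ξ_i ξ_j + ∑_i b_i ξ_i`. -/
def quadPoly {n : ℕ} (a : Fin n → Fin n → ℝ) (b : Fin n → ℝ) (x : Fin n → ℤˣ) : ℝ :=
  (∑ i, ∑ j ∈ Finset.Ioi i, a i j * ((x i : ℤ) : ℝ) * ((x j : ℤ) : ℝ))
    + ∑ i, b i * ((x i : ℤ) : ℝ)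

/-- `∑_{i < j < k} c_ijk ξ_i ξ_j ξ_k + ∑_{i < j} a_ij ξ_i ξ_j + ∑_i b_i ξ_i`. -/
def cubicPoly {n : ℕ} (c : Fin n → Fin n → Fin n → ℝ) (a : Fin n → Fin n → ℝ) (b : Fin n → ℝ)
    (x : Fin n → ℤˣ) : ℝ :=
  (∑ i, ∑ j ∈ Finset.Ioi i, ∑ k ∈ Finset.Ioi j,
      c i j k * ((x i : ℤ) : ℝ) * ((x j : ℤ) : ℝ) * ((x k : ℤ) : ℝ))
    + quadPoly a b x

/-- `S(e^f) = ∑_{x ∈ {-1, 1}ⁿ} e^{f(x)}`. -/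
def partitionFunction {n : ℕ} (f : (Fin n → ℤˣ) → ℝ) : ℝ :=
  ∑ x, Real.exp (f x)

/-- `w₁` and `w₂` approximate each other within relative error `ε`:
`w₁ = e^{z₁}` and `w₂ = e^{z₂}` with `|z₁ - z₂| ≤ ε`. -/
def RelApprox (w₁ w₂ : ℂ) (ε : ℝ) : Prop :=
  ∃ z₁ z₂ : ℂ, w₁ = Complex.exp z₁ ∧ w₂ = Complex.exp z₂ ∧ ‖z₁ - z₂‖ ≤ ε

/-! ## Real random access machines

Programs work on two infinite arrays of registers, one holding natural numbers (counters and
addresses) and one holding real numbers, and on a read-only list of real inputs. Every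
instruction and every test costs one step. The only constants are integers, and there is no
rounding of real numbers. -/

namespace RealRAM

/-- The contents of the registers. -/
structure State where
  nat : ℕ → ℕ
  real : ℕ → ℝ

/-- Below `N` and `R` are the natural and the real registers; `d`, `p`, `q` are fixed register
numbers, so that `R[N[p]]` is indirect addressing. -/
inductive Instr where
  /-- `N[d] := k` -/
  | natConst (d k : ℕ)
  /-- `N[d] := N[p] + N[q]` -/
  | natAdd (d p q : ℕ)
  /-- `N[d] := max (N[p] - N[q]) 0` -/
  | natSub (d p q : ℕ)
  /-- `N[d] := N[N[p]]` -/
  | natLoad (d p : ℕ)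
  /-- `N[N[p]] := N[q]` -/
  | natStore (p q : ℕ)
  /-- `R[d] := k` -/
  | realConst (d : ℕ) (k : ℤ)
  /-- `R[d] := N[p]` -/
  | realOfNat (d p : ℕ)
  /-- `R[d] := R[p] + R[q]` -/
  | realAdd (d p q : ℕ)
  /-- `R[d] := R[p] - R[q]` -/
  | realSub (d p q : ℕ)
  /-- `R[d] := R[p] * R[q]` -/
  | realMul (d p q : ℕ)
  /-- `R[d] := R[p] / R[q]`, allowed only if `R[q] ≠ 0` -/
  | realDiv (d p q : ℕ)
  /-- `R[d] := R[N[p]]` -/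
  | realLoad (d p : ℕ)
  /-- `R[N[p]] := R[q]` -/
  | realStore (p q : ℕ)
  /-- `R[d] :=` the input number at position `N[p]`, counted from `0`
  (and `0` beyond the end of the input) -/
  | realInput (d p : ℕ)

/-- The condition under which an instruction can be executed. -/
def Instr.Valid : Instr → State → Prop
  | .realDiv _ _ q, s => s.real q ≠ 0
  | _, _ => True

/-- The effect of an instruction. -/
def Instr.run (inp : List ℝ) : Instr → State → State
  | .natConst d k, s => ⟨Function.update s.nat d k, s.real⟩
  | .natAdd d p q, s => ⟨Function.update s.nat d (s.nat p + s.nat q), s.real⟩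
  | .natSub d p q, s => ⟨Function.update s.nat d (s.nat p - s.nat q), s.real⟩
  | .natLoad d p, s => ⟨Function.update s.nat d (s.nat (s.nat p)), s.real⟩
  | .natStore p q, s => ⟨Function.update s.nat (s.nat p) (s.nat q), s.real⟩
  | .realConst d k, s => ⟨s.nat, Function.update s.real d (k : ℝ)⟩
  | .realOfNat d p, s => ⟨s.nat, Function.update s.real d (s.nat p : ℝ)⟩
  | .realAdd d p q, s => ⟨s.nat, Function.update s.real d (s.real p + s.real q)⟩
  | .realSub d p q, s => ⟨s.nat, Function.update s.real d (s.real p - s.real q)⟩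
  | .realMul d p q, s => ⟨s.nat, Function.update s.real d (s.real p * s.real q)⟩
  | .realDiv d p q, s => ⟨s.nat, Function.update s.real d (s.real p / s.real q)⟩
  | .realLoad d p, s => ⟨s.nat, Function.update s.real d (s.real (s.nat p))⟩
  | .realStore p q, s => ⟨s.nat, Function.update s.real (s.nat p) (s.real q)⟩
  | .realInput d p, s => ⟨s.nat, Function.update s.real d (inp.getD (s.nat p) 0)⟩

/-- Tests compare two registers of the same kind. -/
inductive Test where
  | natLt (p q : ℕ)
  | natLe (p q : ℕ)
  | realLt (p q : ℕ)
  | realLe (p q : ℕ)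

/-- The outcome of a test. -/
def Test.Holds : Test → State → Prop
  | .natLt p q, s => s.nat p < s.nat q
  | .natLe p q, s => s.nat p ≤ s.nat q
  | .realLt p q, s => s.real p < s.real q
  | .realLe p q, s => s.real p ≤ s.real q

/-- Programs: instructions, composition, branching, and `while` loops. -/
inductive Program where
  | skip
  | instr (i : Instr)
  | seq (P Q : Program)
  | ite (c : Test) (P Q : Program)
  | loop (c : Test) (P : Program)

/-- `Exec inp P s s' t`: started in the state `s` with input `inp`, the program `P` halts in the
state `s'` after exactly `t` steps (executed instructions and tests). -/
inductive Exec (inp : List ℝ) : Program → State → State → ℕ → Prop where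
  | skip (s : State) : Exec inp .skip s s 0
  | instr (i : Instr) (s : State) (h : i.Valid s) : Exec inp (.instr i) s (i.run inp s) 1
  | seq {P Q : Program} {s s' s'' : State} {t t' : ℕ}
      (h : Exec inp P s s' t) (h' : Exec inp Q s' s'' t') :
      Exec inp (.seq P Q) s s'' (t + t')
  | ite_true {c : Test} {P Q : Program} {s s' : State} {t : ℕ}
      (hc : c.Holds s) (h : Exec inp P s s' t) :
      Exec inp (.ite c P Q) s s' (1 + t)
  | ite_false {c : Test} {P Q : Program} {s s' : State} {t : ℕ}
      (hc : ¬ c.Holds s) (h : Exec inp Q s s' t) :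
      Exec inp (.ite c P Q) s s' (1 + t)
  | loop_true {c : Test} {P : Program} {s s' s'' : State} {t t' : ℕ}
      (hc : c.Holds s) (h : Exec inp P s s' t) (h' : Exec inp (.loop c P) s' s'' t') :
      Exec inp (.loop c P) s s'' (1 + t + t')
  | loop_false {c : Test} {P : Program} {s : State}
      (hc : ¬ c.Holds s) : Exec inp (.loop c P) s s 1

/-- At the start `N[0] = n` and all other registers are `0`. -/
def init (n : ℕ) : State :=
  ⟨Function.update (fun _ => 0) 0 n, fun _ => 0⟩

/-- On the size parameter `n` and the input list `inp`, the program `P` halts after exactly `t`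
steps and its output, the final content of `R[0]`, is `w`. -/
def Outputs (P : Program) (n : ℕ) (inp : List ℝ) (w : ℝ) (t : ℕ) : Prop :=
  ∃ s : State, Exec inp P (init n) s t ∧ s.real 0 = w

end RealRAM

/-! ## The inputs

The machine is given `ε`, the numbers `e^{b_i}` (not the `b_i`) and the coefficients, as flat
lists in lexicographic order of the indices. -/

/-- `ε, (e^{b_i})_i, (a_ij)_{i,j}`. -/
def quadInput {n : ℕ} (ε : ℝ) (a : Fin n → Fin n → ℝ) (b : Fin n → ℝ) : List ℝ :=
  ε :: (List.ofFn (fun i => Real.exp (b i)) ++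
    (List.ofFn fun i => List.ofFn fun j => a i j).flatten)

/-- `ε, (e^{b_i})_i, (a_ij)_{i,j}, (c_ijk)_{i,j,k}`. -/
def cubicInput {n : ℕ} (ε : ℝ) (c : Fin n → Fin n → Fin n → ℝ) (a : Fin n → Fin n → ℝ)
    (b : Fin n → ℝ) : List ℝ :=
  quadInput ε a b ++
    (List.ofFn fun i => (List.ofFn fun j => List.ofFn fun k => c i j k).flatten).flatten

end

/-!
The partition function is computed from conditional odds of single spins, which satisfy a recursion
that contracts errors.

With one more vertex `n`, whose spin is fixed to `1`, the polynomial becomes a sum of cubic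
monomials `w_τ ξ_i ξ_j ξ_k` (`SpinSystem.cubicTerms`). The partition function `Z` is, up to the
weight of the configuration `1`, the product over `r` of `1 + o_r`, where `o_r` are the odds of
`ξ_r = -1` against `ξ_r = 1` when all smaller spins are fixed to `1` (`Terms.Z_eq_prod`).

To compute the odds of a vertex `v`, the signs of the coefficients of the monomials containing `v`
are flipped one at a time. This writes the odds as a product with one factor `(1 + q σ) / (q + σ)`
for each such monomial, where `q = e^{2 w_τ}` and `σ` are the odds of the product of the other two
spins; and `σ` is a function of odds of one of them when the other one is pinned, in a system
without `v` (`Terms.odds_eq_prod`). The logarithm of the factor is Lipschitz in `log σ` with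
constant `tanh |w_τ| ≤ |w_τ|` (`abs_log_factor_sub_le`). Hence one step of the recursion multiplies
the error in the logarithm by at most the total strength of the interactions of `v`, which is at
most `1 - δ` (`near_odds_of_near`, `Terms.near_value`). Fields do not enter: a monomial
without other free spins gives an exact factor. So `O(log n + log (1 / ε))` levels of the recursion
suffice (`pow_depth_le`), and since each level multiplies the number of queries by a polynomial
in `n`, the whole forest of queries has size `n^{O(log (n / ε))}` (`size_le`, `log_ceil_le`).

The machine is given `a_ij` and `c_ijk` rather than their exponentials. Since the interactions are
bounded, `e^a` can be replaced by `(1 + a / N) ^ N` with `N` of order `n / ε`. This changes the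
logarithm of `Z` by a small multiple of `ε`, and the contraction rate from `1 - δ` to at most
`1 - δ ^ 2` (`abs_mul_log_sub_le`, `Admissible.near_Z_weight`, `near_output`).

On the machine, expressions over the entries of tables are compiled to programs whose running time
is polynomial in the size of the tables (`NExpr.compile_runs`, `RExpr.compile_runs`). The algorithm
consists of loops that fill one table each by such an expression (`fillNat_runs`, `fillReal_runs`,
`tableProgram_runs`). The quadratic polynomial is the cubic one with `c = 0`, and since positions
beyond the end of the input read as `0`, the same program serves both (`exists_program`). The case
`n = 1` is treated separately, as the time bound is then a constant.
-/

/-! ### Total correctness for real random access machines -/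

namespace RealRAM

/-- Started in `s`, the program halts after at most `T` steps in a state satisfying `Q`. -/
def Runs (inp : List ℝ) (P : Program) (s : State) (T : ℕ) (Q : State → Prop) : Prop :=
  ∃ s' t, Exec inp P s s' t ∧ t ≤ T ∧ Q s'

variable {inp : List ℝ} {P P' : Program} {s : State} {T T' : ℕ} {Q Q' : State → Prop}

theorem Runs.mono (h : Runs inp P s T Q) (hT : T ≤ T') (hQ : ∀ s', Q s' → Q' s') :
    Runs inp P s T' Q' := by
  obtain ⟨s', t, he, ht, hq⟩ := h
  exact ⟨s', t, he, ht.trans hT, hQ _ hq⟩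

theorem Runs.of_le (h : Runs inp P s T Q) (hT : T ≤ T') : Runs inp P s T' Q :=
  h.mono hT fun _ h => h

theorem Runs.skip (h : Q s) : Runs inp .skip s 0 Q :=
  ⟨s, 0, .skip s, le_rfl, h⟩

theorem Runs.seq (h : Runs inp P s T Q) (h' : ∀ s', Q s' → Runs inp P' s' T' Q') :
    Runs inp (.seq P P') s (T + T') Q' := by
  obtain ⟨s', t, he, ht, hq⟩ := h
  obtain ⟨s'', t', he', ht', hq'⟩ := h' _ hq
  exact ⟨s'', t + t', .seq he he', by omega, hq'⟩

theorem Runs.instr {i : Instr} (hi : i.Valid s) (h : Q (i.run inp s)) :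
    Runs inp (.instr i) s 1 Q :=
  ⟨_, 1, .instr i s hi, le_rfl, h⟩

theorem Runs.instr_seq {i : Instr} (hi : i.Valid s) (h : Runs inp P (i.run inp s) T Q) :
    Runs inp (.seq (.instr i) P) s (1 + T) Q :=
  (Runs.instr (Q := fun s' => s' = i.run inp s) hi rfl).seq (by rintro _ rfl; exact h)

theorem Runs.ite {c : Test} (h : c.Holds s → Runs inp P s T Q)
    (h' : ¬ c.Holds s → Runs inp P' s T Q) : Runs inp (.ite c P P') s (1 + T) Q := by
  by_cases hc : c.Holds s
  · obtain ⟨s', t, he, ht, hq⟩ := h hc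
    exact ⟨s', 1 + t, .ite_true hc he, by omega, hq⟩
  · obtain ⟨s', t, he, ht, hq⟩ := h' hc
    exact ⟨s', 1 + t, .ite_false hc he, by omega, hq⟩

/-- A loop that makes exactly `m` rounds, with the invariant `I i` after `i` rounds. -/
theorem Runs.loop {c : Test} (I : ℕ → State → Prop) (m : ℕ) (h0 : I 0 s)
    (hstep : ∀ i < m, ∀ s, I i s → c.Holds s ∧ Runs inp P s T (I (i + 1)))
    (hend : ∀ s, I m s → ¬ c.Holds s) :
    Runs inp (.loop c P) s (m * (T + 1) + 1) (I m) := by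
  have key : ∀ k i, i + k = m → ∀ s, I i s → Runs inp (.loop c P) s (k * (T + 1) + 1) (I m) := by
    intro k
    induction k with
    | zero =>
      intro i hi s hs
      obtain rfl : i = m := by omega
      exact ⟨s, 1, .loop_false (hend _ hs), by omega, hs⟩
    | succ k ih =>
      intro i hi s hs
      obtain ⟨hc, s', t, he, ht, hs'⟩ := hstep i (by omega) s hs
      obtain ⟨s'', t', he', ht', hq⟩ := ih (i + 1) (by omega) s' hs'
      refine ⟨s'', 1 + t + t', .loop_true hc he he', ?_, hq⟩
      have : (k + 1) * (T + 1) = k * (T + 1) + (T + 1) := by ring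
      omega
  exact key m 0 (by omega) s h0

/-! ### A language of expressions and its compiler -/

/-- Expressions with natural values: three variables, four tables, and a conditional on `<`.
Division rounds down, and `x / 0 = 0`. -/
inductive NExpr where
  | const (k : ℕ)
  | var (i : Fin 3)
  | add (a b : NExpr)
  | sub (a b : NExpr)
  | mul (a b : NExpr)
  | div (a b : NExpr)
  | tab (t : Fin 4) (a : NExpr)
  /-- `if a < b then c else d` -/
  | ite (a b c d : NExpr)

/-- Expressions with real values; `input a` is the input number at position `a`. -/
inductive RExpr where
  | const (k : ℤ)
  | ofNat (a : NExpr)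
  | tab (t : Fin 4) (a : NExpr)
  | input (a : NExpr)
  | add (a b : RExpr)
  | sub (a b : RExpr)
  | mul (a b : RExpr)
  | div (a b : RExpr)
  /-- `if a < b then c else d` -/
  | ite (a b : NExpr) (c d : RExpr)

/-- What an expression can read: three natural variables and four tables of each kind. -/
structure Env where
  var : Fin 3 → ℕ
  nat : Fin 4 → ℕ → ℕ
  real : Fin 4 → ℕ → ℝ

/-- The value of a natural expression. -/
@[simp] def NExpr.eval (E : Env) : NExpr → ℕ
  | .const k => k
  | .var i => E.var i
  | .add a b => a.eval E + b.eval E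
  | .sub a b => a.eval E - b.eval E
  | .mul a b => a.eval E * b.eval E
  | .div a b => a.eval E / b.eval E
  | .tab t a => E.nat t (a.eval E)
  | .ite a b c d => if a.eval E < b.eval E then c.eval E else d.eval E

/-- The value of a real expression. -/
@[simp] noncomputable def RExpr.eval (inp : List ℝ) (E : Env) : RExpr → ℝ
  | .const k => k
  | .ofNat a => (a.eval E : ℝ)
  | .tab t a => E.real t (a.eval E)
  | .input a => inp.getD (a.eval E) 0
  | .add a b => a.eval inp E + b.eval inp E
  | .sub a b => a.eval inp E - b.eval inp E
  | .mul a b => a.eval inp E * b.eval inp E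
  | .div a b => a.eval inp E / b.eval inp E
  | .ite a b c d => if a.eval E < b.eval E then c.eval inp E else d.eval inp E

/-- Every division that is carried out in the evaluation has a non-zero denominator. -/
@[simp] def RExpr.Ok (inp : List ℝ) (E : Env) : RExpr → Prop
  | .const _ => True
  | .ofNat _ => True
  | .tab _ _ => True
  | .input _ => True
  | .add a b => a.Ok inp E ∧ b.Ok inp E
  | .sub a b => a.Ok inp E ∧ b.Ok inp E
  | .mul a b => a.Ok inp E ∧ b.Ok inp E
  | .div a b => a.Ok inp E ∧ b.Ok inp E ∧ b.eval inp E ≠ 0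
  | .ite a b c d => if a.eval E < b.eval E then c.Ok inp E else d.Ok inp E

/-- The environment in a state: the variables are the registers `N[0]`, `N[1]`, `N[2]`, and entry
`x` of table `t` is in register `S + 4 x + t`. -/
noncomputable def envOf (S : ℕ) (s : State) : Env where
  var i := s.nat i
  nat t x := s.nat (S + (4 * x + t))
  real t x := s.real (S + (4 * x + t))

/-- All natural numbers in the environment are at most `M`. -/
def Env.Bounded (M : ℕ) (E : Env) : Prop :=
  (∀ i, E.var i ≤ M) ∧ ∀ t x, E.nat t x ≤ M

/-- Turn the number in `N[d]` into the address of that entry of table `t`. -/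
def address (S : ℕ) (t : Fin 4) (d : ℕ) : Program :=
  .seq (.instr (.natAdd d d d)) <| .seq (.instr (.natAdd d d d)) <|
    .seq (.instr (.natConst (d + 1) (S + t))) (.instr (.natAdd d (d + 1) d))

/-- `N[d] := N[d] * N[d + 1]`, by repeated addition. -/
def mulProgram (d : ℕ) : Program :=
  .seq (.instr (.natConst (d + 2) 0)) <| .seq (.instr (.natConst (d + 3) 1)) <|
    .seq (.instr (.natConst (d + 4) 0)) <|
    .seq (.loop (.natLt (d + 4) (d + 1))
      (.seq (.instr (.natAdd (d + 2) (d + 2) d)) (.instr (.natSub (d + 1) (d + 1) (d + 3)))))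
    (.instr (.natAdd d (d + 2) (d + 4)))

/-- `N[d] := N[d] / N[d + 1]`, rounded down, by repeated subtraction; the result is `0` for
`N[d + 1] = 0`. -/
def divProgram (d : ℕ) : Program :=
  .seq (.instr (.natConst (d + 2) 0)) <| .seq (.instr (.natConst (d + 3) 1)) <|
    .seq (.instr (.natConst (d + 4) 0)) <|
    .seq (.ite (.natLt (d + 4) (d + 1)) (.loop (.natLe (d + 1) d)
      (.seq (.instr (.natSub d d (d + 1))) (.instr (.natAdd (d + 2) (d + 2) (d + 3))))) .skip)
    (.instr (.natAdd d (d + 2) (d + 4)))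

/-- The program that puts the value of the expression into `N[d]`, with the registers
`N[d], N[d + 1], …` as work space. -/
def NExpr.compile (S : ℕ) : NExpr → ℕ → Program
  | .const k, d => .instr (.natConst d k)
  | .var i, d => .seq (.instr (.natConst d 0)) (.instr (.natAdd d i d))
  | .add a b, d =>
      .seq (a.compile S d) <| .seq (b.compile S (d + 1)) (.instr (.natAdd d d (d + 1)))
  | .sub a b, d =>
      .seq (a.compile S d) <| .seq (b.compile S (d + 1)) (.instr (.natSub d d (d + 1)))
  | .mul a b, d => .seq (a.compile S d) <| .seq (b.compile S (d + 1)) (mulProgram d)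
  | .div a b, d => .seq (a.compile S d) <| .seq (b.compile S (d + 1)) (divProgram d)
  | .tab t a, d => .seq (a.compile S d) <| .seq (address S t d) (.instr (.natLoad d d))
  | .ite a b c e, d =>
      .seq (a.compile S d) <| .seq (b.compile S (d + 1)) <|
        .ite (.natLt d (d + 1)) (c.compile S d) (e.compile S d)

/-- The size of the work space that `NExpr.compile` needs. -/
def NExpr.width : NExpr → ℕ
  | .const _ => 1
  | .var _ => 1
  | .add a b => max a.width (b.width + 1)
  | .sub a b => max a.width (b.width + 1)
  | .mul a b => max 5 (max a.width (b.width + 1))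
  | .div a b => max 5 (max a.width (b.width + 1))
  | .tab _ a => max 2 a.width
  | .ite a b c d => max (max a.width (b.width + 1)) (max c.width d.width)

/-- The program that puts the value of the expression into `R[r]`, with the registers
`N[d], N[d + 1], …` and `R[r], R[r + 1], …` as work space. -/
def RExpr.compile (S d : ℕ) : RExpr → ℕ → Program
  | .const k, r => .instr (.realConst r k)
  | .ofNat a, r => .seq (a.compile S d) (.instr (.realOfNat r d))
  | .tab t a, r => .seq (a.compile S d) <| .seq (address S t d) (.instr (.realLoad r d))
  | .input a, r => .seq (a.compile S d) (.instr (.realInput r d))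
  | .add a b, r =>
      .seq (a.compile S d r) <| .seq (b.compile S d (r + 1)) (.instr (.realAdd r r (r + 1)))
  | .sub a b, r =>
      .seq (a.compile S d r) <| .seq (b.compile S d (r + 1)) (.instr (.realSub r r (r + 1)))
  | .mul a b, r =>
      .seq (a.compile S d r) <| .seq (b.compile S d (r + 1)) (.instr (.realMul r r (r + 1)))
  | .div a b, r =>
      .seq (a.compile S d r) <| .seq (b.compile S d (r + 1)) (.instr (.realDiv r r (r + 1)))
  | .ite a b c e, r =>
      .seq (a.compile S d) <| .seq (b.compile S (d + 1)) <|
        .ite (.natLt d (d + 1)) (c.compile S d r) (e.compile S d r)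

/-- The size of the work space that `RExpr.compile` needs, in either kind of registers. -/
def RExpr.width : RExpr → ℕ
  | .const _ => 1
  | .ofNat a => a.width
  | .tab _ a => max 2 a.width
  | .input a => a.width
  | .add a b => max a.width (b.width + 1)
  | .sub a b => max a.width (b.width + 1)
  | .mul a b => max a.width (b.width + 1)
  | .div a b => max a.width (b.width + 1)
  | .ite a b c d => max (max a.width (b.width + 1)) (max c.width d.width)

theorem NExpr.width_pos : ∀ e : NExpr, 1 ≤ e.width
  | .const _ | .var _ => le_rfl
  | .add a b | .sub a b | .mul a b | .div a b | .tab _ a | .ite a b _ _ => by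
    simp [NExpr.width]

theorem RExpr.width_pos : ∀ e : RExpr, 1 ≤ e.width
  | .const _ => le_rfl
  | .ofNat a | .input a => a.width_pos
  | .add a b | .sub a b | .mul a b | .div a b | .tab _ a | .ite a b _ _ => by
    simp [RExpr.width]

/-- The natural registers below `d` and from `S` on are the same in both states. -/
def AgreeNat (S d : ℕ) (s s' : State) : Prop := ∀ i, i < d ∨ S ≤ i → s'.nat i = s.nat i

/-- The real registers below `r` and from `S` on are the same in both states. -/
def AgreeReal (S r : ℕ) (s s' : State) : Prop := ∀ i, i < r ∨ S ≤ i → s'.real i = s.real i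

theorem AgreeNat.trans {S d d' : ℕ} {s s' s'' : State} (h : AgreeNat S d s s')
    (h' : AgreeNat S d' s' s'') (hd : d ≤ d') : AgreeNat S d s s'' := fun i hi =>
  (h' i (by omega)).trans (h i hi)

theorem AgreeReal.trans {S d d' : ℕ} {s s' s'' : State} (h : AgreeReal S d s s')
    (h' : AgreeReal S d' s' s'') (hd : d ≤ d') : AgreeReal S d s s'' := fun i hi =>
  (h' i (by omega)).trans (h i hi)

theorem envOf_congr {S d r : ℕ} {s s' : State} (hd : 3 ≤ d) (h : AgreeNat S d s s')
    (h' : AgreeReal S r s s') : envOf S s' = envOf S s := by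
  simp only [envOf, Env.mk.injEq]
  refine ⟨?_, ?_, ?_⟩
  · funext i; exact h _ (by omega)
  · funext t x; exact h _ (by omega)
  · funext t x; exact h' _ (by omega)

theorem envOf_congr_nat {S d : ℕ} {s s' : State} (hd : 3 ≤ d) (h : AgreeNat S d s s')
    (h' : s'.real = s.real) : envOf S s' = envOf S s :=
  envOf_congr (r := 0) hd h fun i _ => congrFun h' i

theorem const_le_pow {M : ℕ} (hM : 2 ≤ M) (k : ℕ) : k ≤ M ^ k :=
  (Nat.lt_pow_self (by omega)).le

theorem add_le_pow {M a b p q : ℕ} (hM : 2 ≤ M) (ha : a ≤ M ^ p) (hb : b ≤ M ^ q) :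
    a + b ≤ M ^ (p + q + 1) := by
  have h1 : M ^ p ≤ M ^ (p + q) := Nat.pow_le_pow_right (by omega) (by omega)
  have h2 : M ^ q ≤ M ^ (p + q) := Nat.pow_le_pow_right (by omega) (by omega)
  calc a + b ≤ M ^ (p + q) * 2 := by omega
    _ ≤ M ^ (p + q) * M := Nat.mul_le_mul_left _ hM
    _ = M ^ (p + q + 1) := by rw [pow_succ]

theorem mul_le_pow {M a b p q : ℕ} (ha : a ≤ M ^ p) (hb : b ≤ M ^ q) :
    a * b ≤ M ^ (p + q) := by
  rw [pow_add]; exact Nat.mul_le_mul ha hb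

theorem address_runs {S d : ℕ} (t : Fin 4) (hdS : d + 2 ≤ S) :
    Runs inp (address S t d) s 4 (fun s' => s'.nat d = S + (4 * s.nat d + t) ∧
      AgreeNat S d s s' ∧ s'.real = s.real) := by
  refine Runs.instr_seq (T := 3) trivial (Runs.instr_seq (T := 2) trivial
    (Runs.instr_seq (T := 1) trivial (Runs.instr trivial ⟨?_, ?_, rfl⟩)))
  · simp [Instr.run]; ring
  · intro i hi
    have h1 : i ≠ d := by omega
    have h2 : i ≠ d + 1 := by omega
    simp [Instr.run, Function.update_of_ne, h1, h2]

theorem mulProgram_runs {S d : ℕ} (hdS : d + 5 ≤ S) :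
    Runs inp (mulProgram d) s (s.nat (d + 1) * 3 + 5) (fun s' =>
      s'.nat d = s.nat d * s.nat (d + 1) ∧ AgreeNat S d s s' ∧ s'.real = s.real) := by
  have e : s.nat (d + 1) * 3 + 5 = 1 + (1 + (1 + ((s.nat (d + 1) * (2 + 1) + 1) + 1))) := by ring
  rw [e]
  refine Runs.instr_seq trivial (Runs.instr_seq trivial (Runs.instr_seq trivial
    (Runs.seq (Runs.loop (fun i s' => s'.nat d = s.nat d ∧ s'.nat (d + 1) = s.nat (d + 1) - i ∧
      s'.nat (d + 2) = s.nat d * i ∧ s'.nat (d + 3) = 1 ∧ s'.nat (d + 4) = 0 ∧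
      AgreeNat S d s s' ∧ s'.real = s.real) (s.nat (d + 1)) ?_ ?_ ?_) ?_)))
  · refine ⟨by simp [Instr.run], by simp [Instr.run], by simp [Instr.run], by simp [Instr.run],
      by simp [Instr.run], ?_, rfl⟩
    intro i hi
    have h2 : i ≠ d + 2 := by omega
    have h3 : i ≠ d + 3 := by omega
    have h4 : i ≠ d + 4 := by omega
    simp [Instr.run, Function.update_of_ne, h2, h3, h4]
  · rintro i hi s' ⟨h0, h1, h2, h3, h4, ha, hr⟩
    refine ⟨by simp only [Test.Holds, h4, h1]; omega, Runs.instr_seq (T := 1) trivial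
      (Runs.instr trivial ⟨?_, ?_, ?_, ?_, ?_, ?_, hr⟩)⟩
    · simp [Instr.run, h0]
    · simp [Instr.run, h1, h3]; omega
    · simp [Instr.run, h0, h2]; ring
    · simp [Instr.run, h3]
    · simp [Instr.run, h4]
    · intro j hj
      have h1 : j ≠ d + 1 := by omega
      have h2 : j ≠ d + 2 := by omega
      simp [Instr.run, Function.update_of_ne, h1, h2, ha j hj]
  · rintro s' ⟨h0, h1, h2, h3, h4, ha, hr⟩
    simp [Test.Holds, h4, h1]
  · rintro s' ⟨h0, h1, h2, h3, h4, ha, hr⟩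
    refine Runs.instr trivial ⟨by simp [Instr.run, h2, h4], ?_, hr⟩
    intro j hj
    have h1 : j ≠ d := by omega
    simp [Instr.run, Function.update_of_ne, h1, ha j hj]

theorem divProgram_runs {S d : ℕ} (hdS : d + 5 ≤ S) :
    Runs inp (divProgram d) s (s.nat d * 3 + 6) (fun s' =>
      s'.nat d = s.nat d / s.nat (d + 1) ∧ AgreeNat S d s s' ∧ s'.real = s.real) := by
  have e : s.nat d * 3 + 6 = 1 + (1 + (1 + ((1 + (s.nat d * (2 + 1) + 1)) + 1))) := by ring
  rw [e]
  refine Runs.instr_seq trivial (Runs.instr_seq trivial (Runs.instr_seq trivial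
    (Runs.seq (Q := fun s' => s'.nat (d + 2) = s.nat d / s.nat (d + 1) ∧ s'.nat (d + 4) = 0 ∧
      AgreeNat S d s s' ∧ s'.real = s.real) (Runs.ite ?_ ?_) ?_)))
  · intro hc
    have hb : 0 < s.nat (d + 1) := by simpa [Test.Holds, Instr.run] using hc
    set b := s.nat (d + 1) with hbdef
    refine Runs.mono (Runs.loop (T := 2) (fun i s' => s'.nat d = s.nat d - b * i ∧
      s'.nat (d + 1) = b ∧ s'.nat (d + 2) = i ∧ s'.nat (d + 3) = 1 ∧ s'.nat (d + 4) = 0 ∧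
      AgreeNat S d s s' ∧ s'.real = s.real) (s.nat d / b) ?_ ?_ ?_) ?_ ?_
    · refine ⟨by simp [Instr.run], by simp [Instr.run, hbdef], by simp [Instr.run],
        by simp [Instr.run], by simp [Instr.run], ?_, rfl⟩
      intro i hi
      have h2 : i ≠ d + 2 := by omega
      have h3 : i ≠ d + 3 := by omega
      have h4 : i ≠ d + 4 := by omega
      simp [Instr.run, Function.update_of_ne, h2, h3, h4]
    · rintro i hi s' ⟨h0, h1, h2, h3, h4, ha, hr⟩
      have hi' : b * (i + 1) ≤ s.nat d :=
        (Nat.mul_le_mul_left _ hi).trans (Nat.mul_div_le _ _)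
      have hi'' : b * (i + 1) = b * i + b := by ring
      refine ⟨by simp only [Test.Holds, h0, h1]; omega, Runs.instr_seq (T := 1) trivial
        (Runs.instr trivial ⟨?_, ?_, ?_, ?_, ?_, ?_, hr⟩)⟩
      · simp [Instr.run, h0, h1]; omega
      · simp [Instr.run, h1]
      · simp [Instr.run, h2, h3]
      · simp [Instr.run, h3]
      · simp [Instr.run, h4]
      · intro j hj
        have h1 : j ≠ d := by omega
        have h2 : j ≠ d + 2 := by omega
        simp [Instr.run, Function.update_of_ne, h1, h2, ha j hj]
    · rintro s' ⟨h0, h1, h2, h3, h4, ha, hr⟩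
      have := Nat.mod_add_div (s.nat d) b
      have := Nat.mod_lt (s.nat d) hb
      simp only [Test.Holds, h0, h1]; omega
    · have := Nat.div_le_self (s.nat d) b
      omega
    · rintro s' ⟨h0, h1, h2, h3, h4, ha, hr⟩
      exact ⟨h2, h4, ha, hr⟩
  · intro hc
    have hb : s.nat (d + 1) = 0 := by simpa [Test.Holds, Instr.run] using hc
    refine (Runs.skip ?_).mono (Nat.zero_le _) (fun _ h => h)
    refine ⟨by simp [Instr.run, hb], by simp [Instr.run], ?_, rfl⟩
    intro i hi
    have h2 : i ≠ d + 2 := by omega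
    have h3 : i ≠ d + 3 := by omega
    have h4 : i ≠ d + 4 := by omega
    simp [Instr.run, Function.update_of_ne, h2, h3, h4]
  · rintro s' ⟨h2, h4, ha, hr⟩
    refine Runs.instr trivial ⟨by simp [Instr.run, h2, h4], ?_, hr⟩
    intro j hj
    have h1 : j ≠ d := by omega
    simp [Instr.run, Function.update_of_ne, h1, ha j hj]

end RealRAM

namespace RealRAM

/-- The compiled form of a natural expression is correct, and both the value of the expression
and the running time are at most a fixed power of a bound `M` on the numbers in the environment.
The exponent depends on the expression only; multiplication and division are loops, whence the
running time depends on `M`. -/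
theorem NExpr.compile_runs (S : ℕ) (e : NExpr) : ∃ k, ∀ inp d, 3 ≤ d →
    d + e.width ≤ S → ∀ M, 2 ≤ M → ∀ s, (envOf S s).Bounded M → e.eval (envOf S s) ≤ M ^ k ∧
      Runs inp (e.compile S d) s (M ^ k) (fun s' => s'.nat d = e.eval (envOf S s) ∧
        AgreeNat S d s s' ∧ s'.real = s.real) := by
  induction e with
  | const c =>
    refine ⟨c, fun inp d hd hw M hM s hs => ⟨const_le_pow hM c, ?_⟩⟩
    simp only [NExpr.width] at hw
    refine Runs.of_le (Runs.instr trivial ⟨by simp [Instr.run], ?_, rfl⟩)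
      (Nat.one_le_pow _ _ (by omega))
    intro i hi
    have h1 : i ≠ d := by omega
    simp [Instr.run, h1]
  | var i =>
    refine ⟨1, fun inp d hd hw M hM s hs => ⟨by simpa using hs.1 i, ?_⟩⟩
    simp only [NExpr.width] at hw
    refine Runs.of_le (Runs.instr_seq (T := 1) trivial (Runs.instr trivial ⟨?_, ?_, rfl⟩))
      (by simpa using hM)
    · have : (i : ℕ) ≠ d := by omega
      simp [Instr.run, this, envOf]
    · intro i hi
      have h1 : i ≠ d := by omega
      simp [Instr.run, h1]
  | add a b iha ihb =>
    obtain ⟨ka, ha⟩ := iha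
    obtain ⟨kb, hb⟩ := ihb
    refine ⟨ka + (kb + 1 + 1) + 1, fun inp d hd hw M hM s hs => ?_⟩
    simp only [NExpr.width] at hw
    have := b.width_pos
    obtain ⟨ha1, ha2⟩ := ha inp d hd (by omega) M hM s hs
    refine ⟨?_, ?_⟩
    · have hb1 := (hb inp (d + 1) (by omega) (by omega) M hM s hs).1
      refine (add_le_pow hM ha1 hb1).trans (Nat.pow_le_pow_right (by omega) (by omega))
    · refine (ha2.seq (T' := M ^ kb + 1) ?_).of_le
        (add_le_pow hM le_rfl (add_le_pow hM le_rfl (const_le_pow hM 1)))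
      rintro s1 ⟨h1, h1a, h1r⟩
      have hE := envOf_congr_nat hd h1a h1r
      obtain ⟨-, hb2⟩ := hb inp (d + 1) (by omega) (by omega) M hM s1 (hE ▸ hs)
      refine hb2.seq ?_
      rintro s2 ⟨h2, h2a, h2r⟩
      refine Runs.instr trivial ⟨?_, ?_, by simp [Instr.run, h2r, h1r]⟩
      · simp [Instr.run, h2, hE, h2a d (by omega), h1]
      · intro i hi
        have h3 : i ≠ d := by omega
        simp [Instr.run, h3, h2a i (by omega), h1a i hi]
  | sub a b iha ihb =>
    obtain ⟨ka, ha⟩ := iha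
    obtain ⟨kb, hb⟩ := ihb
    refine ⟨ka + (kb + 1 + 1) + 1, fun inp d hd hw M hM s hs => ?_⟩
    simp only [NExpr.width] at hw
    have := b.width_pos
    obtain ⟨ha1, ha2⟩ := ha inp d hd (by omega) M hM s hs
    refine ⟨?_, ?_⟩
    · refine ((Nat.sub_le _ _).trans ha1).trans (Nat.pow_le_pow_right (by omega) (by omega))
    · refine (ha2.seq (T' := M ^ kb + 1) ?_).of_le
        (add_le_pow hM le_rfl (add_le_pow hM le_rfl (const_le_pow hM 1)))
      rintro s1 ⟨h1, h1a, h1r⟩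
      have hE := envOf_congr_nat hd h1a h1r
      obtain ⟨-, hb2⟩ := hb inp (d + 1) (by omega) (by omega) M hM s1 (hE ▸ hs)
      refine hb2.seq ?_
      rintro s2 ⟨h2, h2a, h2r⟩
      refine Runs.instr trivial ⟨?_, ?_, by simp [Instr.run, h2r, h1r]⟩
      · simp [Instr.run, h2, hE, h2a d (by omega), h1]
      · intro i hi
        have h3 : i ≠ d := by omega
        simp [Instr.run, h3, h2a i (by omega), h1a i hi]
  | mul a b iha ihb =>
    obtain ⟨ka, ha⟩ := iha
    obtain ⟨kb, hb⟩ := ihb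
    refine ⟨ka + (kb + ((kb + 3) + 5 + 1) + 1) + 1, fun inp d hd hw M hM s hs => ?_⟩
    simp only [NExpr.width] at hw
    obtain ⟨ha1, ha2⟩ := ha inp d hd (by omega) M hM s hs
    have hb1 := (hb inp (d + 1) (by omega) (by omega) M hM s hs).1
    refine ⟨?_, ?_⟩
    · refine (mul_le_pow ha1 hb1).trans (Nat.pow_le_pow_right (by omega) (by omega))
    · refine (ha2.seq (T' := M ^ kb + (b.eval (envOf S s) * 3 + 5)) ?_).of_le
        (add_le_pow hM le_rfl (add_le_pow hM le_rfl (add_le_pow (p := kb + 3) (q := 5) hM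
          (mul_le_pow hb1 (const_le_pow hM 3)) (const_le_pow hM 5))))
      rintro s1 ⟨h1, h1a, h1r⟩
      have hE := envOf_congr_nat hd h1a h1r
      obtain ⟨-, hb2⟩ := hb inp (d + 1) (by omega) (by omega) M hM s1 (hE ▸ hs)
      refine hb2.seq ?_
      rintro s2 ⟨h2, h2a, h2r⟩
      rw [hE] at h2
      have hd2 : s2.nat d = a.eval (envOf S s) := by rw [h2a d (by omega), h1]
      refine (mulProgram_runs (S := S) (d := d) (by omega)).mono (by rw [h2]) ?_
      rintro s3 ⟨h3, h3a, h3r⟩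
      refine ⟨by simp [h3, h2, hd2], ?_, by rw [h3r, h2r, h1r]⟩
      exact (h1a.trans h2a (by omega)).trans h3a le_rfl
  | div a b iha ihb =>
    obtain ⟨ka, ha⟩ := iha
    obtain ⟨kb, hb⟩ := ihb
    refine ⟨ka + (kb + ((ka + 3) + 6 + 1) + 1) + 1, fun inp d hd hw M hM s hs => ?_⟩
    simp only [NExpr.width] at hw
    obtain ⟨ha1, ha2⟩ := ha inp d hd (by omega) M hM s hs
    refine ⟨?_, ?_⟩
    · refine ((Nat.div_le_self _ _).trans ha1).trans (Nat.pow_le_pow_right (by omega) (by omega))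
    · refine (ha2.seq (T' := M ^ kb + (a.eval (envOf S s) * 3 + 6)) ?_).of_le
        (add_le_pow hM le_rfl (add_le_pow hM le_rfl (add_le_pow (p := ka + 3) (q := 6) hM
          (mul_le_pow ha1 (const_le_pow hM 3)) (const_le_pow hM 6))))
      rintro s1 ⟨h1, h1a, h1r⟩
      have hE := envOf_congr_nat hd h1a h1r
      obtain ⟨-, hb2⟩ := hb inp (d + 1) (by omega) (by omega) M hM s1 (hE ▸ hs)
      refine hb2.seq ?_
      rintro s2 ⟨h2, h2a, h2r⟩
      rw [hE] at h2
      have hd2 : s2.nat d = a.eval (envOf S s) := by rw [h2a d (by omega), h1]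
      refine (divProgram_runs (S := S) (d := d) (by omega)).mono (by rw [hd2]) ?_
      rintro s3 ⟨h3, h3a, h3r⟩
      refine ⟨by simp [h3, h2, hd2], ?_, by rw [h3r, h2r, h1r]⟩
      exact (h1a.trans h2a (by omega)).trans h3a le_rfl
  | tab t a iha =>
    obtain ⟨ka, ha⟩ := iha
    refine ⟨ka + 5 + 1, fun inp d hd hw M hM s hs => ?_⟩
    simp only [NExpr.width] at hw
    obtain ⟨ha1, ha2⟩ := ha inp d hd (by omega) M hM s hs
    refine ⟨?_, ?_⟩
    · refine (hs.2 t _).trans ?_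
      calc M = M ^ 1 := by simp
        _ ≤ _ := Nat.pow_le_pow_right (by omega) (by omega)
    · refine (ha2.seq (T' := 4 + 1) ?_).mono (add_le_pow hM le_rfl (const_le_pow hM 5))
        (fun _ h => h)
      rintro s1 ⟨h1, h1a, h1r⟩
      refine (address_runs (S := S) (d := d) t (by omega)).seq ?_
      rintro s2 ⟨h2, h2a, h2r⟩
      refine Runs.instr trivial ⟨?_, ?_, by simp [Instr.run, h2r, h1r]⟩
      · simp [Instr.run, h2, h1, envOf, (h1a.trans h2a le_rfl) (S + _) (by omega)]
      · intro i hi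
        have h3 : i ≠ d := by omega
        simp [Instr.run, h3, (h1a.trans h2a le_rfl) i hi]
  | ite a b c e iha ihb ihc ihe =>
    obtain ⟨ka, ha⟩ := iha
    obtain ⟨kb, hb⟩ := ihb
    obtain ⟨kc, hc⟩ := ihc
    obtain ⟨ke, he⟩ := ihe
    refine ⟨ka + (kb + (1 + (kc + ke) + 1) + 1) + 1, fun inp d hd hw M hM s hs => ?_⟩
    simp only [NExpr.width] at hw
    have := b.width_pos
    obtain ⟨ha1, ha2⟩ := ha inp d hd (by omega) M hM s hs
    refine ⟨?_, ?_⟩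
    · simp only [NExpr.eval]
      split_ifs
      · exact (hc inp d hd (by omega) M hM s hs).1.trans
          (Nat.pow_le_pow_right (by omega) (by omega))
      · exact (he inp d hd (by omega) M hM s hs).1.trans
          (Nat.pow_le_pow_right (by omega) (by omega))
    · refine (ha2.seq (T' := M ^ kb + (1 + M ^ (kc + ke))) ?_).of_le
        (add_le_pow hM le_rfl (add_le_pow hM le_rfl (add_le_pow hM (const_le_pow hM 1) le_rfl)))
      rintro s1 ⟨h1, h1a, h1r⟩
      have hE := envOf_congr_nat hd h1a h1r
      obtain ⟨-, hb2⟩ := hb inp (d + 1) (by omega) (by omega) M hM s1 (hE ▸ hs)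
      refine hb2.seq ?_
      rintro s2 ⟨h2, h2a, h2r⟩
      have h02 := h1a.trans h2a (by omega)
      have hE2 := envOf_congr_nat hd h02 (h2r.trans h1r)
      rw [hE] at h2
      have hd2 : s2.nat d = a.eval (envOf S s) := by rw [h2a d (by omega), h1]
      refine Runs.ite ?_ ?_
      · intro hlt
        simp only [Test.Holds, h2, hd2] at hlt
        refine (hc inp d hd (by omega) M hM s2 (hE2 ▸ hs)).2.mono
          (Nat.pow_le_pow_right (by omega) (by omega)) ?_
        rintro s3 ⟨h3, h3a, h3r⟩
        exact ⟨by simp [h3, hE2, hlt], h02.trans h3a le_rfl, by rw [h3r, h2r, h1r]⟩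
      · intro hlt
        simp only [Test.Holds, h2, hd2] at hlt
        refine (he inp d hd (by omega) M hM s2 (hE2 ▸ hs)).2.mono
          (Nat.pow_le_pow_right (by omega) (by omega)) ?_
        rintro s3 ⟨h3, h3a, h3r⟩
        exact ⟨by simp [h3, hE2, hlt], h02.trans h3a le_rfl, by rw [h3r, h2r, h1r]⟩

/-- The common part of the four arithmetic operations in `RExpr.compile_runs`. -/
theorem RExpr.compile_binary {inp : List ℝ} {S : ℕ} {a b : RExpr} {ka kb : ℕ}
    {op : ℕ → ℕ → ℕ → Instr} {f : ℝ → ℝ → ℝ} {d r M : ℕ} (hd : 3 ≤ d) (hM : 2 ≤ M)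
    (hrS : r + 2 ≤ S)
    (hop : ∀ s, ((op r r (r + 1)).run inp s) =
      ⟨s.nat, Function.update s.real r (f (s.real r) (s.real (r + 1)))⟩)
    {s : State} (hok : b.Ok inp (envOf S s)) (hs : (envOf S s).Bounded M)
    (hv : ∀ s' : State, s'.real (r + 1) = b.eval inp (envOf S s) → (op r r (r + 1)).Valid s')
    (ha : Runs inp (a.compile S d r) s (M ^ ka) (fun s' => s'.real r = a.eval inp (envOf S s) ∧
        AgreeNat S d s s' ∧ AgreeReal S r s s'))
    (hb : ∀ s, b.Ok inp (envOf S s) → (envOf S s).Bounded M →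
      Runs inp (b.compile S d (r + 1)) s (M ^ kb) (fun s' =>
        s'.real (r + 1) = b.eval inp (envOf S s) ∧ AgreeNat S d s s' ∧
        AgreeReal S (r + 1) s s')) :
    Runs inp (.seq (a.compile S d r) (.seq (b.compile S d (r + 1)) (.instr (op r r (r + 1))))) s
      (M ^ (ka + (kb + 1 + 1) + 1)) (fun s' =>
        s'.real r = f (a.eval inp (envOf S s)) (b.eval inp (envOf S s)) ∧
        AgreeNat S d s s' ∧ AgreeReal S r s s') := by
  refine (ha.seq (T' := M ^ kb + 1) ?_).of_le
    (add_le_pow hM le_rfl (add_le_pow hM le_rfl (const_le_pow hM 1)))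
  rintro s1 ⟨h1, h1a, h1r⟩
  have hE := envOf_congr hd h1a h1r
  refine (hb s1 (hE ▸ hok) (hE ▸ hs)).seq ?_
  rintro s2 ⟨h2, h2a, h2r⟩
  rw [hE] at h2
  refine Runs.instr (hv _ h2) ?_
  rw [hop]
  refine ⟨?_, h1a.trans h2a le_rfl, ?_⟩
  · simp [h2, h2r r (by omega), h1]
  · intro i hi
    have h3 : i ≠ r := by omega
    simp [h3, (h1r.trans h2r (by omega)) i hi]

/-- The compiled form of a real expression is correct if no division by `0` occurs in its
evaluation. -/
theorem RExpr.compile_runs (S : ℕ) (e : RExpr) : ∃ k, ∀ inp d r, 3 ≤ d →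
    d + e.width ≤ S → r + e.width ≤ S → ∀ M, 2 ≤ M → ∀ s, (envOf S s).Bounded M →
      e.Ok inp (envOf S s) →
      Runs inp (e.compile S d r) s (M ^ k) (fun s' => s'.real r = e.eval inp (envOf S s) ∧
        AgreeNat S d s s' ∧ AgreeReal S r s s') := by
  induction e with
  | const c =>
    refine ⟨1, fun inp d r hd hw hw' M hM s hs hok => ?_⟩
    simp only [RExpr.width] at hw'
    refine Runs.of_le (Runs.instr trivial ⟨by simp [Instr.run], fun _ _ => rfl, ?_⟩)
      (by simpa using hM.trans' (by norm_num))
    intro i hi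
    have h1 : i ≠ r := by omega
    simp [Instr.run, h1]
  | ofNat a =>
    obtain ⟨k, ha⟩ := a.compile_runs S
    refine ⟨k + 1 + 1, fun inp d r hd hw hw' M hM s hs hok => ?_⟩
    simp only [RExpr.width] at hw hw'
    have := a.width_pos
    refine ((ha inp d hd hw M hM s hs).2.seq (T' := 1) ?_).of_le
      (add_le_pow hM le_rfl (const_le_pow hM 1))
    rintro s1 ⟨h1, h1a, h1r⟩
    refine Runs.instr trivial ⟨by simp [Instr.run, h1], h1a, ?_⟩
    intro i hi
    have h3 : i ≠ r := by omega
    simp [Instr.run, h3, h1r]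
  | tab t a =>
    obtain ⟨k, ha⟩ := a.compile_runs S
    refine ⟨k + 5 + 1, fun inp d r hd hw hw' M hM s hs hok => ?_⟩
    simp only [RExpr.width] at hw hw'
    refine ((ha inp d hd (by omega) M hM s hs).2.seq (T' := 4 + 1) ?_).of_le
      (add_le_pow hM le_rfl (const_le_pow hM 5))
    rintro s1 ⟨h1, h1a, h1r⟩
    refine (address_runs (S := S) (d := d) t (by omega)).seq ?_
    rintro s2 ⟨h2, h2a, h2r⟩
    refine Runs.instr trivial ⟨?_, h1a.trans h2a le_rfl, ?_⟩
    · simp [Instr.run, h2, h1, h2r, h1r, envOf]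
    · intro i hi
      have h3 : i ≠ r := by omega
      simp [Instr.run, h3, h1r, h2r]
  | input a =>
    obtain ⟨k, ha⟩ := a.compile_runs S
    refine ⟨k + 1 + 1, fun inp d r hd hw hw' M hM s hs hok => ?_⟩
    simp only [RExpr.width] at hw hw'
    have := a.width_pos
    refine ((ha inp d hd hw M hM s hs).2.seq (T' := 1) ?_).of_le
      (add_le_pow hM le_rfl (const_le_pow hM 1))
    rintro s1 ⟨h1, h1a, h1r⟩
    refine Runs.instr trivial ⟨by simp [Instr.run, h1], h1a, ?_⟩
    intro i hi
    have h3 : i ≠ r := by omega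
    simp [Instr.run, h3, h1r]
  | add a b iha ihb =>
    obtain ⟨ka, ha⟩ := iha
    obtain ⟨kb, hb⟩ := ihb
    refine ⟨ka + (kb + 1 + 1) + 1, fun inp d r hd hw hw' M hM s hs hok => ?_⟩
    simp only [RExpr.width] at hw hw'
    have := b.width_pos
    exact RExpr.compile_binary (f := (· + ·)) hd hM (by omega) (fun _ => rfl) hok.2 hs
      (fun _ _ => trivial) (ha inp d r hd (by omega) (by omega) M hM s hs hok.1)
      (fun s hok hs => hb inp d (r + 1) hd (by omega) (by omega) M hM s hs hok)
  | sub a b iha ihb =>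
    obtain ⟨ka, ha⟩ := iha
    obtain ⟨kb, hb⟩ := ihb
    refine ⟨ka + (kb + 1 + 1) + 1, fun inp d r hd hw hw' M hM s hs hok => ?_⟩
    simp only [RExpr.width] at hw hw'
    have := b.width_pos
    exact RExpr.compile_binary (f := (· - ·)) hd hM (by omega) (fun _ => rfl) hok.2 hs
      (fun _ _ => trivial) (ha inp d r hd (by omega) (by omega) M hM s hs hok.1)
      (fun s hok hs => hb inp d (r + 1) hd (by omega) (by omega) M hM s hs hok)
  | mul a b iha ihb =>
    obtain ⟨ka, ha⟩ := iha
    obtain ⟨kb, hb⟩ := ihb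
    refine ⟨ka + (kb + 1 + 1) + 1, fun inp d r hd hw hw' M hM s hs hok => ?_⟩
    simp only [RExpr.width] at hw hw'
    have := b.width_pos
    exact RExpr.compile_binary (f := (· * ·)) hd hM (by omega) (fun _ => rfl) hok.2 hs
      (fun _ _ => trivial) (ha inp d r hd (by omega) (by omega) M hM s hs hok.1)
      (fun s hok hs => hb inp d (r + 1) hd (by omega) (by omega) M hM s hs hok)
  | div a b iha ihb =>
    obtain ⟨ka, ha⟩ := iha
    obtain ⟨kb, hb⟩ := ihb
    refine ⟨ka + (kb + 1 + 1) + 1, fun inp d r hd hw hw' M hM s hs hok => ?_⟩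
    simp only [RExpr.width] at hw hw'
    have := b.width_pos
    exact RExpr.compile_binary (f := (· / ·)) hd hM (by omega) (fun _ => rfl) hok.2.1 hs
      (fun s' h => by simpa [Instr.Valid, h] using hok.2.2)
      (ha inp d r hd (by omega) (by omega) M hM s hs hok.1)
      (fun s hok hs => hb inp d (r + 1) hd (by omega) (by omega) M hM s hs hok)
  | ite a b c e ihc ihe =>
    obtain ⟨ka, ha⟩ := a.compile_runs S
    obtain ⟨kb, hb⟩ := b.compile_runs S
    obtain ⟨kc, hc⟩ := ihc
    obtain ⟨ke, he⟩ := ihe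
    refine ⟨ka + (kb + (1 + (kc + ke) + 1) + 1) + 1, fun inp d r hd hw hw' M hM s hs hok => ?_⟩
    simp only [RExpr.width] at hw hw'
    have := b.width_pos
    obtain ⟨ha1, ha2⟩ := ha inp d hd (by omega) M hM s hs
    refine (ha2.seq (T' := M ^ kb + (1 + M ^ (kc + ke))) ?_).of_le
      (add_le_pow hM le_rfl (add_le_pow hM le_rfl (add_le_pow hM (const_le_pow hM 1) le_rfl)))
    rintro s1 ⟨h1, h1a, h1r⟩
    have hE := envOf_congr_nat hd h1a h1r
    obtain ⟨-, hb2⟩ := hb inp (d + 1) (by omega) (by omega) M hM s1 (hE ▸ hs)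
    refine hb2.seq ?_
    rintro s2 ⟨h2, h2a, h2r⟩
    have h02 := h1a.trans h2a (by omega)
    have hE2 := envOf_congr_nat hd h02 (h2r.trans h1r)
    rw [hE] at h2
    have hd2 : s2.nat d = a.eval (envOf S s) := by rw [h2a d (by omega), h1]
    have h02r : AgreeReal S r s s2 := fun i _ => by rw [h2r, h1r]
    refine Runs.ite ?_ ?_
    · intro hlt
      simp only [Test.Holds, h2, hd2] at hlt
      simp only [RExpr.Ok, hlt, if_true] at hok
      refine (hc inp d r hd (by omega) (by omega) M hM s2 (hE2 ▸ hs) (hE2 ▸ hok)).mono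
        (Nat.pow_le_pow_right (by omega) (by omega)) ?_
      rintro s3 ⟨h3, h3a, h3r⟩
      exact ⟨by simp [h3, hE2, hlt], h02.trans h3a le_rfl, h02r.trans h3r le_rfl⟩
    · intro hlt
      simp only [Test.Holds, h2, hd2] at hlt
      simp only [RExpr.Ok, hlt, if_false] at hok
      refine (he inp d r hd (by omega) (by omega) M hM s2 (hE2 ▸ hs) (hE2 ▸ hok)).mono
        (Nat.pow_le_pow_right (by omega) (by omega)) ?_
      rintro s3 ⟨h3, h3a, h3r⟩
      exact ⟨by simp [h3, hE2, hlt], h02.trans h3a le_rfl, h02r.trans h3r le_rfl⟩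

end RealRAM

namespace RealRAM

/-! ### Filling tables -/

/-- The environment in which entry `x` of the natural table `t` is computed, when the table holds
`g` so far. -/
def Env.setNat (E : Env) (x : ℕ) (t : Fin 4) (g : ℕ → ℕ) : Env where
  var := ![E.var 0, E.var 1, x]
  nat := Function.update E.nat t g
  real := E.real

/-- The environment in which entry `x` of the real table `t` is computed, when the table holds
`g` so far. -/
def Env.setReal (E : Env) (x : ℕ) (t : Fin 4) (g : ℕ → ℝ) : Env where
  var := ![E.var 0, E.var 1, x]
  nat := E.nat
  real := Function.update E.real t g

/-- `for x < len do body`, with the index `x` in `N[2]` and the length in `N[3]`. -/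
def forProgram (S : ℕ) (len : NExpr) (body : Program) : Program :=
  .seq (len.compile S 3) <| .seq (.instr (.natConst 2 0)) <| .loop (.natLt 2 3) <|
    .seq body <| .seq (.instr (.natConst 5 1)) (.instr (.natAdd 2 2 5))

/-- `N[5] :=` the address of entry `N[2]` of table `t`. -/
def indexAddress (S : ℕ) (t : Fin 4) : Program :=
  .seq (.instr (.natConst 5 0)) <| .seq (.instr (.natAdd 5 2 5)) (address S t 5)

/-- The program `for x < len do t[x] := body`, for a table of natural numbers. -/
def fillNat (S : ℕ) (t : Fin 4) (len body : NExpr) : Program :=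
  forProgram S len <|
    .seq (body.compile S 4) <| .seq (indexAddress S t) (.instr (.natStore 5 4))

/-- The program `for x < len do t[x] := body`, for a table of real numbers. -/
def fillReal (S : ℕ) (t : Fin 4) (len : NExpr) (body : RExpr) : Program :=
  forProgram S len <|
    .seq (body.compile S 4 1) <| .seq (indexAddress S t) (.instr (.realStore 5 1))

theorem address_injective {x y : ℕ} {t u : Fin 4} (h : 4 * x + (t : ℕ) = 4 * y + u) :
    x = y ∧ t = u := by
  constructor
  · omega
  · apply Fin.ext; omega

theorem envOf_natStore {S : ℕ} (hS : 3 ≤ S) (s : State) (t : Fin 4) (x v : ℕ) :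
    envOf S ⟨Function.update s.nat (S + (4 * x + t)) v, s.real⟩ =
      ⟨(envOf S s).var, Function.update (envOf S s).nat t
        (Function.update ((envOf S s).nat t) x v), (envOf S s).real⟩ := by
  simp only [envOf, Env.mk.injEq, and_true]
  constructor
  · funext i
    exact Function.update_of_ne (by omega) _ _
  · funext u y
    by_cases hu : u = t
    · subst hu
      by_cases hy : y = x
      · subst hy; simp
      · have : 4 * y ≠ 4 * x := by omega
        simp [hy]
    · have : S + (4 * y + (u : ℕ)) ≠ S + (4 * x + t) := fun h =>
        hu (address_injective (Nat.add_left_cancel h)).2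
      rw [Function.update_of_ne hu]
      exact Function.update_of_ne this _ _

theorem envOf_realStore {S : ℕ} (s : State) (t : Fin 4) (x : ℕ) (v : ℝ) :
    envOf S ⟨s.nat, Function.update s.real (S + (4 * x + t)) v⟩ =
      ⟨(envOf S s).var, (envOf S s).nat, Function.update (envOf S s).real t
        (Function.update ((envOf S s).real t) x v)⟩ := by
  simp only [envOf, Env.mk.injEq, true_and]
  funext u y
  by_cases hu : u = t
  · subst hu
    by_cases hy : y = x
    · subst hy; simp
    · have : 4 * y ≠ 4 * x := by omega
      simp [hy]
  · have : S + (4 * y + (u : ℕ)) ≠ S + (4 * x + t) := fun h =>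
      hu (address_injective (Nat.add_left_cancel h)).2
    rw [Function.update_of_ne hu]
    exact Function.update_of_ne this _ _

theorem envOf_setVar {S : ℕ} (hS : 3 ≤ S) (s : State) (x : ℕ) :
    envOf S ⟨Function.update s.nat 2 x, s.real⟩ =
      ⟨![(envOf S s).var 0, (envOf S s).var 1, x], (envOf S s).nat, (envOf S s).real⟩ := by
  simp only [envOf, Env.mk.injEq, and_true]
  constructor
  · funext i
    fin_cases i <;> simp
  · funext u y
    exact Function.update_of_ne (by omega) _ _

theorem indexAddress_runs {inp : List ℝ} {S : ℕ} (hS : 7 ≤ S) (t : Fin 4) (s : State) :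
    Runs inp (indexAddress S t) s 6 (fun s' => s'.nat 5 = S + (4 * s.nat 2 + t) ∧
      AgreeNat S 5 s s' ∧ s'.real = s.real) := by
  refine Runs.instr_seq (T := 5) trivial (Runs.instr_seq (T := 4) trivial
    ((address_runs (S := S) (d := 5) t (by omega)).mono le_rfl ?_))
  rintro s' ⟨h, ha, hr⟩
  refine ⟨by simp [h, Instr.run], ?_, hr⟩
  intro i hi
  have h5 : i ≠ 5 := by omega
  rw [ha i hi]
  simp [Instr.run, h5]

/-- A loop whose body takes polynomial time takes polynomial time; `I i` is what holds of the
environment before round `i`. -/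
theorem forProgram_runs {S : ℕ} (hS : 7 ≤ S) (len : NExpr)
    (hlen : 3 + len.width ≤ S) (body : Program) (k : ℕ) : ∃ K, ∀ inp M, 2 ≤ M → ∀ s,
    (envOf S s).Bounded M → len.eval (envOf S s) ≤ M → ∀ I : ℕ → Env → Prop,
    (∀ i < len.eval (envOf S s), ∀ s, I i (envOf S s) → (envOf S s).var 2 = i →
      Runs inp body s (M ^ k) (fun s' => s'.nat 2 = i ∧ s'.nat 3 = s.nat 3 ∧
        I (i + 1) ⟨![(envOf S s').var 0, (envOf S s').var 1, i + 1], (envOf S s').nat,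
          (envOf S s').real⟩)) →
    I 0 ⟨![(envOf S s).var 0, (envOf S s).var 1, 0], (envOf S s).nat, (envOf S s).real⟩ →
    Runs inp (forProgram S len body) s (M ^ K)
      (fun s' => I (len.eval (envOf S s)) (envOf S s')) := by
  obtain ⟨kl, hl⟩ := len.compile_runs S
  refine ⟨kl + (1 + (1 + (k + 3 + 1) + 1 + 1) + 1) + 1, fun inp M hM s hs hL I hbody h0 => ?_⟩
  set L := len.eval (envOf S s) with hLdef
  have hround : M ^ k + 3 ≤ M ^ (k + 3 + 1) := add_le_pow hM le_rfl (const_le_pow hM 3)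
  have hloop : L * (M ^ k + 3) ≤ M ^ (1 + (k + 3 + 1)) := mul_le_pow (by simpa using hL) hround
  have hloop' : L * (M ^ k + 3) + 1 ≤ M ^ (1 + (k + 3 + 1) + 1 + 1) :=
    add_le_pow hM hloop (const_le_pow hM 1)
  refine Runs.of_le ((hl inp 3 le_rfl hlen M hM s hs).2.seq
    (T' := 1 + (L * ((M ^ k + 2) + 1) + 1)) ?_)
    (add_le_pow hM le_rfl (add_le_pow hM (const_le_pow hM 1) hloop'))
  rintro s1 ⟨h1, h1a, h1r⟩
  have hE := envOf_congr_nat le_rfl h1a h1r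
  refine Runs.instr_seq trivial ?_
  refine (Runs.loop (fun i s' => I i (envOf S s') ∧ s'.nat 2 = i ∧ s'.nat 3 = L) L ?_ ?_ ?_).mono
    le_rfl (fun _ h => h.1)
  · refine ⟨?_, by simp [Instr.run], by simp [Instr.run, h1, hLdef]⟩
    simp only [Instr.run]
    rw [envOf_setVar (by omega), hE]
    exact h0
  · rintro i hi s2 ⟨hI, h2, h3⟩
    refine ⟨by simpa [Test.Holds, h2, h3] using hi, ?_⟩
    refine (hbody i hi s2 hI h2).seq ?_
    rintro s3 ⟨h32, h33, hfin⟩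
    refine Runs.instr_seq (T := 1) trivial (Runs.instr trivial ⟨?_, ?_, ?_⟩)
    · have h5 : envOf S ⟨Function.update s3.nat 5 1, s3.real⟩ = envOf S s3 := by
        refine envOf_congr_nat (d := 3) le_rfl (fun j hj => ?_) rfl
        have : j ≠ 5 := by omega
        simp [this]
      simp only [Instr.run]
      rw [envOf_setVar (s := ⟨Function.update s3.nat 5 1, s3.real⟩) (by omega), h5]
      simpa [h32] using hfin
    · simp [Instr.run, h32]
    · simp [Instr.run, h33, h3]
  · rintro s2 ⟨hI, h2, h3⟩
    simp [Test.Holds, h2, h3]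

/-- Filling a table of natural numbers by a recursion in which every entry may use the earlier
ones: if `body` computes the entries `V x` correctly, the table ends up holding `V`. -/
theorem fillNat_runs {S : ℕ} (hS : 7 ≤ S) (t : Fin 4) {len body : NExpr}
    (hlen : 3 + len.width ≤ S) (hbody : 4 + body.width ≤ S) : ∃ K, ∀ inp M, 2 ≤ M → ∀ s,
    (envOf S s).Bounded M → len.eval (envOf S s) ≤ M → ∀ V : ℕ → ℕ,
    (∀ x < len.eval (envOf S s), V x ≤ M) →
    (∀ x < len.eval (envOf S s), ∀ g : ℕ → ℕ, (∀ y < x, g y = V y) →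
      body.eval ((envOf S s).setNat x t g) = V x) →
    Runs inp (fillNat S t len body) s (M ^ K) (fun s' => ∃ g : ℕ → ℕ,
      envOf S s' = (envOf S s).setNat (len.eval (envOf S s)) t g ∧
      (∀ y < len.eval (envOf S s), g y = V y) ∧ (envOf S s').Bounded M) := by
  obtain ⟨kb, hb⟩ := body.compile_runs S
  obtain ⟨K, hK⟩ := forProgram_runs hS len hlen
    (.seq (body.compile S 4) <| .seq (indexAddress S t) (.instr (.natStore 5 4))) (kb + 7 + 1)
  refine ⟨K, fun inp M hM s hs hL V hV hspec => ?_⟩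
  set E := envOf S s with hE
  set L := len.eval E with hLdef
  refine (hK inp M hM s hs hL (fun i E' => ∃ g : ℕ → ℕ, E' = E.setNat i t g ∧ (∀ y < i, g y = V y) ∧
    E'.Bounded M) ?_ ?_).mono le_rfl (fun _ h => h)
  · rintro i hi s1 ⟨g, hg, hgV, hB⟩ hvar
    have hi : i < L := hi
    refine Runs.of_le (((hb inp 4 (by omega) hbody M hM s1 hB).2).seq (T' := 6 + 1) ?_)
      (add_le_pow hM le_rfl (const_le_pow hM 7))
    rintro s2 ⟨h2, h2a, h2r⟩
    refine (indexAddress_runs hS t s2).seq ?_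
    rintro s3 ⟨h3, h3a, h3r⟩
    have hval : s3.nat 4 = V i := by
      rw [h3a 4 (by omega), h2, hg, hspec i hi g hgV]
    have hE3 : envOf S s3 = E.setNat i t g := by
      rw [envOf_congr_nat (by omega) h3a h3r, envOf_congr_nat (by omega) h2a h2r, hg]
    have hs22 : s2.nat 2 = i := by rw [h2a 2 (by omega)]; exact hvar
    have hs32 : s3.nat 2 = i := by rw [h3a 2 (by omega), hs22]
    rw [hs22] at h3
    have hne2 : 2 ≠ S + (4 * i + (t : ℕ)) := by omega
    have hne3 : 3 ≠ S + (4 * i + (t : ℕ)) := by omega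
    refine Runs.instr trivial ⟨?_, ?_, Function.update g i (V i), ?_, ?_, ?_⟩
    · simp [Instr.run, h3, hs32, hne2]
    · simp [Instr.run, h3, hne3, h3a 3 (by omega), h2a 3 (by omega)]
    · simp only [Instr.run, h3, hval]
      rw [envOf_natStore (by omega), hE3]
      simp [Env.setNat]
    · intro y hy
      by_cases hyi : y = i
      · simp [hyi]
      · simp [hyi, hgV y (by omega)]
    · simp only [Instr.run, h3, hval]
      rw [envOf_natStore (by omega), hE3]
      refine ⟨?_, ?_⟩
      · have h0 := hs.1 0
        have h1 := hs.1 1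
        have : i + 1 ≤ M := by omega
        intro j
        fin_cases j <;> simp [Env.setNat] <;> assumption
      · intro u y
        have := hB.2 u y
        rw [hg] at this
        by_cases hu : u = t
        · subst hu
          simp only [Env.setNat, Function.update_self] at this ⊢
          by_cases hyi : y = i
          · simp [hyi, hV i hi]
          · simpa [hyi] using this
        · simpa [Env.setNat, hu] using this
  · refine ⟨E.nat t, by simp [Env.setNat, hE], by simp, ?_, hs.2⟩
    have h0 := hs.1 0
    have h1 := hs.1 1
    intro j
    fin_cases j <;> simp <;> assumption

/-- Filling a table of real numbers by a recursion in which every entry may use the earlier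
ones. -/
theorem fillReal_runs {S : ℕ} (hS : 7 ≤ S) (t : Fin 4) {len : NExpr}
    {body : RExpr} (hlen : 3 + len.width ≤ S) (hbody : 4 + body.width ≤ S) :
    ∃ K, ∀ inp M, 2 ≤ M → ∀ s,
    (envOf S s).Bounded M → len.eval (envOf S s) ≤ M → ∀ V : ℕ → ℝ,
    (∀ x < len.eval (envOf S s), ∀ g : ℕ → ℝ, (∀ y < x, g y = V y) →
      body.Ok inp ((envOf S s).setReal x t g) ∧
      body.eval inp ((envOf S s).setReal x t g) = V x) →
    Runs inp (fillReal S t len body) s (M ^ K) (fun s' => ∃ g : ℕ → ℝ,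
      envOf S s' = (envOf S s).setReal (len.eval (envOf S s)) t g ∧
      (∀ y < len.eval (envOf S s), g y = V y) ∧ (envOf S s').Bounded M) := by
  obtain ⟨kb, hb⟩ := body.compile_runs S
  obtain ⟨K, hK⟩ := forProgram_runs hS len hlen
    (.seq (body.compile S 4 1) <| .seq (indexAddress S t) (.instr (.realStore 5 1))) (kb + 7 + 1)
  refine ⟨K, fun inp M hM s hs hL V hspec => ?_⟩
  set E := envOf S s with hE
  set L := len.eval E with hLdef
  refine (hK inp M hM s hs hL (fun i E' => ∃ g : ℕ → ℝ, E' = E.setReal i t g ∧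
    (∀ y < i, g y = V y) ∧ E'.Bounded M) ?_ ?_).mono le_rfl (fun _ h => h)
  · rintro i hi s1 ⟨g, hg, hgV, hB⟩ hvar
    have hi : i < L := hi
    obtain ⟨hok, hval⟩ := hspec i hi g hgV
    refine Runs.of_le ((hb inp 4 1 (by omega) hbody (by omega) M hM s1 hB (hg ▸ hok)).seq
      (T' := 6 + 1) ?_) (add_le_pow hM le_rfl (const_le_pow hM 7))
    rintro s2 ⟨h2, h2a, h2r⟩
    refine (indexAddress_runs hS t s2).seq ?_
    rintro s3 ⟨h3, h3a, h3r⟩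
    have hval : s3.real 1 = V i := by
      rw [h3r, h2, hg, hval]
    have hE3 : envOf S s3 = E.setReal i t g := by
      rw [envOf_congr_nat (by omega) h3a h3r, envOf_congr (by omega) h2a h2r, hg]
    have hs22 : s2.nat 2 = i := by rw [h2a 2 (by omega)]; exact hvar
    have hs32 : s3.nat 2 = i := by rw [h3a 2 (by omega), hs22]
    rw [hs22] at h3
    refine Runs.instr trivial ⟨?_, ?_, Function.update g i (V i), ?_, ?_, ?_⟩
    · simp [Instr.run, hs32]
    · simp [Instr.run, h3a 3 (by omega), h2a 3 (by omega)]
    · simp only [Instr.run, h3, hval]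
      rw [envOf_realStore, hE3]
      simp [Env.setReal]
    · intro y hy
      by_cases hyi : y = i
      · simp [hyi]
      · simp [hyi, hgV y (by omega)]
    · simp only [Instr.run, h3, hval]
      rw [envOf_realStore, hE3]
      refine ⟨?_, ?_⟩
      · have h0 := hs.1 0
        have h1 := hs.1 1
        have : i + 1 ≤ M := by omega
        intro j
        fin_cases j <;> simp [Env.setReal] <;> assumption
      · exact hs.2
  · refine ⟨E.real t, by simp [Env.setReal, hE], by simp, ?_, hs.2⟩
    have h0 := hs.1 0
    have h1 := hs.1 1
    intro j
    fin_cases j <;> simp <;> assumption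

end RealRAM

/-! ### Spin systems with interactions of order at most three -/

namespace SpinSystem

open Finset Real

/-- A finite list of monomials `ξ_i ξ_j ξ_k`, indexed by `τ < card`. -/
structure Terms where
  card : ℕ
  i : ℕ → ℕ
  j : ℕ → ℕ
  k : ℕ → ℕ

variable (T : Terms)

/-- The vertex `v` occurs in the monomial `τ`. -/
def Terms.Mem (v τ : ℕ) : Prop := T.i τ = v ∨ T.j τ = v ∨ T.k τ = v

instance (v τ : ℕ) : Decidable (T.Mem v τ) := inferInstanceAs (Decidable (_ ∨ _ ∨ _))

/-- The vertex `v` does not occur twice in the monomial `τ`. -/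
def Terms.Once (v τ : ℕ) : Prop :=
  ¬(T.i τ = v ∧ T.j τ = v) ∧ ¬(T.i τ = v ∧ T.k τ = v) ∧ ¬(T.j τ = v ∧ T.k τ = v)

/-- The spin of `u` in the configuration whose set of negative spins is `s`. -/
def spin (s : Finset ℕ) (u : ℕ) : ℝ := if u ∈ s then -1 else 1

/-- The value of the monomial `τ` at a configuration. -/
def Terms.monomial (s : Finset ℕ) (τ : ℕ) : ℝ :=
  spin s (T.i τ) * spin s (T.j τ) * spin s (T.k τ)

/-- The polynomial with coefficients `w`. -/
def Terms.energy (w : ℕ → ℝ) (s : Finset ℕ) : ℝ := ∑ τ ∈ range T.card, w τ * T.monomial s τ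

/-- The partition function over the spins in `A`; all other spins are `+1`. -/
noncomputable def Terms.Z (w : ℕ → ℝ) (A : Finset ℕ) : ℝ := ∑ s ∈ A.powerset, exp (T.energy w s)

/-- The coefficients after the substitution `ξ_v ↦ -ξ_v`. -/
def Terms.flip (v : ℕ) (w : ℕ → ℝ) (τ : ℕ) : ℝ := if T.Mem v τ then -w τ else w τ

/-- The odds `P(ξ_v = -1) / P(ξ_v = 1)`; this is `0` for a vertex outside `A`, whose spin is
`+1`. -/
noncomputable def Terms.odds (w : ℕ → ℝ) (A : Finset ℕ) (v : ℕ) : ℝ :=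
  if v ∈ A then T.Z (T.flip v w) (A.erase v) / T.Z w (A.erase v) else 0

/-- No free spin occurs twice in a monomial with a non-zero coefficient. -/
def Terms.Simple (w : ℕ → ℝ) (A : Finset ℕ) : Prop :=
  ∀ τ < T.card, w τ ≠ 0 → ∀ v ∈ A, T.Once v τ

variable {T} {w w' : ℕ → ℝ} {A B s : Finset ℕ} {v τ : ℕ}

theorem Terms.monomial_insert (hv : v ∉ s) (h : T.Once v τ) :
    T.monomial (insert v s) τ = if T.Mem v τ then -T.monomial s τ else T.monomial s τ := by
  have hs : ∀ u, spin (insert v s) u = if u = v then -1 else spin s u := by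
    intro u
    by_cases hu : u = v <;> simp [spin, hu]
  have hsv : spin s v = 1 := by simp [spin, hv]
  obtain ⟨h1, h2, h3⟩ := h
  simp only [Terms.monomial, hs, Terms.Mem]
  by_cases hi : T.i τ = v
  · have hj : T.j τ ≠ v := fun h => h1 ⟨hi, h⟩
    have hk : T.k τ ≠ v := fun h => h2 ⟨hi, h⟩
    simp [hi, hj, hk, hsv]
  · by_cases hj : T.j τ = v
    · have hk : T.k τ ≠ v := fun h => h3 ⟨hj, h⟩
      simp [hi, hj, hk, hsv]
    · by_cases hk : T.k τ = v <;> simp [hi, hj, hk, hsv]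

theorem Terms.energy_insert (hv : v ∉ s) (h : ∀ τ < T.card, w τ ≠ 0 → T.Once v τ) :
    T.energy w (insert v s) = T.energy (T.flip v w) s := by
  refine sum_congr rfl fun τ hτ => ?_
  by_cases h0 : w τ = 0
  · simp [h0, Terms.flip]
  · rw [Terms.monomial_insert hv (h τ (mem_range.1 hτ) h0), Terms.flip]
    split_ifs <;> ring

theorem Terms.Z_pos : 0 < T.Z w A :=
  sum_pos (fun _ _ => exp_pos _) ⟨∅, empty_mem_powerset A⟩

/-- The configurations with `ξ_v = 1` and those with `ξ_v = -1`. -/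
theorem Terms.Z_erase (hA : T.Simple w A) (hv : v ∈ A) :
    T.Z w A = T.Z w (A.erase v) + T.Z (T.flip v w) (A.erase v) := by
  conv_lhs => rw [← insert_erase hv]
  rw [Terms.Z, sum_powerset_insert (notMem_erase v A)]
  congr 1
  refine sum_congr rfl fun s hs => ?_
  rw [Terms.energy_insert (fun h => notMem_erase v A (mem_powerset.1 hs h))
    fun τ hτ h0 => hA τ hτ h0 v hv]

theorem Terms.odds_nonneg : 0 ≤ T.odds w A v := by
  unfold Terms.odds
  split_ifs
  · exact (div_pos Terms.Z_pos Terms.Z_pos).le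
  · exact le_rfl

theorem Terms.odds_of_notMem (hv : v ∉ A) : T.odds w A v = 0 := by
  simp [Terms.odds, hv]

theorem Terms.Z_eq_mul (hA : T.Simple w A) (hv : v ∈ A) :
    T.Z w A = T.Z w (A.erase v) * (1 + T.odds w A v) := by
  rw [Terms.Z_erase hA hv, Terms.odds, if_pos hv]
  have := (Terms.Z_pos (T := T) (w := w) (A := A.erase v)).ne'
  field_simp

theorem Terms.Simple.mono (h : T.Simple w A) (hw : ∀ τ, w' τ ≠ 0 → w τ ≠ 0) (hB : B ⊆ A) :
    T.Simple w' B := fun τ hτ h0 v hv => h τ hτ (hw τ h0) v (hB hv)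

theorem Terms.abs_flip : |T.flip v w τ| = |w τ| := by
  unfold Terms.flip; split_ifs <;> simp

theorem Terms.flip_ne_zero (h : T.flip v w τ ≠ 0) : w τ ≠ 0 := by
  rwa [← abs_pos, Terms.abs_flip, abs_pos] at h

/-- The partition function is a product of one factor for each spin. -/
theorem Terms.Z_eq_prod {n : ℕ} (hA : T.Simple w (range n)) :
    T.Z w (range n) = (∏ τ ∈ range T.card, exp (w τ)) *
      ∏ r ∈ range n, (1 + T.odds w (Ico r n) r) := by
  have key : ∀ r ≤ n, T.Z w (range n) = T.Z w (Ico r n) *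
      ∏ r ∈ range r, (1 + T.odds w (Ico r n) r) := by
    intro r
    induction r with
    | zero => intro _; simp
    | succ r ih =>
      intro hr
      have hsub : Ico r n ⊆ range n := fun x hx => mem_range.2 (mem_Ico.1 hx).2
      have he : (Ico r n).erase r = Ico (r + 1) n := by
        ext x; simp only [mem_erase, mem_Ico]; omega
      rw [ih (by omega), prod_range_succ,
        Terms.Z_eq_mul (hA.mono (fun _ h => h) hsub) (v := r) (by simp; omega), he]
      ring
  have h0 : T.Z w ∅ = ∏ τ ∈ range T.card, exp (w τ) := by
    simp [Terms.Z, Terms.energy, Terms.monomial, spin, exp_sum]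
  rw [key n le_rfl, Ico_self, h0]

/-! ### The recursion for the odds -/

variable (T)

/-- The coefficients after `ξ_v = -1` in the monomials before `τ` and `ξ_v = 1` in those after
`τ`, with the monomial `τ` dropped if it contains `v`. -/
def Terms.cut (v t : ℕ) (w : ℕ → ℝ) (τ : ℕ) : ℝ :=
  if T.Mem v τ then (if τ < t then -w τ else if τ = t then 0 else w τ) else w τ

/-- The coefficients after `ξ_v = -1` in the monomials before `τ` and `ξ_v = 1` elsewhere. -/
def Terms.hybrid (v t : ℕ) (w : ℕ → ℝ) (τ : ℕ) : ℝ :=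
  if T.Mem v τ ∧ τ < t then -w τ else w τ

/-- For a monomial that contains `v`, the first one of the other two vertices. -/
def Terms.fst (v τ : ℕ) : ℕ := if T.i τ = v then T.j τ else T.i τ

/-- For a monomial that contains `v`, the second one of the other two vertices. -/
def Terms.snd (v τ : ℕ) : ℕ := if T.i τ = v ∨ T.j τ = v then T.k τ else T.j τ

/-- The vertex whose spin is fixed in branch `κ` of the recursion at the monomial `τ ∋ v`. -/
def Terms.pin (v τ κ : ℕ) : ℕ := if κ < 2 then T.fst v τ else T.snd v τ

/-- The vertex whose odds are taken in branch `κ` of the recursion at the monomial `τ ∋ v`. -/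
def Terms.query (v τ κ : ℕ) : ℕ := if κ < 2 then T.snd v τ else T.fst v τ

/-- The coefficients in branch `κ`: the pinned spin is `1` for even `κ` and `-1` for odd `κ`. -/
def Terms.branch (v τ κ : ℕ) (w : ℕ → ℝ) : ℕ → ℝ :=
  if κ % 2 = 1 then T.flip (T.pin v τ κ) (T.cut v τ w) else T.cut v τ w

/-- The factor of the odds of `v` that comes from a monomial `ξ_v ξ_y ξ_z` with coefficient `w`,
in terms of `q = e^{2 w}` and the odds `σ` of `ξ_y ξ_z`. -/
noncomputable def factor (q σ : ℝ) : ℝ := (1 + q * σ) / (q + σ)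

/-- The odds of `ξ_y ξ_z` in terms of the odds of `z` given `ξ_y = ± 1` (`o 0` and `o 1`) and
those of `y` given `ξ_z = ± 1` (`o 2` and `o 3`). -/
noncomputable def pairOdds (o : ℕ → ℝ) : ℝ := o 0 / (1 + o 0 * o 3) + o 2 / (1 + o 2 * o 1)

variable {T}

/-- `factor` is the ratio of the partition functions at `-u` and at `u` if the configurations whose
value at the monomial is `1` and `-1` contribute `P` and `M`. -/
theorem factor_eq {u P M : ℝ} (hP : 0 < P) (hM : 0 ≤ M) :
    (exp (-u) * P + exp u * M) / (exp u * P + exp (-u) * M) = factor (exp (2 * u)) (M / P) := by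
  have h2 : exp (2 * u) = exp u * exp u := by rw [← exp_add]; ring_nf
  rw [factor, h2, exp_neg]
  have hu := exp_pos u
  field_simp

theorem factor_one {σ : ℝ} (hσ : 0 ≤ σ) : factor 1 σ = 1 := by
  rw [factor, one_mul, div_self (by positivity)]

theorem factor_pos {q σ : ℝ} (hq : 0 < q) (hσ : 0 ≤ σ) : 0 < factor q σ := by
  unfold factor; positivity

theorem pairOdds_nonneg {o : ℕ → ℝ} (ho : ∀ κ < 4, 0 ≤ o κ) : 0 ≤ pairOdds o := by
  have := ho 0 (by norm_num)
  have := ho 1 (by norm_num)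
  have := ho 2 (by norm_num)
  have := ho 3 (by norm_num)
  unfold pairOdds; positivity

theorem Terms.flip_update (p : ℕ) (u : ℝ) : T.flip p (Function.update w τ u) =
    Function.update (T.flip p w) τ (if T.Mem p τ then -u else u) := by
  funext x
  by_cases hx : x = τ
  · subst hx; simp [Terms.flip]
  · simp [Terms.flip, hx]

theorem Terms.flip_comm (p q : ℕ) : T.flip p (T.flip q w) = T.flip q (T.flip p w) := by
  funext x
  simp only [Terms.flip]
  split_ifs <;> rfl

theorem Terms.cut_apply_self (hv : T.Mem v τ) : T.cut v τ w τ = 0 := by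
  simp [Terms.cut, hv]

theorem Terms.update_cut_self (hv : T.Mem v τ) :
    Function.update (T.cut v τ w) τ (w τ) = T.hybrid v τ w := by
  funext x
  rcases lt_trichotomy x τ with h | h | h
  · simp [Terms.cut, Terms.hybrid, h, h.ne]
  · subst h; simp [Terms.hybrid]
  · simp [Terms.cut, Terms.hybrid, h.ne', h.not_gt]

theorem Terms.update_cut_neg (hv : T.Mem v τ) :
    Function.update (T.cut v τ w) τ (-w τ) = T.hybrid v (τ + 1) w := by
  funext x
  rcases lt_trichotomy x τ with h | h | h
  · simp [Terms.cut, Terms.hybrid, h, h.ne, Nat.lt_succ_of_lt h]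
  · subst h; simp [Terms.hybrid, hv]
  · have : ¬ x < τ + 1 := by omega
    simp [Terms.cut, Terms.hybrid, h.ne', h.not_gt, this]

theorem Terms.abs_cut_le (t : ℕ) : |T.cut v t w τ| ≤ |w τ| := by
  unfold Terms.cut; split_ifs <;> simp

theorem Terms.abs_branch_le (t κ : ℕ) : |T.branch v t κ w τ| ≤ |w τ| := by
  unfold Terms.branch; split_ifs
  · rw [Terms.abs_flip]; exact Terms.abs_cut_le t
  · exact Terms.abs_cut_le t

theorem Terms.cut_ne_zero {t : ℕ} (h : T.cut v t w τ ≠ 0) : w τ ≠ 0 := by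
  rw [← abs_pos] at h ⊢
  exact h.trans_le (Terms.abs_cut_le t)

theorem Terms.mem_fst : T.Mem (T.fst v τ) τ := by
  unfold Terms.fst Terms.Mem; split_ifs <;> simp

theorem Terms.mem_snd : T.Mem (T.snd v τ) τ := by
  unfold Terms.snd Terms.Mem; split_ifs <;> simp

theorem Terms.fst_ne_snd {p : ℕ} (hp : T.Once p τ) (h : T.fst v τ = p) : T.snd v τ ≠ p := by
  rintro h'
  obtain ⟨h1, h2, h3⟩ := hp
  unfold Terms.fst at h
  unfold Terms.snd at h'
  split_ifs at h h' <;> tauto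

theorem Terms.eq_of_mem {u : ℕ} (hv : T.Mem v τ) (hu : T.Mem u τ) :
    u = v ∨ u = T.fst v τ ∨ u = T.snd v τ := by
  unfold Terms.fst Terms.snd
  unfold Terms.Mem at hv hu
  split_ifs <;> grind

/-- A monomial none of whose spins is free only contributes a constant. -/
theorem Terms.Z_update (hτ : τ < T.card) (h0 : w τ = 0) (hA : ∀ u ∈ A, ¬ T.Mem u τ) (u : ℝ) :
    T.Z (Function.update w τ u) A = exp u * T.Z w A := by
  rw [Terms.Z, Terms.Z, mul_sum]
  refine sum_congr rfl fun s hs => ?_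
  rw [← exp_add]
  congr 1
  have hm : T.monomial s τ = 1 := by
    have hs' : ∀ u, T.Mem u τ → u ∉ s := fun u hu h => hA u (mem_powerset.1 hs h) hu
    simp [Terms.monomial, spin, hs' (T.i τ) (Or.inl rfl), hs' (T.j τ) (Or.inr (Or.inl rfl)),
      hs' (T.k τ) (Or.inr (Or.inr rfl))]
  rw [Terms.energy, Terms.energy, ← add_sum_erase _ _ (mem_range.2 hτ),
    ← add_sum_erase _ (fun x => w x * _) (mem_range.2 hτ)]
  simp only [Function.update_self, hm, h0]
  rw [sum_congr rfl fun x hx => by rw [Function.update_of_ne (ne_of_mem_erase hx)]]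
  ring

/-- How the partition function depends on the coefficient of one monomial: the ratio of its
values at `-w` and `w` is determined by the odds of the product of the spins in the monomial. -/
theorem Terms.Z_hybrid_succ (hA : T.Simple w A) (hτ : τ < T.card) (hm : T.Mem v τ)
    (hw : w τ ≠ 0) :
    T.Z (T.hybrid v (τ + 1) w) (A.erase v) / T.Z (T.hybrid v τ w) (A.erase v) =
      factor (exp (2 * w τ)) (pairOdds fun κ => T.odds (T.branch v τ κ w)
        ((A.erase v).erase (T.pin v τ κ)) (T.query v τ κ)) := by
  set A' := A.erase v with hA'
  set y := T.fst v τ with hy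
  set z := T.snd v τ with hz
  set c := T.cut v τ w with hc
  have hsub : A' ⊆ A := erase_subset _ _
  have hyτ : T.Mem y τ := Terms.mem_fst
  have hzτ : T.Mem z τ := Terms.mem_snd
  have hcτ : c τ = 0 := Terms.cut_apply_self hm
  set A₃ := (A'.erase y).erase z with hA₃
  have hA₃' : (A'.erase z).erase y = A₃ := erase_right_comm
  have hy₃ : y ∉ A₃ := by rw [← hA₃']; exact notMem_erase _ _
  have hz₃ : z ∉ A₃ := notMem_erase _ _
  have hfree : ∀ u ∈ A₃, ¬ T.Mem u τ := by
    intro u hu hmem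
    simp only [hA₃, hA', mem_erase] at hu
    rcases Terms.eq_of_mem hm hmem with h | h | h <;> tauto
  have hup : ∀ u, T.Simple (Function.update c τ u) A' := by
    intro u x hx h0 p hp
    by_cases hxτ : x = τ
    · subst hxτ; exact hA x hx hw p (hsub hp)
    · rw [Function.update_of_ne hxτ] at h0
      exact hA x hx (Terms.cut_ne_zero h0) p (hsub hp)
  have hupf : ∀ p u, T.Simple (T.flip p (Function.update c τ u)) A' := fun p u =>
    (hup u).mono (fun _ => Terms.flip_ne_zero) subset_rfl
  have hpin0 : T.pin v τ 0 = y := rfl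
  have hpin1 : T.pin v τ 1 = y := rfl
  have hpin2 : T.pin v τ 2 = z := rfl
  have hpin3 : T.pin v τ 3 = z := rfl
  have hq0 : T.query v τ 0 = z := rfl
  have hq1 : T.query v τ 1 = z := rfl
  have hq2 : T.query v τ 2 = y := rfl
  have hq3 : T.query v τ 3 = y := rfl
  have hb0 : T.branch v τ 0 w = c := rfl
  have hb1 : T.branch v τ 1 w = T.flip y c := rfl
  have hb2 : T.branch v τ 2 w = c := rfl
  have hb3 : T.branch v τ 3 w = T.flip z c := rfl
  have hfzero : ∀ p, T.flip p c τ = 0 := fun p => by simp [Terms.flip, hcτ]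
  -- the partial sums with `ξ_y ξ_z = 1` and `ξ_y ξ_z = -1`
  obtain ⟨P, M, hP, hM, hZ, hσ⟩ : ∃ P M : ℝ, 0 < P ∧ 0 ≤ M ∧
      (∀ u, T.Z (Function.update c τ u) A' = exp u * P + exp (-u) * M) ∧
      (pairOdds fun κ => T.odds (T.branch v τ κ w) (A'.erase (T.pin v τ κ)) (T.query v τ κ)) =
        M / P := by
    have ha := Terms.Z_pos (T := T) (w := c) (A := A₃)
    have hC := Terms.Z_pos (T := T) (w := T.flip z c) (A := A₃)
    have hD := Terms.Z_pos (T := T) (w := T.flip y c) (A := A₃)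
    have hB := Terms.Z_pos (T := T) (w := T.flip z (T.flip y c)) (A := A₃)
    simp only [pairOdds, hpin0, hpin1, hpin2, hpin3, hq0, hq1, hq2, hq3, hb0, hb1, hb2, hb3]
    -- a vertex outside `A'` has spin `1`, so that its odds vanish
    by_cases hyA : y ∈ A'
    · by_cases hzA : z ∈ A'
      · have hzy : z ≠ y := Terms.fst_ne_snd (hA τ hτ hw y (hsub hyA)) rfl
        have hzA' : z ∈ A'.erase y := mem_erase.2 ⟨hzy, hzA⟩
        have hyA' : y ∈ A'.erase z := mem_erase.2 ⟨hzy.symm, hyA⟩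
        refine ⟨T.Z c A₃ + T.Z (T.flip z (T.flip y c)) A₃, T.Z (T.flip z c) A₃ +
          T.Z (T.flip y c) A₃, by positivity, by positivity, fun u => ?_, ?_⟩
        · rw [Terms.Z_erase (hup u) hyA,
            Terms.Z_erase ((hup u).mono (fun _ h => h) (erase_subset y _)) hzA',
            Terms.Z_erase ((hupf y u).mono (fun _ h => h) (erase_subset y _)) hzA']
          simp only [Terms.flip_update, hyτ, hzτ, if_true, neg_neg]
          rw [Terms.Z_update hτ hcτ hfree, Terms.Z_update hτ (hfzero _) hfree,
            Terms.Z_update hτ (hfzero _) hfree, Terms.Z_update hτ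
              (by simp [Terms.flip, hcτ]) hfree]
          ring
        · simp only [Terms.odds, if_pos hzA', if_pos hyA', hA₃', ← hA₃]
          rw [Terms.flip_comm y z]
          field_simp
      · have hzA' : z ∉ A'.erase y := fun h => hzA (mem_of_mem_erase h)
        have hz' : A'.erase z = A' := erase_eq_of_notMem hzA
        have h3 : A'.erase y = A₃ := by rw [← hA₃', hz']
        refine ⟨T.Z c A₃, T.Z (T.flip y c) A₃, ha, hD.le, fun u => ?_, ?_⟩
        · rw [Terms.Z_erase (hup u) hyA, h3, Terms.flip_update,
            Terms.Z_update hτ hcτ hfree, Terms.Z_update hτ (hfzero _) hfree, if_pos hyτ]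
        · simp [Terms.odds, hz', hyA, h3, hz₃]
    · have hyA' : y ∉ A'.erase z := fun h => hyA (mem_of_mem_erase h)
      have hy' : A'.erase y = A' := erase_eq_of_notMem hyA
      by_cases hzA : z ∈ A'
      · have h3 : A'.erase z = A₃ := by rw [hA₃, hy']
        refine ⟨T.Z c A₃, T.Z (T.flip z c) A₃, ha, hC.le, fun u => ?_, ?_⟩
        · rw [Terms.Z_erase (hup u) hzA, h3, Terms.flip_update,
            Terms.Z_update hτ hcτ hfree, Terms.Z_update hτ (hfzero _) hfree, if_pos hzτ]
        · simp [Terms.odds, hy', hzA, h3, hy₃]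
      · have h3 : A' = A₃ := by rw [hA₃, hy', erase_eq_of_notMem hzA]
        refine ⟨T.Z c A₃, 0, ha, le_rfl, fun u => ?_, ?_⟩
        · rw [h3, Terms.Z_update hτ hcτ hfree]; ring
        · simp [Terms.odds, hyA, hzA]
  rw [← Terms.update_cut_neg hm, ← Terms.update_cut_self hm, ← hc, hZ, hZ, neg_neg, hσ,
    factor_eq hP hM]

theorem prod_range_div_of_ne_zero {f : ℕ → ℝ} (hf : ∀ i, f i ≠ 0) (n : ℕ) :
    ∏ i ∈ range n, f (i + 1) / f i = f n / f 0 := by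
  induction n with
  | zero => simp [hf]
  | succ n ih =>
    rw [prod_range_succ, ih]
    have := hf n
    field_simp

/-- The recursion for the odds of a vertex, with one factor for each monomial that contains it:
the sign of `ξ_v` is changed in one monomial after the other, and the ratios of consecutive
partition functions telescope. -/
theorem Terms.odds_eq_prod (hA : T.Simple w A) (hv : v ∈ A) :
    T.odds w A v = ∏ τ ∈ range T.card, if T.Mem v τ then
      factor (exp (2 * w τ)) (pairOdds fun κ => T.odds (T.branch v τ κ w)
        ((A.erase v).erase (T.pin v τ κ)) (T.query v τ κ)) else 1 := by
  have hflip : T.Z (T.flip v w) (A.erase v) = T.Z (T.hybrid v T.card w) (A.erase v) := by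
    refine sum_congr rfl fun s _ => congrArg exp (sum_congr rfl fun τ hτ => ?_)
    simp [Terms.flip, Terms.hybrid, mem_range.1 hτ]
  have hzero : T.hybrid v 0 w = w := by funext τ; simp [Terms.hybrid]
  have htel := prod_range_div_of_ne_zero
    (fun t => (Terms.Z_pos (T := T) (w := T.hybrid v t w) (A := A.erase v)).ne') T.card
  rw [Terms.odds, if_pos hv, hflip]
  rw [hzero] at htel
  rw [← htel]
  refine prod_congr rfl fun τ hτ => ?_
  have hτ := mem_range.1 hτ
  have hpos := (Terms.Z_pos (T := T) (w := T.hybrid v τ w) (A := A.erase v)).ne'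
  by_cases hm : T.Mem v τ
  · rw [if_pos hm]
    by_cases hw : w τ = 0
    · have : T.hybrid v (τ + 1) w = T.hybrid v τ w := by
        rw [← Terms.update_cut_neg hm, ← Terms.update_cut_self hm, hw, neg_zero]
      rw [this, div_self hpos, hw, mul_zero, exp_zero,
        factor_one (pairOdds_nonneg fun _ _ => Terms.odds_nonneg)]
    · exact Terms.Z_hybrid_succ hA hτ hm hw
  · have : T.hybrid v (τ + 1) w = T.hybrid v τ w := by
      funext x
      simp only [Terms.hybrid]
      by_cases hx : x = τ
      · subst hx; simp [hm]
      · have : x < τ + 1 ↔ x < τ := by omega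
        simp only [this]
    rw [if_neg hm, this, div_self hpos]

end SpinSystem

namespace SpinSystem

open Finset Real

/-! ### Multiplicative errors -/

/-- The numbers `a` and `b` differ at most by a factor of `e^t`. -/
def Near (t a b : ℝ) : Prop := a ≤ exp t * b ∧ b ≤ exp t * a

variable {t a b a' b' : ℝ}

theorem Near.refl (ht : 0 ≤ t) (ha : 0 ≤ a) : Near t a a :=
  ⟨le_mul_of_one_le_left ha (one_le_exp ht), le_mul_of_one_le_left ha (one_le_exp ht)⟩

theorem Near.symm (h : Near t a b) : Near t b a := ⟨h.2, h.1⟩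

theorem Near.mono {t' : ℝ} (h : Near t a b) (ha : 0 ≤ a) (hb : 0 ≤ b) (ht : t ≤ t') :
    Near t' a b :=
  ⟨h.1.trans (mul_le_mul_of_nonneg_right (exp_le_exp.2 ht) hb),
    h.2.trans (mul_le_mul_of_nonneg_right (exp_le_exp.2 ht) ha)⟩

theorem Near.trans {c t' : ℝ} (h : Near t a b) (h' : Near t' b c) : Near (t + t') a c := by
  constructor
  · calc a ≤ exp t * b := h.1
      _ ≤ exp t * (exp t' * c) := mul_le_mul_of_nonneg_left h'.1 (exp_pos _).le
      _ = _ := by rw [exp_add]; ring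
  · calc c ≤ exp t' * b := h'.2
      _ ≤ exp t' * (exp t * a) := mul_le_mul_of_nonneg_left h.2 (exp_pos _).le
      _ = _ := by rw [exp_add]; ring

theorem Near.add (h : Near t a b) (h' : Near t a' b') : Near t (a + a') (b + b') := by
  constructor
  · rw [mul_add]; exact add_le_add h.1 h'.1
  · rw [mul_add]; exact add_le_add h.2 h'.2

theorem Near.one_add (ht : 0 ≤ t) (h : Near t a b) : Near t (1 + a) (1 + b) :=
  (Near.refl ht zero_le_one).add h

theorem Near.sum {ι : Type*} {s : Finset ι} {f g : ι → ℝ} (h : ∀ i ∈ s, Near t (f i) (g i)) :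
    Near t (∑ i ∈ s, f i) (∑ i ∈ s, g i) := by
  constructor
  · rw [mul_sum]; exact sum_le_sum fun i hi => (h i hi).1
  · rw [mul_sum]; exact sum_le_sum fun i hi => (h i hi).2

theorem Near.mul {t' : ℝ} (h : Near t a b) (h' : Near t' a' b') (ha : 0 ≤ a) (hb : 0 ≤ b)
    (ha' : 0 ≤ a') (hb' : 0 ≤ b') : Near (t + t') (a * a') (b * b') := by
  constructor
  · calc a * a' ≤ (exp t * b) * (exp t' * b') :=
          mul_le_mul h.1 h'.1 ha' (mul_nonneg (exp_pos _).le hb)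
      _ = _ := by rw [exp_add]; ring
  · calc b * b' ≤ (exp t * a) * (exp t' * a') :=
          mul_le_mul h.2 h'.2 hb' (mul_nonneg (exp_pos _).le ha)
      _ = _ := by rw [exp_add]; ring

theorem Near.prod {ι : Type*} {s : Finset ι} {f g : ι → ℝ} {t : ι → ℝ}
    (h : ∀ i ∈ s, Near (t i) (f i) (g i)) (hf : ∀ i ∈ s, 0 ≤ f i) (hg : ∀ i ∈ s, 0 ≤ g i) :
    Near (∑ i ∈ s, t i) (∏ i ∈ s, f i) (∏ i ∈ s, g i) := by
  classical
  induction s using Finset.induction_on with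
  | empty => simp [Near]
  | insert i s hi ih =>
    simp only [mem_insert, forall_eq_or_imp] at h hf hg
    rw [sum_insert hi, prod_insert hi, prod_insert hi]
    exact h.1.mul (ih h.2 hf.2 hg.2) hf.1 hg.1 (prod_nonneg hf.2) (prod_nonneg hg.2)

theorem Near.exp (h : |a - b| ≤ t) : Near t (exp a) (exp b) := by
  rw [abs_le] at h
  constructor
  · rw [← exp_add]; exact exp_le_exp.2 (by linarith)
  · rw [← exp_add]; exact exp_le_exp.2 (by linarith)

theorem Near.abs_log_sub_le (h : Near t a b) (ha : 0 < a) (hb : 0 < b) :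
    |log a - log b| ≤ t := by
  have h1 := log_le_log ha h.1
  have h2 := log_le_log hb h.2
  rw [log_mul (exp_pos _).ne' hb.ne', log_exp] at h1
  rw [log_mul (exp_pos _).ne' ha.ne', log_exp] at h2
  rw [abs_le]
  constructor <;> linarith

/-- The map `(a, b) ↦ 1 / (1 / a + b)` does not increase multiplicative errors. -/
theorem Near.div_one_add_mul (h : Near t a a') (h' : Near t b b') (ha : 0 ≤ a) (hb : 0 ≤ b)
    (ha' : 0 ≤ a') (hb' : 0 ≤ b') : Near t (a / (1 + a * b)) (a' / (1 + a' * b')) := by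
  have key : ∀ {a a' b b' : ℝ}, a ≤ Real.exp t * a' → b' ≤ Real.exp t * b → 0 ≤ a → 0 ≤ b →
      0 ≤ a' → 0 ≤ b' → a / (1 + a * b) ≤ Real.exp t * (a' / (1 + a' * b')) := by
    intro a a' b b' h h' ha hb ha' hb'
    rw [← mul_div_assoc, div_le_div_iff₀ (by positivity) (by positivity)]
    have := mul_le_mul_of_nonneg_left h' (mul_nonneg ha ha')
    nlinarith
  exact ⟨key h.1 h'.2 ha hb ha' hb', key h.2 h'.1 ha' hb' ha hb⟩

theorem Near.pairOdds {o o' : ℕ → ℝ} (h : ∀ κ < 4, Near t (o κ) (o' κ)) (ho : ∀ κ < 4, 0 ≤ o κ)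
    (ho' : ∀ κ < 4, 0 ≤ o' κ) : Near t (pairOdds o) (pairOdds o') := by
  have h0 : 0 < 4 := by norm_num
  have h1 : 1 < 4 := by norm_num
  have h2 : 2 < 4 := by norm_num
  have h3 : 3 < 4 := by norm_num
  exact ((h 0 h0).div_one_add_mul (h 3 h3) (ho 0 h0) (ho 3 h3) (ho' 0 h0) (ho' 3 h3)).add
    ((h 2 h2).div_one_add_mul (h 1 h1) (ho 2 h2) (ho 1 h1) (ho' 2 h2) (ho' 1 h1))

/-! ### The recursion contracts errors -/

/-- In other words, `tanh w ≤ w`. -/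
theorem exp_sub_one_le {w : ℝ} (hw : 0 ≤ w) : exp (2 * w) - 1 ≤ w * (exp (2 * w) + 1) := by
  have hd : ∀ x : ℝ, HasDerivAt (fun x => x * (exp (2 * x) + 1) - (exp (2 * x) - 1))
      (1 * (exp (2 * x) + 1) + x * (exp (2 * x) * (2 * 1)) - exp (2 * x) * (2 * 1)) x := by
    intro x
    have h1 : HasDerivAt (fun x : ℝ => exp (2 * x)) (exp (2 * x) * (2 * 1)) x :=
      ((hasDerivAt_id x).const_mul 2).exp
    exact ((hasDerivAt_id x).mul (h1.add_const 1)).sub (h1.sub_const 1)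
  have hmono : Monotone fun x : ℝ => x * (exp (2 * x) + 1) - (exp (2 * x) - 1) := by
    refine monotone_of_deriv_nonneg (fun x => (hd x).differentiableAt) fun x => ?_
    rw [(hd x).deriv]
    have h1 := add_one_le_exp (-(2 * x))
    have h2 : exp (2 * x) * exp (-(2 * x)) = 1 := by rw [← exp_add]; simp
    nlinarith [exp_pos (2 * x)]
  have := hmono hw
  simp only [mul_zero, exp_zero] at this
  linarith

/-- In other words, `|tanh w| ≤ |w|`. -/
theorem abs_exp_sub_one_le (w : ℝ) : |exp (2 * w) - 1| ≤ |w| * (exp (2 * w) + 1) := by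
  rcases le_total 0 w with hw | hw
  · rw [abs_of_nonneg hw, abs_of_nonneg (by linarith [one_le_exp (show 0 ≤ 2 * w by linarith)])]
    exact exp_sub_one_le hw
  · have h1 := exp_sub_one_le (w := -w) (by linarith)
    have h2 : exp (2 * w) * exp (2 * -w) = 1 := by rw [← exp_add]; simp
    have h3 : exp (2 * w) ≤ 1 := exp_le_one_iff.2 (by linarith)
    rw [abs_of_nonpos hw, abs_of_nonpos (by linarith)]
    nlinarith [exp_pos (2 * w)]

/-- The logarithm of `factor` is Lipschitz in the logarithm of the odds. The derivative is largest
in absolute value at odds `1`, where it is `tanh w`. -/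
theorem abs_log_factor_sub_le (w x y : ℝ) :
    |log (factor (exp (2 * w)) (exp x)) - log (factor (exp (2 * w)) (exp y))| ≤ |w| * |x - y| := by
  set q := exp (2 * w) with hq
  have hq0 : 0 < q := exp_pos _
  have hfac : ∀ x, log (factor q (exp x)) = log (1 + q * exp x) - log (q + exp x) := by
    intro x
    have := exp_pos x
    rw [factor, log_div (by positivity) (by positivity)]
  have hd : ∀ x, HasDerivAt (fun x => log (factor q (exp x)))
      (q * exp x / (1 + q * exp x) - exp x / (q + exp x)) x := by
    intro x
    have := exp_pos x
    have h := (Real.hasDerivAt_exp x)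
    simp only [hfac]
    exact (((h.const_mul q).const_add 1).log (by positivity)).sub
      ((h.const_add q).log (by positivity))
  have hbound : ∀ x, ‖q * exp x / (1 + q * exp x) - exp x / (q + exp x)‖ ≤ |w| := by
    intro x
    set e := exp x with he
    have he0 : 0 < e := exp_pos x
    have hr : q * e / (1 + q * e) - e / (q + e) =
        e * (q + 1) * (q - 1) / ((1 + q * e) * (q + e)) := by
      field_simp; ring
    rw [hr, Real.norm_eq_abs, abs_div, abs_mul, abs_of_pos (show 0 < e * (q + 1) by positivity),
      abs_of_pos (show 0 < (1 + q * e) * (q + e) by positivity), div_le_iff₀ (by positivity)]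
    calc e * (q + 1) * |q - 1| ≤ e * (q + 1) * (|w| * (q + 1)) :=
          mul_le_mul_of_nonneg_left (abs_exp_sub_one_le w) (by positivity)
      _ = |w| * (e * (q + 1) ^ 2) := by ring
      _ ≤ |w| * ((1 + q * e) * (q + e)) := by
          refine mul_le_mul_of_nonneg_left ?_ (abs_nonneg w)
          -- the difference of the two sides is `q (e - 1)²`
          nlinarith [mul_nonneg hq0.le (sq_nonneg (e - 1))]
  have := Convex.norm_image_sub_le_of_norm_hasDerivWithin_le (s := Set.univ)
    (fun x _ => (hd x).hasDerivWithinAt) (fun x _ => hbound x) convex_univ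
    (Set.mem_univ y) (Set.mem_univ x)
  simpa [Real.norm_eq_abs] using this

theorem Near.factor (w : ℝ) {σ σ' : ℝ} (hσ : 0 ≤ σ) (hσ' : 0 ≤ σ') (ht : 0 ≤ t)
    (h : Near t σ σ') :
    Near (|w| * t) (factor (Real.exp (2 * w)) σ) (factor (Real.exp (2 * w)) σ') := by
  have hw : 0 ≤ |w| * t := by positivity
  rcases hσ.eq_or_lt with rfl | hpos
  · have : σ' = 0 := le_antisymm (by simpa using h.2) hσ'
    subst this
    exact Near.refl hw (factor_pos (exp_pos _) le_rfl).le
  · have hpos' : 0 < σ' := by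
      rcases hσ'.eq_or_lt with rfl | h'
      · exact absurd h.1 (by simpa using hpos)
      · exact h'
    have h1 := abs_log_factor_sub_le w (log σ) (log σ')
    rw [exp_log hpos, exp_log hpos'] at h1
    have h2 := h1.trans (mul_le_mul_of_nonneg_left (h.abs_log_sub_le hpos hpos') (abs_nonneg w))
    have := Near.exp h2
    rwa [exp_log (factor_pos (exp_pos _) hσ), exp_log (factor_pos (exp_pos _) hσ')] at this

/-- The factor of one monomial is between `e^{-2 |w|}` and `e^{2 |w|}`. -/
theorem near_factor_factor (w : ℝ) {σ σ' : ℝ} (hσ : 0 ≤ σ) (hσ' : 0 ≤ σ') :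
    Near (|w| * 4) (factor (exp (2 * w)) σ) (factor (exp (2 * w)) σ') := by
  have key : ∀ {σ : ℝ}, 0 ≤ σ → Near (2 * |w|) (factor (exp (2 * w)) σ) 1 := by
    intro σ hσ
    have h1 : exp (2 * w) ≤ exp (2 * |w|) := exp_le_exp.2 (by linarith [le_abs_self w])
    have h2 : 1 ≤ exp (2 * |w|) * exp (2 * w) := by
      rw [← exp_add]; exact one_le_exp (by linarith [neg_abs_le w])
    have hq := exp_pos (2 * w)
    constructor
    · rw [SpinSystem.factor, mul_one, div_le_iff₀ (by positivity)]
      nlinarith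
    · rw [SpinSystem.factor, ← mul_div_assoc, le_div_iff₀ (by positivity)]
      nlinarith
  have := (key hσ).trans (key hσ').symm
  convert this using 1; ring

variable {T : Terms} {w w' : ℕ → ℝ} {A B : Finset ℕ} {v : ℕ} {c : ℝ}

variable (T) in
/-- The total strength of the interaction of `v` with the other free spins. -/
def Terms.load (w : ℕ → ℝ) (A : Finset ℕ) (v : ℕ) : ℝ :=
  ∑ τ ∈ range T.card with T.Mem v τ ∧ ∃ u ∈ A, u ≠ v ∧ T.Mem u τ, |w τ|

variable (T) in
/-- No free spin occurs twice in a monomial, and the interactions of every free spin are bounded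
by `c`. -/
def Terms.Good (c : ℝ) (w : ℕ → ℝ) (A : Finset ℕ) : Prop :=
  T.Simple w A ∧ ∀ v ∈ A, T.load w A v ≤ c

theorem Terms.Good.mono (h : T.Good c w A) (hw : ∀ τ, |w' τ| ≤ |w τ|) (hB : B ⊆ A) :
    T.Good c w' B := by
  refine ⟨h.1.mono (fun τ h0 => ?_) hB, fun v hv => (?_ : _ ≤ T.load w A v).trans
    (h.2 v (hB hv))⟩
  · rw [← abs_pos] at h0 ⊢
    exact h0.trans_le (hw τ)
  · refine (sum_le_sum fun τ _ => hw τ).trans (sum_le_sum_of_subset_of_nonneg ?_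
      fun _ _ _ => abs_nonneg _)
    intro τ hτ
    simp only [mem_filter] at hτ ⊢
    obtain ⟨h1, h2, u, hu, h3⟩ := hτ
    exact ⟨h1, h2, u, hB hu, h3⟩

/-- One step of the recursion: if the odds used for the monomials in which `v` interacts with other
free spins are such that each factor has an error of at most `|w τ| t`, then the computed odds of
`v` have an error of at most `c t`. -/
theorem near_odds_of_factor (hA : T.Good c w A) (hv : v ∈ A) (ht : 0 ≤ t) {o : ℕ → ℕ → ℝ}
    (ho : ∀ τ < T.card, ∀ κ < 4, 0 ≤ o τ κ)
    (hdead : ∀ τ < T.card, ∀ κ < 4,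
      T.query v τ κ ∉ (A.erase v).erase (T.pin v τ κ) → o τ κ = 0)
    (hnear : ∀ τ < T.card, Near (|w τ| * t) (factor (exp (2 * w τ)) (pairOdds (o τ)))
      (factor (exp (2 * w τ)) (pairOdds fun κ => T.odds (T.branch v τ κ w)
        ((A.erase v).erase (T.pin v τ κ)) (T.query v τ κ)))) :
    Near (c * t) (∏ τ ∈ range T.card, if T.Mem v τ then
      factor (exp (2 * w τ)) (pairOdds (o τ)) else 1) (T.odds w A v) := by
  rw [Terms.odds_eq_prod hA.1 hv]
  have hpos1 : ∀ τ ∈ range T.card, 0 ≤ if T.Mem v τ then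
      factor (exp (2 * w τ)) (pairOdds (o τ)) else 1 := by
    intro τ hτ
    split_ifs
    · exact (factor_pos (exp_pos _) (pairOdds_nonneg (ho τ (mem_range.1 hτ)))).le
    · exact zero_le_one
  have hpos2 : ∀ τ ∈ range T.card, 0 ≤ if T.Mem v τ then
      factor (exp (2 * w τ)) (pairOdds fun κ => T.odds (T.branch v τ κ w)
        ((A.erase v).erase (T.pin v τ κ)) (T.query v τ κ)) else 1 := by
    intro τ _
    split_ifs
    · exact (factor_pos (exp_pos _) (pairOdds_nonneg fun _ _ => Terms.odds_nonneg)).le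
    · exact zero_le_one
  refine (Near.prod (t := fun τ => if T.Mem v τ ∧ ∃ u ∈ A, u ≠ v ∧ T.Mem u τ then |w τ| * t else 0)
    (fun τ hτ => ?_) hpos1 hpos2).mono (prod_nonneg hpos1) (prod_nonneg hpos2) ?_
  · have hτ := mem_range.1 hτ
    by_cases hm : T.Mem v τ
    · by_cases hu : ∃ u ∈ A, u ≠ v ∧ T.Mem u τ
      · simpa only [hm, hu, if_true, and_self] using hnear τ hτ
      · -- no other spin of the monomial is free, so that all the odds vanish
        have hout : ∀ κ, T.query v τ κ ∉ (A.erase v).erase (T.pin v τ κ) := by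
          intro κ hq
          refine hu ⟨_, mem_of_mem_erase (mem_of_mem_erase hq),
            ne_of_mem_erase (mem_of_mem_erase hq), ?_⟩
          unfold Terms.query
          split_ifs
          exacts [Terms.mem_snd, Terms.mem_fst]
        simp only [hm, hu, if_true, and_false, if_false]
        have h1 : pairOdds (o τ) = 0 := by
          simp [pairOdds, hdead τ hτ 0 (by norm_num) (hout 0),
            hdead τ hτ 2 (by norm_num) (hout 2)]
        have h2 : (pairOdds fun κ => T.odds (T.branch v τ κ w)
            ((A.erase v).erase (T.pin v τ κ)) (T.query v τ κ)) = 0 := by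
          simp [pairOdds, Terms.odds_of_notMem (hout _)]
        rw [h1, h2]
        exact Near.refl le_rfl (factor_pos (exp_pos _) le_rfl).le
    · simp only [hm, if_false, false_and]
      exact Near.refl le_rfl zero_le_one
  · rw [← sum_filter, ← sum_mul]
    exact mul_le_mul_of_nonneg_right (hA.2 v hv) ht

/-- Errors in the odds shrink by the factor `c` in one step of the recursion. -/
theorem near_odds_of_near (hA : T.Good c w A) (hv : v ∈ A) (ht : 0 ≤ t) {o : ℕ → ℕ → ℝ}
    (ho : ∀ τ < T.card, ∀ κ < 4, 0 ≤ o τ κ)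
    (hdead : ∀ τ < T.card, ∀ κ < 4,
      T.query v τ κ ∉ (A.erase v).erase (T.pin v τ κ) → o τ κ = 0)
    (hnear : ∀ τ < T.card, ∀ κ < 4, Near t (o τ κ) (T.odds (T.branch v τ κ w)
        ((A.erase v).erase (T.pin v τ κ)) (T.query v τ κ))) :
    Near (c * t) (∏ τ ∈ range T.card, if T.Mem v τ then
      factor (exp (2 * w τ)) (pairOdds (o τ)) else 1) (T.odds w A v) :=
  near_odds_of_factor hA hv ht ho hdead fun τ hτ =>
    (Near.pairOdds (hnear τ hτ) (ho τ hτ) fun _ _ => Terms.odds_nonneg).factor _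
      (pairOdds_nonneg (ho τ hτ)) (pairOdds_nonneg fun _ _ => Terms.odds_nonneg) ht

/-- After one step of the recursion the error is bounded, whatever the odds used in it. -/
theorem near_odds (hA : T.Good c w A) (hv : v ∈ A) {o : ℕ → ℕ → ℝ}
    (ho : ∀ τ < T.card, ∀ κ < 4, 0 ≤ o τ κ)
    (hdead : ∀ τ < T.card, ∀ κ < 4,
      T.query v τ κ ∉ (A.erase v).erase (T.pin v τ κ) → o τ κ = 0) :
    Near (c * 4) (∏ τ ∈ range T.card, if T.Mem v τ then
      factor (exp (2 * w τ)) (pairOdds (o τ)) else 1) (T.odds w A v) :=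
  near_odds_of_factor hA hv (by norm_num) ho hdead fun τ hτ =>
    near_factor_factor _ (pairOdds_nonneg (ho τ hτ)) (pairOdds_nonneg fun _ _ => Terms.odds_nonneg)

end SpinSystem

namespace SpinSystem

open Finset Real

/-! ### The computation forest -/

/-- A spin system, given by the coefficients of the monomials and the set of free vertices, with a
distinguished vertex, whose odds are asked for. -/
structure Node where
  w : ℕ → ℝ
  A : Finset ℕ
  v : ℕ

variable (T : Terms)

/-- The system whose odds the recursion needs at the monomial `τ` in branch `κ`. -/
def Terms.child (P : Node) (τ κ : ℕ) : Node :=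
  ⟨T.branch P.v τ κ P.w, (P.A.erase P.v).erase (T.pin P.v τ κ), T.query P.v τ κ⟩

/-- The number of the child `(τ, κ)` of the node with number `m`. The `n` roots have the
numbers below `n`, and the other nodes are numbered level by level. -/
def Terms.childIndex (n m τ κ : ℕ) : ℕ := n + ((m * T.card + τ) * 4 + κ)

/-- The node with number `m`; the root `r < n` asks for the odds of `r` when all smaller spins
are `1`. -/
def Terms.node (n : ℕ) (w : ℕ → ℝ) (m : ℕ) : Node :=
  if h : n ≤ m ∧ 0 < n then
    T.child (Terms.node n w ((m - n) / 4 / T.card)) ((m - n) / 4 % T.card) ((m - n) % 4)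
  else ⟨w, Ico m n, m⟩
termination_by m
decreasing_by
  have h1 := Nat.div_le_self ((m - n) / 4) T.card
  have h2 := Nat.div_le_self (m - n) 4
  omega

/-- The computed odds at the node `m`, when the recursion is carried out at the nodes below `G`,
and `1` is used for the odds of a free spin at all other nodes. -/
noncomputable def Terms.value (n : ℕ) (w : ℕ → ℝ) (G m : ℕ) : ℝ :=
  if (T.node n w m).v ∈ (T.node n w m).A then
    if h : m < G ∧ 0 < n ∧ 0 < T.card then
      ∏ τ ∈ range T.card, if T.Mem (T.node n w m).v τ then
        factor (exp (2 * (T.node n w m).w τ))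
          (pairOdds fun κ => Terms.value n w G (T.childIndex n m τ κ)) else 1
    else 1
  else 0
termination_by G - m
decreasing_by
  have h1 : m ≤ m * T.card := Nat.le_mul_of_pos_right m h.2.2
  unfold Terms.childIndex
  omega

/-- The number of nodes above level `d` of the forest. -/
def Terms.levelSize (n : ℕ) : ℕ → ℕ
  | 0 => 0
  | d + 1 => n + Terms.levelSize n d * T.card * 4

variable {T} {n m G τ κ : ℕ} {w : ℕ → ℝ} {c : ℝ}

theorem Terms.lt_childIndex (hn : 0 < n) (hT : 0 < T.card) : m < T.childIndex n m τ κ := by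
  have h1 : m ≤ m * T.card := Nat.le_mul_of_pos_right m hT
  unfold Terms.childIndex
  omega

theorem Terms.childIndex_lt {M : ℕ} (hm : m < M) (hτ : τ < T.card) (hκ : κ < 4) :
    T.childIndex n m τ κ < n + M * T.card * 4 := by
  have h1 : (m + 1) * T.card ≤ M * T.card := Nat.mul_le_mul_right _ hm
  unfold Terms.childIndex
  rw [Nat.add_mul] at h1
  omega

theorem Terms.childIndex_decode (hτ : τ < T.card) (hκ : κ < 4) :
    (T.childIndex n m τ κ - n) / 4 / T.card = m ∧
      (T.childIndex n m τ κ - n) / 4 % T.card = τ ∧ (T.childIndex n m τ κ - n) % 4 = κ := by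
  have h1 : T.childIndex n m τ κ - n = (m * T.card + τ) * 4 + κ := by
    unfold Terms.childIndex; omega
  have h2 : ((m * T.card + τ) * 4 + κ) / 4 = T.card * m + τ := by
    rw [Nat.mul_comm T.card]; omega
  rw [h1, h2]
  refine ⟨?_, ?_, by omega⟩
  · rw [Nat.mul_add_div (by omega), Nat.div_eq_of_lt hτ, add_zero]
  · rw [Nat.mul_add_mod, Nat.mod_eq_of_lt hτ]

theorem Terms.node_root (hm : m < n) : T.node n w m = ⟨w, Ico m n, m⟩ := by
  rw [Terms.node, dif_neg (by omega)]

theorem Terms.node_of_le (hn : 0 < n) (hm : n ≤ m) : T.node n w m =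
    T.child (T.node n w ((m - n) / 4 / T.card)) ((m - n) / 4 % T.card) ((m - n) % 4) := by
  rw [Terms.node, dif_pos ⟨hm, hn⟩]

theorem Terms.node_childIndex (hn : 0 < n) (hτ : τ < T.card) (hκ : κ < 4) :
    T.node n w (T.childIndex n m τ κ) = T.child (T.node n w m) τ κ := by
  obtain ⟨h1, h2, h3⟩ := Terms.childIndex_decode (n := n) (m := m) hτ hκ
  rw [Terms.node_of_le hn (by unfold Terms.childIndex; omega), h1, h2, h3]

theorem Terms.node_good (hn : 0 < n) (h : T.Good c w (range n)) (m : ℕ) :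
    T.Good c (T.node n w m).w (T.node n w m).A := by
  induction m using Nat.strong_induction_on with
  | _ m ih =>
    rcases lt_or_ge m n with hm | hm
    · rw [Terms.node_root hm]
      exact h.mono (fun _ => le_rfl) fun x hx => mem_range.2 (mem_Ico.1 hx).2
    · rw [Terms.node_of_le hn hm]
      have h1 := Nat.div_le_self ((m - n) / 4) T.card
      have h2 := Nat.div_le_self (m - n) 4
      exact (ih _ (by omega)).mono (fun _ => Terms.abs_branch_le _ _)
        ((erase_subset _ _).trans (erase_subset _ _))

theorem Terms.value_eq_zero (h : (T.node n w m).v ∉ (T.node n w m).A) :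
    T.value n w G m = 0 := by
  rw [Terms.value, if_neg h]

theorem Terms.value_nonneg : 0 ≤ T.value n w G m := by
  induction hd : G - m using Nat.strong_induction_on generalizing m with
  | _ d ih =>
    rw [Terms.value]
    split_ifs with h1 h2
    · refine prod_nonneg fun τ _ => ?_
      split_ifs
      · refine (factor_pos (exp_pos _) (pairOdds_nonneg fun κ _ => ih _ ?_ rfl)).le
        have := Terms.lt_childIndex (τ := τ) (κ := κ) (m := m) h2.2.1 h2.2.2
        omega
      · exact zero_le_one
    · exact zero_le_one
    · exact le_rfl

theorem Terms.levelSize_mono (hn : 0 < n) (hT : 0 < T.card) : Monotone (T.levelSize n) := by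
  refine monotone_nat_of_le_succ fun d => ?_
  have := Nat.le_mul_of_pos_right (T.levelSize n d) hT
  rw [Terms.levelSize]
  omega

/-- The error of the computed odds decays geometrically with the number `h` of levels below the
node `m`, which is on one of the first `d` levels. -/
theorem Terms.near_value (hn : 0 < n) (hT : 0 < T.card) (hc : 0 ≤ c)
    (hw : T.Good c w (range n)) {l : ℕ} (h d : ℕ) (hd : d + h = l) (hm : m < T.levelSize n d) :
    Near (4 * c ^ (h + 1)) (T.value n w (T.levelSize n l) m)
      (T.odds (T.node n w m).w (T.node n w m).A (T.node n w m).v) := by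
  induction h generalizing d m with
  | zero =>
    by_cases hv : (T.node n w m).v ∈ (T.node n w m).A
    · rw [Terms.value, if_pos hv, dif_pos ⟨by rwa [← hd], hn, hT⟩]
      have := near_odds (Terms.node_good hn hw m) hv
        (o := fun τ κ => T.value n w (T.levelSize n l) (T.childIndex n m τ κ))
        (fun _ _ _ _ => Terms.value_nonneg) (fun τ hτ κ hκ hq => Terms.value_eq_zero (by
          rw [Terms.node_childIndex hn hτ hκ]; exact hq))
      convert this using 1
      ring
    · rw [Terms.value_eq_zero hv, Terms.odds_of_notMem hv]
      exact Near.refl (by positivity) le_rfl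
  | succ h ih =>
    by_cases hv : (T.node n w m).v ∈ (T.node n w m).A
    · have hmG : m < T.levelSize n l :=
        hm.trans_le (Terms.levelSize_mono hn hT (by omega))
      rw [Terms.value, if_pos hv, dif_pos ⟨hmG, hn, hT⟩]
      have := near_odds_of_near (Terms.node_good hn hw m) hv (t := 4 * c ^ (h + 1))
        (by positivity)
        (o := fun τ κ => T.value n w (T.levelSize n l) (T.childIndex n m τ κ))
        (fun _ _ _ _ => Terms.value_nonneg) (fun τ hτ κ hκ hq => Terms.value_eq_zero (by
          rw [Terms.node_childIndex hn hτ hκ]; exact hq))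
        (fun τ hτ κ hκ => by
          have := ih (m := T.childIndex n m τ κ) (d + 1) (by omega)
            (Terms.childIndex_lt hm hτ hκ)
          rwa [Terms.node_childIndex hn hτ hκ] at this)
      convert this using 1
      ring
    · rw [Terms.value_eq_zero hv, Terms.odds_of_notMem hv]
      exact Near.refl (by positivity) le_rfl

/-- The computed value of the partition function and its error. -/
theorem Terms.near_Z (hn : 0 < n) (hT : 0 < T.card) (hc : 0 ≤ c)
    (hw : T.Good c w (range n)) (l : ℕ) :
    Near (n * (4 * c ^ (l + 1))) ((∏ τ ∈ range T.card, exp (w τ)) *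
      ∏ r ∈ range n, (1 + T.value n w (T.levelSize n (l + 1)) r)) (T.Z w (range n)) := by
  rw [Terms.Z_eq_prod hw.1]
  have hval : ∀ r ∈ range n, 0 ≤ 1 + T.value n w (T.levelSize n (l + 1)) r := fun r _ =>
    add_nonneg zero_le_one Terms.value_nonneg
  have hodds : ∀ r ∈ range n, 0 ≤ 1 + T.odds w (Ico r n) r := fun r _ =>
    add_nonneg zero_le_one Terms.odds_nonneg
  have h1 : ∀ r ∈ range n, Near (4 * c ^ (l + 1))
      (1 + T.value n w (T.levelSize n (l + 1)) r) (1 + T.odds w (Ico r n) r) := by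
    intro r hr
    have hr := mem_range.1 hr
    have := Terms.near_value hn hT hc hw (l := l + 1) (m := r) l 1 (by omega)
      (by simp [Terms.levelSize, hr])
    rw [Terms.node_root hr] at this
    exact this.one_add (by positivity)
  have h2 := Near.prod h1 hval hodds
  rw [sum_const, card_range, nsmul_eq_mul] at h2
  have hexp : 0 ≤ ∏ τ ∈ range T.card, exp (w τ) := prod_nonneg fun _ _ => (exp_pos _).le
  have := (Near.refl le_rfl hexp).mul h2 hexp hexp (prod_nonneg hval) (prod_nonneg hodds)
  rwa [zero_add] at this

end SpinSystem

namespace SpinSystem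

open Finset Real

/-! ### The cubic polynomial as a spin system -/

theorem sum_range_mul_div_mod {M : Type*} [AddCommMonoid M] (f : ℕ → ℕ → M) (m n : ℕ) :
    ∑ x ∈ range (m * n), f (x / n) (x % n) = ∑ i ∈ range m, ∑ j ∈ range n, f i j := by
  induction m with
  | zero => simp
  | succ m ih =>
    rw [Nat.succ_mul, sum_range_add, ih, sum_range_succ]
    congr 1
    refine sum_congr rfl fun j hj => ?_
    have hj := mem_range.1 hj
    have hn : 0 < n := by omega
    rw [Nat.mul_comm m n, Nat.mul_add_div hn, Nat.div_eq_of_lt hj, add_zero, Nat.mul_add_mod,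
      Nat.mod_eq_of_lt hj]

/-- All monomials `ξ_i ξ_j ξ_k` with `i, j, k ≤ n` in lexicographic order; the spin of the
additional vertex `n` is `1`, so that this list contains the monomials of lower degree. -/
def cubicTerms (n : ℕ) : Terms where
  card := (n + 1) * (n + 1) * (n + 1)
  i τ := τ / (n + 1) / (n + 1)
  j τ := τ / (n + 1) % (n + 1)
  k τ := τ % (n + 1)

/-- The coefficient of `ξ_i ξ_j ξ_k`, with each monomial of degree two or three listed once. -/
def coupling (n : ℕ) (c : ℕ → ℕ → ℕ → ℝ) (a : ℕ → ℕ → ℝ) (i j k : ℕ) : ℝ :=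
  if i < j then (if j < k then (if k < n then c i j k else a i j) else 0) else 0

/-- The coefficient of the monomial `ξ_i = ξ_i ξ_n ξ_n`. -/
def field (n : ℕ) (b : ℕ → ℝ) (i j k : ℕ) : ℝ :=
  if i < n then (if j < n then 0 else if k < n then 0 else b i) else 0

/-- The number `e^{field} (1 + coupling / N)^N`, which approximates the exponential of the
coefficient and which a real random access machine can compute. -/
noncomputable def weight (n N : ℕ) (c : ℕ → ℕ → ℕ → ℝ) (a : ℕ → ℕ → ℝ) (b : ℕ → ℝ)
    (τ : ℕ) : ℝ :=
  exp (field n b ((cubicTerms n).i τ) ((cubicTerms n).j τ) ((cubicTerms n).k τ)) *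
    (1 + coupling n c a ((cubicTerms n).i τ) ((cubicTerms n).j τ) ((cubicTerms n).k τ) / N) ^ N

variable {n N : ℕ} {c : ℕ → ℕ → ℕ → ℝ} {a : ℕ → ℕ → ℝ} {b : ℕ → ℝ}

theorem sum_cubicTerms (f : ℕ → ℕ → ℕ → ℝ) :
    ∑ τ ∈ range (cubicTerms n).card,
      f ((cubicTerms n).i τ) ((cubicTerms n).j τ) ((cubicTerms n).k τ) =
    ∑ i ∈ range (n + 1), ∑ j ∈ range (n + 1), ∑ k ∈ range (n + 1), f i j k := by
  rw [show (cubicTerms n).card = (n + 1) * (n + 1) * (n + 1) from rfl]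
  rw [← sum_range_mul_div_mod (fun i j => ∑ k ∈ range (n + 1), f i j k) (n + 1) (n + 1),
    ← sum_range_mul_div_mod (fun x k => f (x / (n + 1)) (x % (n + 1)) k)]
  rfl

theorem cubicTerms_i_le {τ : ℕ} (hτ : τ < (cubicTerms n).card) : (cubicTerms n).i τ ≤ n := by
  have : τ / (n + 1) / (n + 1) < n + 1 := by
    rw [Nat.div_div_eq_div_mul]
    exact Nat.div_lt_of_lt_mul (by rw [mul_comm]; simpa [cubicTerms, mul_assoc] using hτ)
  exact Nat.lt_succ_iff.1 this

theorem cubicTerms_j_le {τ : ℕ} : (cubicTerms n).j τ ≤ n :=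
  Nat.lt_succ_iff.1 (Nat.mod_lt _ (by omega))

theorem cubicTerms_k_le {τ : ℕ} : (cubicTerms n).k τ ≤ n :=
  Nat.lt_succ_iff.1 (Nat.mod_lt _ (by omega))

/-- The total strength of the interactions of the vertex `v`, as in the hypothesis of the
theorem. -/
def strength (n : ℕ) (c : ℕ → ℕ → ℕ → ℝ) (a : ℕ → ℕ → ℝ) (v : ℕ) : ℝ :=
  ∑ p ∈ range n, if p = v then 0 else
    (∑ q ∈ range n, if p < q ∧ q ≠ v then |c v p q| else 0) + |a v p|

/-- The interactions of `v` with the pair `p < q`, where `q = n` stands for the interaction of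
`v` with `p`. -/
theorem sum_pair_eq_strength {v : ℕ} (hv : v < n) :
    ∑ p ∈ range (n + 1), ∑ q ∈ range (n + 1),
      (if p < q ∧ p ≠ v ∧ q ≠ v then (if q < n then |c v p q| else |a v p|) else 0) =
    strength n c a v := by
  rw [sum_range_succ, strength]
  have h0 : ∑ q ∈ range (n + 1), (if n < q ∧ n ≠ v ∧ q ≠ v then
      (if q < n then |c v n q| else |a v n|) else 0) = 0 := by
    refine sum_eq_zero fun q hq => if_neg ?_
    have := mem_range.1 hq
    omega
  rw [h0, add_zero]
  refine sum_congr rfl fun p hp => ?_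
  have hp := mem_range.1 hp
  rw [sum_range_succ]
  by_cases hpv : p = v
  · simp [hpv]
  · have hnv : n ≠ v := by omega
    simp only [hpv, hp, hnv, ne_eq, not_false_eq_true, and_self, if_true, if_false,
      lt_self_iff_false, true_and]
    congr 1
    refine sum_congr rfl fun q hq => ?_
    have hq := mem_range.1 hq
    simp [hq]

/-- Each pair of vertices other than `v` interacts with `v` through one of the three monomials with
non-decreasing indices. -/
theorem abs_coupling_add_le (hc : ∀ i j k, c i j k = c j i k ∧ c i j k = c i k j)
    (ha : ∀ i j, a i j = a j i) {v p q : ℕ} (hv : v < n) (hp : p < n + 1) (hq : q < n + 1) :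
    |coupling n c a v p q| + |coupling n c a p v q| + |coupling n c a p q v| ≤
      if p < q ∧ p ≠ v ∧ q ≠ v then (if q < n then |c v p q| else |a v p|) else 0 := by
  have h1 : c p v q = c v p q := (hc p v q).1
  have h2 : c p q v = c v p q := by rw [(hc p q v).2, h1]
  have h3 : a p v = a v p := ha p v
  unfold coupling
  rcases lt_trichotomy v p with h | h | h
  · rcases lt_or_ge p q with h' | h'
    · have e1 : ¬ p < v := by omega
      have e2 : ¬ q < v := by omega
      have e3 : p ≠ v := by omega
      have e4 : q ≠ v := by omega
      simp only [h, h', e1, e2, e3, e4, if_true, if_false, ne_eq, not_false_eq_true, and_self,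
        abs_zero, add_zero]
      split_ifs <;> exact le_rfl
    · have e1 : ¬ p < v := by omega
      have e2 : ¬ p < q := by omega
      simp [e1, e2]
  · subst h
    simp only [lt_irrefl, if_false, ne_eq, not_true_eq_false, false_and, and_false, abs_zero,
      zero_add]
    split_ifs <;> first | exact abs_zero.le | (exfalso; omega)
  · have e0 : ¬ v < p := by omega
    have e3 : p ≠ v := by omega
    rcases lt_or_ge p q with h' | h'
    · rcases lt_trichotomy v q with g | g | g
      · have e2 : ¬ q < v := by omega
        have e4 : q ≠ v := by omega
        simp only [h, h', g, e0, e2, e3, e4, if_true, if_false, ne_eq, not_false_eq_true, and_self,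
          abs_zero, add_zero, zero_add, h1, h3]
        split_ifs <;> exact le_rfl
      · subst g
        simp [e0]
      · have e2 : ¬ v < q := by omega
        have e4 : q ≠ v := by omega
        have e5 : q < n := by omega
        simp [h, h', g, e0, e2, e3, e4, e5, hv, h2]
    · have e1 : ¬ p < q := by omega
      have e2 : ¬ v < q := by omega
      simp [e0, e1, e2]

theorem sum_abs_coupling_le (hc : ∀ i j k, c i j k = c j i k ∧ c i j k = c i k j)
    (ha : ∀ i j, a i j = a j i) {v : ℕ} (hv : v < n) :
    ∑ p ∈ range (n + 1), ∑ q ∈ range (n + 1), |coupling n c a v p q| ≤ strength n c a v := by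
  rw [← sum_pair_eq_strength hv]
  refine sum_le_sum fun p hp => sum_le_sum fun q hq => ?_
  have := abs_coupling_add_le hc ha hv (mem_range.1 hp) (mem_range.1 hq)
  have h1 := abs_nonneg (coupling n c a p v q)
  have h2 := abs_nonneg (coupling n c a p q v)
  linarith

theorem sum_mem_abs_coupling_le (hc : ∀ i j k, c i j k = c j i k ∧ c i j k = c i k j)
    (ha : ∀ i j, a i j = a j i) {v : ℕ} (hv : v < n) :
    ∑ i ∈ range (n + 1), ∑ j ∈ range (n + 1), ∑ k ∈ range (n + 1),
      (if i = v ∨ j = v ∨ k = v then |coupling n c a i j k| else 0) ≤ strength n c a v := by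
  have hv' : v ∈ range (n + 1) := mem_range.2 (by omega)
  have h1 : ∑ i ∈ range (n + 1), ∑ j ∈ range (n + 1), ∑ k ∈ range (n + 1),
      (if i = v ∨ j = v ∨ k = v then |coupling n c a i j k| else 0) ≤
    ∑ i ∈ range (n + 1), ∑ j ∈ range (n + 1), ∑ k ∈ range (n + 1),
      ((if i = v then |coupling n c a i j k| else 0) +
        (if j = v then |coupling n c a i j k| else 0) +
        (if k = v then |coupling n c a i j k| else 0)) := by
    refine sum_le_sum fun i _ => sum_le_sum fun j _ => sum_le_sum fun k _ => ?_
    have := abs_nonneg (coupling n c a i j k)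
    by_cases hi : i = v <;> by_cases hj : j = v <;> by_cases hk : k = v <;> simp [hi, hj, hk]
  refine h1.trans ?_
  simp only [sum_add_distrib]
  have e1 : ∑ i ∈ range (n + 1), ∑ j ∈ range (n + 1), ∑ k ∈ range (n + 1),
      (if i = v then |coupling n c a i j k| else 0) =
      ∑ p ∈ range (n + 1), ∑ q ∈ range (n + 1), |coupling n c a v p q| := by
    rw [sum_eq_single_of_mem v hv' (fun i _ hi => by simp [hi])]
    simp
  have e2 : ∑ i ∈ range (n + 1), ∑ j ∈ range (n + 1), ∑ k ∈ range (n + 1),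
      (if j = v then |coupling n c a i j k| else 0) =
      ∑ p ∈ range (n + 1), ∑ q ∈ range (n + 1), |coupling n c a p v q| := by
    refine sum_congr rfl fun i _ => ?_
    rw [sum_eq_single_of_mem v hv' (fun j _ hj => by simp [hj])]
    simp
  have e3 : ∑ i ∈ range (n + 1), ∑ j ∈ range (n + 1), ∑ k ∈ range (n + 1),
      (if k = v then |coupling n c a i j k| else 0) =
      ∑ p ∈ range (n + 1), ∑ q ∈ range (n + 1), |coupling n c a p q v| := by
    refine sum_congr rfl fun i _ => sum_congr rfl fun j _ => ?_
    rw [sum_ite_eq_of_mem' _ _ _ hv']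
  rw [e1, e2, e3, ← sum_add_distrib, ← sum_add_distrib, ← sum_pair_eq_strength hv]
  refine sum_le_sum fun p hp => ?_
  rw [← sum_add_distrib, ← sum_add_distrib]
  exact sum_le_sum fun q hq => abs_coupling_add_le hc ha hv (mem_range.1 hp) (mem_range.1 hq)

/-- The elementary bound behind `(1 + x / N)^N ≈ e^x`. -/
theorem abs_mul_log_sub_le {x : ℝ} (hx : |x| ≤ 1) (hN : 2 ≤ N) :
    |N * log (1 + x / N) - x| ≤ 2 / N * |x| := by
  have hN' : (2 : ℝ) ≤ N := by exact_mod_cast hN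
  have hN0 : (0 : ℝ) < N := by linarith
  obtain ⟨hx1, hx2⟩ := abs_le.1 hx
  have hy : -(1 / 2) ≤ x / N := by
    rw [le_div_iff₀ hN0]; linarith
  have hpos : 0 < 1 + x / N := by linarith
  have h1 : log (1 + x / N) ≤ x / N := by
    have := log_le_sub_one_of_pos hpos
    linarith
  have h2 : 1 - (1 + x / N)⁻¹ ≤ log (1 + x / N) := one_sub_inv_le_log_of_pos hpos
  have h3 : x / N - 2 * (x / N) ^ 2 ≤ 1 - (1 + x / N)⁻¹ := by
    have : 1 - (1 + x / N)⁻¹ = x / N - (x / N) ^ 2 / (1 + x / N) := by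
      have := hpos.ne'
      generalize x / (N : ℝ) = y at *
      field_simp
      ring
    rw [this, sub_le_sub_iff_left, div_le_iff₀ hpos]
    nlinarith [sq_nonneg (x / N)]
  have h4 : (N : ℝ) * (x / N) = x := by field_simp
  have h5 : (N : ℝ) * (2 * (x / N) ^ 2) = 2 / N * (x * x) := by field_simp
  have h6 : x * x ≤ |x| := by
    rw [← abs_mul_abs_self]
    nlinarith [abs_nonneg x]
  have h7 : 2 / (N : ℝ) * (x * x) ≤ 2 / N * |x| := mul_le_mul_of_nonneg_left h6 (by positivity)
  have h8 : (N : ℝ) * log (1 + x / N) ≤ N * (x / N) := mul_le_mul_of_nonneg_left h1 hN0.le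
  have h9 : (N : ℝ) * (x / N - 2 * (x / N) ^ 2) ≤ N * log (1 + x / N) :=
    mul_le_mul_of_nonneg_left (h3.trans h2) hN0.le
  rw [abs_le]
  constructor
  · linarith
  · have : 0 ≤ 2 / (N : ℝ) * |x| := by positivity
    linarith

theorem Terms.near_Z_of_abs_sub_le {T : Terms} {w w' : ℕ → ℝ} {A : Finset ℕ} {t : ℝ}
    (h : ∑ τ ∈ range T.card, |w τ - w' τ| ≤ t) : Near t (T.Z w A) (T.Z w' A) := by
  refine Near.sum fun s _ => Near.exp (le_trans ?_ h)
  rw [Terms.energy, Terms.energy, ← sum_sub_distrib]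
  refine (abs_sum_le_sum_abs _ _).trans (sum_le_sum fun τ _ => ?_)
  have hm : |T.monomial s τ| = 1 := by
    have : ∀ u, |spin s u| = 1 := fun u => by unfold spin; split_ifs <;> simp
    simp [Terms.monomial, abs_mul, this]
  rw [← sub_mul, abs_mul, hm, mul_one]

/-- The hypotheses on the coefficients: symmetry, and a bound `d` for the interactions of every
vertex. -/
structure Admissible (n : ℕ) (c : ℕ → ℕ → ℕ → ℝ) (a : ℕ → ℕ → ℝ) (d : ℝ) : Prop where
  symm₃ : ∀ i j k, c i j k = c j i k ∧ c i j k = c i k j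
  symm₂ : ∀ i j, a i j = a j i
  nonneg : 0 ≤ d
  le_one : d ≤ 1
  strength_le : ∀ v < n, strength n c a v ≤ d

variable {d : ℝ}

theorem Admissible.abs_coupling_le (h : Admissible n c a d) (i : ℕ) {j k : ℕ} (hj : j ≤ n)
    (hk : k ≤ n) : |coupling n c a i j k| ≤ d := by
  by_cases hi : i < n
  · refine le_trans ?_ ((sum_abs_coupling_le h.symm₃ h.symm₂ hi).trans (h.strength_le i hi))
    refine le_trans ?_ (single_le_sum (f := fun p => ∑ q ∈ range (n + 1), |coupling n c a i p q|)
      (fun _ _ => sum_nonneg fun _ _ => abs_nonneg _) (mem_range.2 (show j < n + 1 by omega)))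
    exact single_le_sum (f := fun q => |coupling n c a i j q|)
      (fun _ _ => abs_nonneg _) (mem_range.2 (show k < n + 1 by omega))
  · have : ¬ i < j := by omega
    simpa [coupling, this] using h.nonneg

theorem Admissible.one_add_coupling_div_pos (h : Admissible n c a d) (hN : 2 ≤ N)
    (i : ℕ) {j k : ℕ} (hj : j ≤ n) (hk : k ≤ n) :
    0 < 1 + coupling n c a i j k / N := by
  have hN' : (2 : ℝ) ≤ N := by exact_mod_cast hN
  have h1 := (abs_le.1 ((h.abs_coupling_le i hj hk).trans h.le_one)).1
  have : -(1 / 2) ≤ coupling n c a i j k / N := by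
    rw [le_div_iff₀ (by linarith)]; linarith
  linarith

theorem Admissible.weight_pos (h : Admissible n c a d) (hN : 2 ≤ N) (τ : ℕ) :
    0 < weight n N c a b τ :=
  mul_pos (exp_pos _) (pow_pos (h.one_add_coupling_div_pos hN _ cubicTerms_j_le
    cubicTerms_k_le) _)

theorem Admissible.log_weight (h : Admissible n c a d) (hN : 2 ≤ N) (τ : ℕ) :
    log (weight n N c a b τ) =
    field n b ((cubicTerms n).i τ) ((cubicTerms n).j τ) ((cubicTerms n).k τ) +
    N * log (1 + coupling n c a ((cubicTerms n).i τ) ((cubicTerms n).j τ)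
      ((cubicTerms n).k τ) / N) := by
  rw [weight, log_mul (exp_pos _).ne' (pow_pos (h.one_add_coupling_div_pos hN _
    cubicTerms_j_le cubicTerms_k_le) _).ne', log_exp, log_pow]

/-- The computed weights define a spin system whose interactions are larger than the given ones by
a factor of at most `1 + 2 / N`. -/
theorem Admissible.weight_good (h : Admissible n c a d) (hN : 2 ≤ N) :
    (cubicTerms n).Good ((1 + 2 / N) * d) (fun τ => log (weight n N c a b τ)) (range n) := by
  have hN0 : (0 : ℝ) < N := by
    have : (2 : ℝ) ≤ N := by exact_mod_cast hN
    linarith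
  refine ⟨fun τ hτ h0 v hv => ?_, fun v hv => ?_⟩
  · have hv := mem_range.1 hv
    have h0 : log (weight n N c a b τ) ≠ 0 := h0
    rw [h.log_weight hN] at h0
    have h1 := cubicTerms_i_le hτ
    unfold Terms.Once
    set i := (cubicTerms n).i τ
    set j := (cubicTerms n).j τ
    set k := (cubicTerms n).k τ
    by_contra hcon
    refine h0 ?_
    have e1 : field n b i j k = 0 := by
      unfold field
      split_ifs <;> first | rfl | (exfalso; omega)
    have e2 : coupling n c a i j k = 0 := by
      unfold coupling
      split_ifs <;> first | rfl | (exfalso; omega)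
    simp [e1, e2]
  · have hv := mem_range.1 hv
    have h1 : (cubicTerms n).load (fun τ => log (weight n N c a b τ)) (range n) v ≤
        ∑ τ ∈ range (cubicTerms n).card, (1 + 2 / N) *
          (fun i j k => if i = v ∨ j = v ∨ k = v then |coupling n c a i j k| else 0)
          ((cubicTerms n).i τ) ((cubicTerms n).j τ) ((cubicTerms n).k τ) := by
      rw [Terms.load, sum_filter]
      refine sum_le_sum fun τ hτ => ?_
      rw [h.log_weight hN]
      split_ifs with hm
      · have hm1 : (cubicTerms n).i τ = v ∨ (cubicTerms n).j τ = v ∨ (cubicTerms n).k τ = v := hm.1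
        obtain ⟨-, u, hu, huv, hm2⟩ := hm
        have hm2 : (cubicTerms n).i τ = u ∨ (cubicTerms n).j τ = u ∨ (cubicTerms n).k τ = u := hm2
        have hu := mem_range.1 hu
        have hx := (h.abs_coupling_le ((cubicTerms n).i τ)
          (cubicTerms_j_le (τ := τ)) (cubicTerms_k_le (τ := τ))).trans h.le_one
        set i := (cubicTerms n).i τ
        set j := (cubicTerms n).j τ
        set k := (cubicTerms n).k τ
        have e1 : field n b i j k = 0 := by
          unfold field
          split_ifs <;> first | rfl | (exfalso; omega)
        rw [e1, zero_add]
        simp only [hm1, if_true]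
        have h2 := abs_mul_log_sub_le hx hN
        have h3 := abs_sub_abs_le_abs_sub (N * log (1 + coupling n c a i j k / N))
          (coupling n c a i j k)
        linarith
      · dsimp only
        split_ifs
        · positivity
        · simp
    refine h1.trans ?_
    rw [← mul_sum, sum_cubicTerms fun i j k =>
      if i = v ∨ j = v ∨ k = v then |coupling n c a i j k| else 0]
    exact mul_le_mul_of_nonneg_left ((sum_mem_abs_coupling_le h.symm₃ h.symm₂ hv).trans
      (h.strength_le v hv))
      (by positivity)

/-- The effect on the partition function of replacing `e^x` by `(1 + x / N)^N`. -/
theorem Admissible.near_Z_weight (h : Admissible n c a d) (hN : 2 ≤ N) :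
    Near (2 / N * (n * d)) ((cubicTerms n).Z (fun τ => log (weight n N c a b τ)) (range n))
      ((cubicTerms n).Z (fun τ =>
        field n b ((cubicTerms n).i τ) ((cubicTerms n).j τ) ((cubicTerms n).k τ) +
        coupling n c a ((cubicTerms n).i τ) ((cubicTerms n).j τ) ((cubicTerms n).k τ))
        (range n)) := by
  refine Terms.near_Z_of_abs_sub_le ?_
  have h1 : ∀ τ ∈ range (cubicTerms n).card, |log (weight n N c a b τ) -
      (field n b ((cubicTerms n).i τ) ((cubicTerms n).j τ) ((cubicTerms n).k τ) +
        coupling n c a ((cubicTerms n).i τ) ((cubicTerms n).j τ) ((cubicTerms n).k τ))| ≤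
      2 / N * (fun i j k => |coupling n c a i j k|) ((cubicTerms n).i τ) ((cubicTerms n).j τ)
        ((cubicTerms n).k τ) := by
    intro τ _
    rw [h.log_weight hN, add_sub_add_left_eq_sub]
    exact abs_mul_log_sub_le ((h.abs_coupling_le _ cubicTerms_j_le
      cubicTerms_k_le).trans h.le_one) hN
  refine (sum_le_sum h1).trans ?_
  rw [← mul_sum, sum_cubicTerms fun i j k => |coupling n c a i j k|, sum_range_succ]
  have h2 : ∑ j ∈ range (n + 1), ∑ k ∈ range (n + 1), |coupling n c a n j k| = 0 := by
    refine sum_eq_zero fun j hj => sum_eq_zero fun k _ => ?_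
    have : ¬ n < j := by have := mem_range.1 hj; omega
    simp [coupling, this]
  rw [h2, add_zero]
  refine mul_le_mul_of_nonneg_left ?_ (by positivity)
  calc _ ≤ ∑ v ∈ range n, d := sum_le_sum fun v hv =>
        (sum_abs_coupling_le h.symm₃ h.symm₂ (mem_range.1 hv)).trans
          (h.strength_le v (mem_range.1 hv))
    _ = n * d := by simp

end SpinSystem

namespace SpinSystem

open Finset Real

/-! ### Coefficients indexed by `Fin n` -/

variable {n : ℕ}

/-- Extension by zero of a family indexed by `Fin n`. -/
def extend₁ (b : Fin n → ℝ) (i : ℕ) : ℝ := if h : i < n then b ⟨i, h⟩ else 0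

/-- Extension by zero of a matrix indexed by `Fin n`. -/
def extend₂ (a : Fin n → Fin n → ℝ) (i j : ℕ) : ℝ :=
  if h : i < n ∧ j < n then a ⟨i, h.1⟩ ⟨j, h.2⟩ else 0

/-- Extension by zero of a tensor indexed by `Fin n`. -/
def extend₃ (c : Fin n → Fin n → Fin n → ℝ) (i j k : ℕ) : ℝ :=
  if h : i < n ∧ j < n ∧ k < n then c ⟨i, h.1⟩ ⟨j, h.2.1⟩ ⟨k, h.2.2⟩ else 0

@[simp] theorem extend₁_coe (b : Fin n → ℝ) (i : Fin n) : extend₁ b i = b i := by simp [extend₁]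

@[simp] theorem extend₂_coe (a : Fin n → Fin n → ℝ) (i j : Fin n) : extend₂ a i j = a i j := by
  simp [extend₂]

@[simp] theorem extend₃_coe (c : Fin n → Fin n → Fin n → ℝ) (i j k : Fin n) :
    extend₃ c i j k = c i j k := by simp [extend₃]

theorem admissible_extend {c : Fin n → Fin n → Fin n → ℝ} {a : Fin n → Fin n → ℝ} {d : ℝ}
    (hc : ∀ i j k, c i j k = c j i k ∧ c i j k = c i k j) (ha : ∀ i j, a i j = a j i)
    (hd : 0 ≤ d) (hd1 : d ≤ 1)
    (h : ∀ i, (∑ j ∈ univ.erase i, ∑ k ∈ (Ioi j).erase i, |c i j k|)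
      + ∑ j ∈ univ.erase i, |a i j| ≤ d) :
    Admissible n (extend₃ c) (extend₂ a) d where
  symm₃ i j k := by
    unfold extend₃
    by_cases hi : i < n <;> by_cases hj : j < n <;> by_cases hk : k < n <;> simp [hi, hj, hk]
    exact hc _ _ _
  symm₂ i j := by
    unfold extend₂
    by_cases hi : i < n <;> by_cases hj : j < n <;> simp [hi, hj]
    exact ha _ _
  nonneg := hd
  le_one := hd1
  strength_le v hv := by
    refine le_trans (le_of_eq ?_) (h ⟨v, hv⟩)
    rw [← sum_add_distrib, strength, ← Fin.sum_univ_eq_sum_range (fun p => if p = v then 0 else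
      (∑ q ∈ range n, if p < q ∧ q ≠ v then |extend₃ c v p q| else 0) + |extend₂ a v p|)]
    rw [show univ.erase (⟨v, hv⟩ : Fin n) = univ.filter (fun p : Fin n => p ≠ ⟨v, hv⟩) by
      ext p; simp, sum_filter]
    refine sum_congr rfl fun p _ => ?_
    rw [← Fin.sum_univ_eq_sum_range (fun q =>
      if (p : ℕ) < q ∧ q ≠ v then |extend₃ c v p q| else 0)]
    by_cases hp : (p : ℕ) = v
    · have : p = ⟨v, hv⟩ := Fin.ext hp
      simp [this]
    · have hp' : p ≠ ⟨v, hv⟩ := fun h => hp (by rw [h])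
      rw [if_neg hp, if_pos hp']
      congr 1
      · rw [show (Ioi p).erase (⟨v, hv⟩ : Fin n) = univ.filter
          (fun q : Fin n => (p : ℕ) < q ∧ (q : ℕ) ≠ v) by
            ext q; simp [Fin.ext_iff, and_comm], sum_filter]
        refine sum_congr rfl fun q _ => ?_
        have := extend₃_coe c ⟨v, hv⟩ p q
        simp only at this
        rw [this]
      · have := extend₂_coe a ⟨v, hv⟩ p
        simp only at this
        rw [this]

theorem sum_Ioi_eq (f : ℕ → ℝ) (i : Fin n) :
    ∑ j ∈ Ioi i, f j = ∑ j ∈ range n, if (i : ℕ) < j then f j else 0 := by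
  rw [show Ioi i = univ.filter (fun j : Fin n => (i : ℕ) < j) by ext j; simp,
    sum_filter, ← Fin.sum_univ_eq_sum_range (fun j => if (i : ℕ) < j then f j else 0)]

theorem sum_range_succ_of_last {f : ℕ → ℝ} (h : f n = 0) :
    ∑ x ∈ range (n + 1), f x = ∑ x ∈ range n, f x := by
  rw [sum_range_succ, h, add_zero]

theorem sum_range_succ_eq_last {f : ℕ → ℝ} (h : ∀ x < n, f x = 0) :
    ∑ x ∈ range (n + 1), f x = f n := by
  rw [sum_range_succ, sum_eq_zero fun x hx => h x (mem_range.1 hx), zero_add]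

/-- The configuration with negative spins at the vertices in `s`. -/
def config (n : ℕ) (s : Finset ℕ) (i : Fin n) : ℤˣ := if (i : ℕ) ∈ s then -1 else 1

theorem coe_config (s : Finset ℕ) (i : Fin n) : ((config n s i : ℤ) : ℝ) = spin s i := by
  unfold config spin
  split_ifs <;> simp

theorem config_eq_neg_one {s : Finset ℕ} {i : Fin n} : config n s i = -1 ↔ (i : ℕ) ∈ s := by
  unfold config
  split_ifs with h <;> simp [h]

theorem energy_eq_cubicPoly (c : Fin n → Fin n → Fin n → ℝ) (a : Fin n → Fin n → ℝ)
    (b : Fin n → ℝ) {s : Finset ℕ} (hs : s ⊆ range n) :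
    (cubicTerms n).energy (fun τ =>
      field n (extend₁ b) ((cubicTerms n).i τ) ((cubicTerms n).j τ) ((cubicTerms n).k τ) +
      coupling n (extend₃ c) (extend₂ a) ((cubicTerms n).i τ) ((cubicTerms n).j τ)
        ((cubicTerms n).k τ)) s = cubicPoly c a b (config n s) := by
  have hn : spin s n = 1 := by
    have : n ∉ s := fun h => by simpa using hs h
    simp [spin, this]
  unfold Terms.energy Terms.monomial
  rw [sum_cubicTerms fun i j k => (field n (extend₁ b) i j k +
    coupling n (extend₃ c) (extend₂ a) i j k) * (spin s i * spin s j * spin s k)]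
  simp only [add_mul, sum_add_distrib]
  have hfield : ∑ i ∈ range (n + 1), ∑ j ∈ range (n + 1), ∑ k ∈ range (n + 1),
      field n (extend₁ b) i j k * (spin s i * spin s j * spin s k) =
      ∑ i : Fin n, b i * spin s i := by
    rw [sum_range_succ_of_last (sum_eq_zero fun j _ => sum_eq_zero fun k _ => by simp [field]),
      show ∑ i : Fin n, b i * spin s i = ∑ i : Fin n, extend₁ b i * spin s i by simp,
      Fin.sum_univ_eq_sum_range (fun i => extend₁ b i * spin s i)]
    refine sum_congr rfl fun i hi => ?_
    have hi := mem_range.1 hi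
    rw [sum_range_succ_eq_last fun j hj => sum_eq_zero fun k _ => by simp [field, hj],
      sum_range_succ_eq_last fun k hk => by simp [field, hk]]
    simp [field, hi, hn]
  have hcoupling : ∑ i ∈ range (n + 1), ∑ j ∈ range (n + 1), ∑ k ∈ range (n + 1),
      coupling n (extend₃ c) (extend₂ a) i j k * (spin s i * spin s j * spin s k) =
      ∑ i ∈ range n, ∑ j ∈ range n, if i < j then
        (∑ k ∈ range n, if j < k then extend₃ c i j k * spin s i * spin s j * spin s k else 0) +
          extend₂ a i j * spin s i * spin s j else 0 := by
    have hlast : ∀ i j k, ¬ i < j ∨ ¬ j < k →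
        coupling n (extend₃ c) (extend₂ a) i j k * (spin s i * spin s j * spin s k) = 0 := by
      intro i j k h
      unfold coupling
      split_ifs <;> first | exact zero_mul _ | (exfalso; omega)
    rw [sum_range_succ_of_last (sum_eq_zero fun j hj => sum_eq_zero fun k _ =>
      hlast _ _ _ (Or.inl (by have := mem_range.1 hj; omega)))]
    refine sum_congr rfl fun i hi => ?_
    have hi := mem_range.1 hi
    rw [sum_range_succ_of_last (sum_eq_zero fun k hk =>
      hlast _ _ _ (Or.inr (by have := mem_range.1 hk; omega)))]
    refine sum_congr rfl fun j hj => ?_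
    have hj := mem_range.1 hj
    by_cases hij : i < j
    · rw [sum_range_succ, if_pos hij]
      congr 1
      · refine sum_congr rfl fun k hk => ?_
        by_cases hjk : j < k
        · simp [coupling, hij, hjk, mem_range.1 hk, mul_assoc]
        · simp [coupling, hjk]
      · simp [coupling, hij, hj, hn, mul_assoc]
    · simp [coupling, hij]
  rw [hfield, hcoupling, cubicPoly, quadPoly]
  simp only [coe_config]
  rw [← add_assoc, ← sum_add_distrib, add_comm]
  congr 1
  rw [← Fin.sum_univ_eq_sum_range (fun i => ∑ j ∈ range n, if i < j then
        (∑ k ∈ range n, if j < k then extend₃ c i j k * spin s i * spin s j * spin s k else 0) +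
          extend₂ a i j * spin s i * spin s j else 0)]
  refine sum_congr rfl fun i _ => ?_
  rw [← sum_add_distrib]
  rw [← sum_Ioi_eq (fun j => (∑ k ∈ range n, if j < k then
    extend₃ c i j k * spin s i * spin s j * spin s k else 0) +
      extend₂ a i j * spin s i * spin s j)]
  refine sum_congr rfl fun j _ => ?_
  rw [← sum_Ioi_eq (fun k => extend₃ c i j k * spin s i * spin s j * spin s k)]
  simp

theorem Z_eq_partitionFunction (c : Fin n → Fin n → Fin n → ℝ) (a : Fin n → Fin n → ℝ)
    (b : Fin n → ℝ) :
    (cubicTerms n).Z (fun τ =>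
      field n (extend₁ b) ((cubicTerms n).i τ) ((cubicTerms n).j τ) ((cubicTerms n).k τ) +
      coupling n (extend₃ c) (extend₂ a) ((cubicTerms n).i τ) ((cubicTerms n).j τ)
        ((cubicTerms n).k τ)) (range n) = partitionFunction (cubicPoly c a b) := by
  rw [Terms.Z, partitionFunction]
  refine sum_bij' (fun s _ => config n s)
    (fun x _ => (univ.filter fun i : Fin n => x i = -1).map Fin.valEmbedding)
    (fun _ _ => mem_univ _) (fun x _ => ?_) (fun s hs => ?_) (fun x _ => ?_) (fun s hs => ?_)
  · rw [mem_powerset]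
    intro u hu
    obtain ⟨i, -, rfl⟩ := mem_map.1 hu
    exact mem_range.2 i.2
  · ext u
    have hs := mem_powerset.1 hs
    rw [mem_map]
    constructor
    · rintro ⟨i, hi, rfl⟩
      rw [mem_filter, config_eq_neg_one] at hi
      exact hi.2
    · intro hu
      exact ⟨⟨u, mem_range.1 (hs hu)⟩, mem_filter.2 ⟨mem_univ _, config_eq_neg_one.2 hu⟩, rfl⟩
  · funext i
    have hmem : config n (map Fin.valEmbedding {i | x i = -1}) i = -1 ↔ x i = -1 := by
      rw [config_eq_neg_one, mem_map]
      constructor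
      · rintro ⟨j, hj, hji⟩
        rw [← Fin.ext hji]
        exact (mem_filter.1 hj).2
      · exact fun hi => ⟨i, mem_filter.2 ⟨mem_univ _, hi⟩, rfl⟩
    rcases Int.units_eq_one_or (x i) with hi | hi
    · rw [hi] at hmem ⊢
      rcases Int.units_eq_one_or (config n (map Fin.valEmbedding {i | x i = -1}) i) with h | h
      · exact h
      · exact absurd (hmem.1 h) (by decide)
    · rw [hi]
      exact hmem.2 hi
  · rw [energy_eq_cubicPoly c a b (mem_powerset.1 hs)]

end SpinSystem

namespace RealRAM

open SpinSystem

/-! ### The algorithm, written as recursions that fill tables -/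

instance : Add NExpr := ⟨.add⟩
instance : Sub NExpr := ⟨.sub⟩
instance : Mul NExpr := ⟨.mul⟩
instance : Div NExpr := ⟨.div⟩

/-- The numeral `k`. -/
def NExpr.numeral (k : ℕ) : NExpr := .const k

instance (k : ℕ) : OfNat NExpr k := ⟨.numeral k⟩
instance : Add RExpr := ⟨.add⟩
instance : Mul RExpr := ⟨.mul⟩
instance : Div RExpr := ⟨.div⟩

/-- The numeral `k`. -/
def RExpr.numeral (k : ℕ) : RExpr := .const k

instance (k : ℕ) : OfNat RExpr k := ⟨.numeral k⟩

variable {inp : List ℝ} {E : Env}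

namespace NExpr

@[simp] theorem eval_add (a b : NExpr) : (a + b).eval E = a.eval E + b.eval E := rfl
@[simp] theorem eval_sub (a b : NExpr) : (a - b).eval E = a.eval E - b.eval E := rfl
@[simp] theorem eval_mul (a b : NExpr) : (a * b).eval E = a.eval E * b.eval E := rfl
@[simp] theorem eval_div (a b : NExpr) : (a / b).eval E = a.eval E / b.eval E := rfl
@[simp] theorem eval_ofNat (k : ℕ) : (no_index (OfNat.ofNat k) : NExpr).eval E = OfNat.ofNat k :=
  rfl

/-- The remainder of `a` modulo `b`. -/
def mod (a b : NExpr) : NExpr := a - b * (a / b)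

@[simp] theorem eval_mod (a b : NExpr) : (mod a b).eval E = a.eval E % b.eval E := by
  simp [mod, Nat.mod_eq_sub_mul_div]

/-- The distance of two numbers; it vanishes if and only if they are equal. -/
def dist (a b : NExpr) : NExpr := (a - b) + (b - a)

@[simp] theorem eval_dist (a b : NExpr) :
    (dist a b).eval E = a.eval E - b.eval E + (b.eval E - a.eval E) := rfl

/-- `if a = b then c else d` -/
def iteEq (a b c d : NExpr) : NExpr := .ite (dist a b) 1 c d

@[simp] theorem eval_iteEq (a b c d : NExpr) :
    (iteEq a b c d).eval E = if a.eval E = b.eval E then c.eval E else d.eval E := by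
  have : a.eval E - b.eval E + (b.eval E - a.eval E) < 1 ↔ a.eval E = b.eval E := by omega
  simp [iteEq, -Nat.lt_one_iff, this]

end NExpr

namespace RExpr

@[simp] theorem eval_add (a b : RExpr) : (a + b).eval inp E = a.eval inp E + b.eval inp E := rfl
@[simp] theorem eval_mul (a b : RExpr) : (a * b).eval inp E = a.eval inp E * b.eval inp E := rfl
@[simp] theorem eval_div (a b : RExpr) : (a / b).eval inp E = a.eval inp E / b.eval inp E := rfl
@[simp] theorem eval_zero : (0 : RExpr).eval inp E = 0 := Int.cast_zero
@[simp] theorem eval_one : (1 : RExpr).eval inp E = 1 := Int.cast_one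
@[simp] theorem ok_add (a b : RExpr) : (a + b).Ok inp E ↔ a.Ok inp E ∧ b.Ok inp E := Iff.rfl
@[simp] theorem ok_mul (a b : RExpr) : (a * b).Ok inp E ↔ a.Ok inp E ∧ b.Ok inp E := Iff.rfl
@[simp] theorem ok_div (a b : RExpr) :
    (a / b).Ok inp E ↔ a.Ok inp E ∧ b.Ok inp E ∧ b.eval inp E ≠ 0 := Iff.rfl
@[simp] theorem ok_ofNat (k : ℕ) : (no_index (OfNat.ofNat k) : RExpr).Ok inp E := trivial

/-- `if a = b then c else d` -/
def iteEq (a b : NExpr) (c d : RExpr) : RExpr := .ite (.dist a b) 1 c d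

@[simp] theorem eval_iteEq (a b : NExpr) (c d : RExpr) : (iteEq a b c d).eval inp E =
    if a.eval E = b.eval E then c.eval inp E else d.eval inp E := by
  have : a.eval E - b.eval E + (b.eval E - a.eval E) < 1 ↔ a.eval E = b.eval E := by omega
  simp [iteEq, -Nat.lt_one_iff, this]

@[simp] theorem ok_iteEq (a b : NExpr) (c d : RExpr) : (iteEq a b c d).Ok inp E ↔
    if a.eval E = b.eval E then c.Ok inp E else d.Ok inp E := by
  have : a.eval E - b.eval E + (b.eval E - a.eval E) < 1 ↔ a.eval E = b.eval E := by omega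
  simp [iteEq, -Nat.lt_one_iff, this]

end RExpr

/-- The number of spins. -/
def nE : NExpr := .var 0

/-- A natural number that is at least `1 / ε`. -/
def eE : NExpr := .var 1

/-- The index of the table entry that is computed. -/
def xE : NExpr := .var 2

@[simp] theorem eval_nE : nE.eval E = E.var 0 := rfl
@[simp] theorem eval_xE : xE.eval E = E.var 2 := rfl

/-- The number of monomials. -/
def cardE : NExpr := (nE + 1) * (nE + 1) * (nE + 1)

/-- The first vertex of a monomial. -/
def iE (t : NExpr) : NExpr := t / (nE + 1) / (nE + 1)

/-- The second vertex of a monomial. -/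
def jE (t : NExpr) : NExpr := .mod (t / (nE + 1)) (nE + 1)

/-- The third vertex of a monomial. -/
def kE (t : NExpr) : NExpr := .mod t (nE + 1)

@[simp] theorem eval_cardE : cardE.eval E = (cubicTerms (E.var 0)).card := rfl
@[simp] theorem eval_iE (t : NExpr) : (iE t).eval E = (cubicTerms (E.var 0)).i (t.eval E) := rfl
@[simp] theorem eval_jE (t : NExpr) : (jE t).eval E = (cubicTerms (E.var 0)).j (t.eval E) := by
  simp [jE, cubicTerms]
@[simp] theorem eval_kE (t : NExpr) : (kE t).eval E = (cubicTerms (E.var 0)).k (t.eval E) := by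
  simp [kE, cubicTerms]

/-- A number that vanishes if and only if the vertex `v` occurs in the monomial `t`. -/
def memE (v t : NExpr) : NExpr := .dist (iE t) v * .dist (jE t) v * .dist (kE t) v

theorem eval_memE_lt (v t : NExpr) :
    (memE v t).eval E < 1 ↔ (cubicTerms (E.var 0)).Mem (v.eval E) (t.eval E) := by
  rw [Nat.lt_one_iff]
  simp only [memE, NExpr.eval_mul, NExpr.eval_dist, eval_iE, eval_jE, eval_kE, mul_eq_zero,
    Terms.Mem]
  omega

/-- `if v ∈ t then c else d`, for a vertex `v` and a monomial `t`. -/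
def RExpr.iteMem (v t : NExpr) (c d : RExpr) : RExpr := .ite (memE v t) 1 c d

@[simp] theorem RExpr.eval_iteMem (v t : NExpr) (c d : RExpr) : (iteMem v t c d).eval inp E =
    if (cubicTerms (E.var 0)).Mem (v.eval E) (t.eval E) then c.eval inp E else d.eval inp E := by
  change (if (memE v t).eval E < 1 then _ else _) = _
  simp only [eval_memE_lt]

@[simp] theorem RExpr.ok_iteMem (v t : NExpr) (c d : RExpr) : (iteMem v t c d).Ok inp E ↔
    if (cubicTerms (E.var 0)).Mem (v.eval E) (t.eval E) then c.Ok inp E else d.Ok inp E := by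
  change (if (memE v t).eval E < 1 then _ else _) ↔ _
  simp only [eval_memE_lt]

/-- The first vertex of the monomial `t` other than `v`. -/
def fstE (v t : NExpr) : NExpr := .iteEq (iE t) v (jE t) (iE t)

/-- The second vertex of the monomial `t` other than `v`. -/
def sndE (v t : NExpr) : NExpr := .iteEq (iE t) v (kE t) (.iteEq (jE t) v (kE t) (jE t))

/-- The vertex whose spin is fixed in branch `k` at the monomial `t` that contains `v`. -/
def pinE (v t k : NExpr) : NExpr := .ite k 2 (fstE v t) (sndE v t)

/-- The vertex whose odds are taken in branch `k` at the monomial `t` that contains `v`. -/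
def queryE (v t k : NExpr) : NExpr := .ite k 2 (sndE v t) (fstE v t)

@[simp] theorem eval_fstE (v t : NExpr) :
    (fstE v t).eval E = (cubicTerms (E.var 0)).fst (v.eval E) (t.eval E) := by
  simp [fstE, Terms.fst]

@[simp] theorem eval_sndE (v t : NExpr) :
    (sndE v t).eval E = (cubicTerms (E.var 0)).snd (v.eval E) (t.eval E) := by
  simp only [sndE, Terms.snd, NExpr.eval_iteEq, eval_iE, eval_jE, eval_kE]
  split_ifs <;> tauto

@[simp] theorem eval_pinE (v t k : NExpr) :
    (pinE v t k).eval E = (cubicTerms (E.var 0)).pin (v.eval E) (t.eval E) (k.eval E) := by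
  simp [pinE, Terms.pin]

@[simp] theorem eval_queryE (v t k : NExpr) :
    (queryE v t k).eval E = (cubicTerms (E.var 0)).query (v.eval E) (t.eval E) (k.eval E) := by
  simp [queryE, Terms.query]

/-- The parent of the node `m`. -/
def parentE (m : NExpr) : NExpr := (m - nE) / 4 / cardE

/-- The monomial that leads from the parent to the node `m`. -/
def termE (m : NExpr) : NExpr := .mod ((m - nE) / 4) cardE

/-- The branch that leads from the parent to the node `m`. -/
def branchE (m : NExpr) : NExpr := .mod (m - nE) 4

@[simp] theorem eval_parentE (m : NExpr) :
    (parentE m).eval E = (m.eval E - E.var 0) / 4 / (cubicTerms (E.var 0)).card := rfl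
@[simp] theorem eval_termE (m : NExpr) :
    (termE m).eval E = (m.eval E - E.var 0) / 4 % (cubicTerms (E.var 0)).card := by
  simp [termE]
@[simp] theorem eval_branchE (m : NExpr) : (branchE m).eval E = (m.eval E - E.var 0) % 4 := by
  simp [branchE]

/-! The natural tables are: `0` the binary logarithm, `1` the number of nodes above a level, `2` the
distinguished vertex of a node, `3` (node by node) the indicator of the vertices that are not free.
The real tables are: `0` the partial products of the weights, `1` (node by node) the exponentials
of the coefficients, `2` (node by node, in decreasing order) the partial products of the odds, `3`
the partial products of the result. -/

variable (k₀ K : ℕ)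

/-- The depth of the recursion. -/
def depth (n e : ℕ) : ℕ := k₀ * (Nat.log 2 (n * e) + 4)

/-- The number of nodes at which the recursion is carried out. -/
def internal (n e : ℕ) : ℕ := (cubicTerms n).levelSize n (depth k₀ n e)

/-- The number of all nodes. -/
def total (n e : ℕ) : ℕ := n + internal k₀ n e * (cubicTerms n).card * 4

/-- The exponent `N` in `(1 + x / N)^N ≈ e^x`. -/
def precision (n e : ℕ) : ℕ := K * (n * e)

def depthE : NExpr := .const k₀ * (.tab 0 (nE * eE) + 4)

def internalE : NExpr := .tab 1 (depthE k₀)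

def totalE : NExpr := nE + internalE k₀ * cardE * 4

def precisionE : NExpr := .const K * (nE * eE)

def logLen : NExpr := nE * eE + 1

/-- `log₂ x`, from `log₂ (x / 2)`. -/
def logBody : NExpr := .ite xE 2 0 (.tab 0 (xE / 2) + 1)

def levelLen : NExpr := depthE k₀ + 1

/-- The number of nodes above level `x`. -/
def levelBody : NExpr := .ite xE 1 0 (nE + .tab 1 (xE - 1) * cardE * 4)

def vertexLen : NExpr := totalE k₀

/-- The distinguished vertex of the node `x`. -/
def vertexBody : NExpr :=
  .ite xE nE xE (queryE (.tab 2 (parentE xE)) (termE xE) (branchE xE))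

def deadLen : NExpr := totalE k₀ * (nE + 1)

/-- Entry `m (n + 1) + u` tells whether the vertex `u` is not free at the node `m`. -/
def deadBody : NExpr :=
  let m := xE / (nE + 1)
  let u := NExpr.mod xE (nE + 1)
  let v := NExpr.tab 2 (parentE m)
  .ite m nE (.ite u m 1 (.ite u nE 0 1))
    (.iteEq u v 1 (.iteEq u (pinE v (termE m) (branchE m)) 1 (.tab 3 (parentE m * (nE + 1) + u))))

/-- `exp` of the coefficient of a monomial of degree one, and `1` for other monomials. -/
def fieldE (t : NExpr) : RExpr :=
  .ite (iE t) nE (.ite (jE t) nE 1 (.ite (kE t) nE 1 (.input (1 + iE t)))) 1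

/-- The coefficient of a monomial of degree two or three, and `0` for other monomials. -/
def couplingE (t : NExpr) : RExpr :=
  .ite (iE t) (jE t) (.ite (jE t) (kE t) (.ite (kE t) nE
    (.input (1 + nE + nE * nE + ((iE t * nE + jE t) * nE + kE t)))
    (.input (1 + nE + (iE t * nE + jE t)))) 0) 0

def weightLen : NExpr := cardE * (precisionE K + 1)

/-- Entry `t (N + 1) + s` is `e^{field} (1 + coupling / N)^s` for the monomial `t`. -/
def weightBody : RExpr :=
  let t := xE / (precisionE K + 1)
  .ite (.mod xE (precisionE K + 1)) 1 (fieldE t)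
    (.tab 0 (xE - 1) * (1 + couplingE t / .ofNat (precisionE K)))

def systemLen : NExpr := totalE k₀ * cardE

/-- `exp` of a coefficient of the parent, after the cut. -/
def cutE (m s : NExpr) : RExpr :=
  let q := RExpr.tab 1 (parentE m * cardE + s)
  .iteMem (.tab 2 (parentE m)) s (.ite s (termE m) (1 / q) (.ite (termE m) s q 1)) q

/-- Entry `m * card + s` is `exp` of the coefficient of the monomial `s` at the node `m`. -/
def systemBody : RExpr :=
  let m := xE / cardE
  let s := NExpr.mod xE cardE
  .ite m nE (.tab 0 (s * (precisionE K + 1) + precisionE K))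
    (.iteEq (.mod (branchE m) 2) 1
      (.iteMem (pinE (.tab 2 (parentE m)) (termE m) (branchE m)) s (1 / cutE m s) (cutE m s))
      (cutE m s))

def valueLen : NExpr := totalE k₀ * (cardE + 1)

/-- The computed odds at the node `m`. -/
def valueE (m : NExpr) : RExpr := .tab 2 ((totalE k₀ - 1 - m) * (cardE + 1) + cardE)

/-- The computed odds at a child of the node `m`. -/
def childE (m t : NExpr) (κ : ℕ) : RExpr := valueE k₀ (nE + ((m * cardE + t) * 4 + .const κ))

/-- The value of `pairOdds` for the computed odds at the children of `m` at the monomial `t`. -/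
def pairOddsE (m t : NExpr) : RExpr :=
  childE k₀ m t 0 / (1 + childE k₀ m t 0 * childE k₀ m t 3) +
    childE k₀ m t 2 / (1 + childE k₀ m t 2 * childE k₀ m t 1)

/-- The factor of the odds at the node `m` that comes from the monomial `t`. -/
def factorE (m t : NExpr) : RExpr :=
  let q := RExpr.tab 1 (m * cardE + t) * RExpr.tab 1 (m * cardE + t)
  (1 + q * pairOddsE k₀ m t) / (q + pairOddsE k₀ m t)

/-- Entry `(total - 1 - m) (card + 1) + s` is the product of the first `s` factors of the odds at
the node `m`. The order of the nodes is reversed because the odds at a node depend on the odds at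
its children. -/
def valueBody : RExpr :=
  let m := totalE k₀ - 1 - xE / (cardE + 1)
  let s := NExpr.mod xE (cardE + 1)
  .ite s 1 (.ite (.tab 3 (m * (nE + 1) + .tab 2 m)) 1 1 0)
    (.tab 2 (xE - 1) * .ite m (internalE k₀)
      (.iteMem (.tab 2 m) (s - 1) (factorE k₀ m (s - 1)) 1) 1)

def outLen : NExpr := cardE + nE + 1

/-- Entry `x` is the product of the first `x` of the weights of the monomials and the numbers `1 +`
odds of the roots. -/
def outBody : RExpr :=
  .ite xE 1 1 (.tab 3 (xE - 1) * .ite (xE - 1) cardE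
    (.tab 0 ((xE - 1) * (precisionE K + 1) + precisionE K)) (1 + valueE k₀ (xE - 1 - cardE)))

end RealRAM

namespace RealRAM

open SpinSystem Finset

/-! ### Correctness of the recursions -/

variable {inp : List ℝ} {E : Env} {n e x N k₀ K G L : ℕ} {w : ℕ → ℝ}
  {c : ℕ → ℕ → ℕ → ℝ} {a : ℕ → ℕ → ℝ} {b : ℕ → ℝ}

theorem logBody_eval (hx : E.var 2 = x) (h : ∀ y < x, E.nat 0 y = Nat.log 2 y) :
    logBody.eval E = Nat.log 2 x := by
  simp only [logBody, NExpr.eval, NExpr.eval_div, eval_xE, NExpr.eval_ofNat, hx]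
  split_ifs with h2
  · rw [Nat.log_of_lt h2]
  · rw [h _ (Nat.div_lt_self (by omega) (by omega)), 
      Nat.log_of_one_lt_of_le (n := x) (by omega) (by omega)]

theorem depthE_eval (hn : E.var 0 = n) (he : E.var 1 = e)
    (h : E.nat 0 (n * e) = Nat.log 2 (n * e)) : (depthE k₀).eval E = depth k₀ n e := by
  change k₀ * (E.nat 0 (E.var 0 * E.var 1) + 4) = _
  rw [hn, he, h, depth]

theorem levelBody_eval (hn : E.var 0 = n) (hx : E.var 2 = x)
    (h : ∀ y < x, E.nat 1 y = (cubicTerms n).levelSize n y) :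
    levelBody.eval E = (cubicTerms n).levelSize n x := by
  change (if E.var 2 < 1 then 0 else E.var 0 + E.nat 1 (E.var 2 - 1) *
    (cubicTerms (E.var 0)).card * 4) = _
  rw [hx, hn]
  cases x with
  | zero => rfl
  | succ x => rw [if_neg (by omega), h _ (by omega)]; rfl

/-- The registers that hold the parameters of the computation forest have been filled. -/
structure Prepared (k₀ n e : ℕ) (E : Env) : Prop where
  n_eq : E.var 0 = n
  e_eq : E.var 1 = e
  internal_eq : (internalE k₀).eval E = internal k₀ n e

theorem Prepared.total_eq (h : Prepared k₀ n e E) : (totalE k₀).eval E = total k₀ n e := by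
  change E.var 0 + (internalE k₀).eval E * (cubicTerms (E.var 0)).card * 4 = _
  rw [h.internal_eq, h.n_eq, total]

theorem precisionE_eval (hn : E.var 0 = n) (he : E.var 1 = e) :
    (precisionE K).eval E = precision K n e := by
  change K * (E.var 0 * E.var 1) = _
  rw [hn, he, precision]

theorem parent_lt (hn : 0 < n) (hx : n ≤ x) : (x - n) / 4 / (cubicTerms n).card < x := by
  have h1 := Nat.div_le_self ((x - n) / 4) (cubicTerms n).card
  have h2 := Nat.div_le_self (x - n) 4
  omega

theorem vertexBody_eval (hn0 : 0 < n) (hn : E.var 0 = n) (hx : E.var 2 = x)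
    (h : ∀ y < x, E.nat 2 y = ((cubicTerms n).node n w y).v) :
    vertexBody.eval E = ((cubicTerms n).node n w x).v := by
  simp only [vertexBody, NExpr.eval, eval_xE, eval_nE, eval_queryE, eval_parentE, eval_termE,
    eval_branchE, hx, hn]
  split_ifs with h1
  · rw [Terms.node_root h1]
  · have h2 : n ≤ x := not_lt.1 h1
    rw [h _ (parent_lt hn0 h2), Terms.node_of_le (m := x) hn0 h2]
    rfl

/-- The indicator of the vertices that are not free, node by node. -/
def deadSpec (n : ℕ) (w : ℕ → ℝ) (x : ℕ) : ℕ :=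
  if x % (n + 1) ∈ ((cubicTerms n).node n w (x / (n + 1))).A then 0 else 1

theorem mul_add_div_mod {m v q : ℕ} (hv : v < q) :
    (m * q + v) / q = m ∧ (m * q + v) % q = v := by
  rw [mul_comm, Nat.mul_add_div (by omega), Nat.div_eq_of_lt hv, Nat.mul_add_mod,
    Nat.mod_eq_of_lt hv]
  exact ⟨by omega, rfl⟩

theorem mul_add_lt_of_lt {m v q x : ℕ} (hm : m < x / q) (hv : v < q) : m * q + v < x := by
  have h1 : (m + 1) * q ≤ x / q * q := Nat.mul_le_mul_right _ hm
  have h2 := Nat.div_mul_le_self x q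
  rw [Nat.add_mul] at h1
  omega

theorem mul_add_lt_mul {m v q l : ℕ} (hm : m < l) (hv : v < q) : m * q + v < l * q := by
  have h1 : (m + 1) * q ≤ l * q := Nat.mul_le_mul_right _ hm
  rw [Nat.add_mul] at h1
  omega

theorem card_pos : 0 < (cubicTerms n).card := by
  simp [cubicTerms]

theorem node_v_le (hn : 0 < n) (m : ℕ) : ((cubicTerms n).node n w m).v ≤ n := by
  rcases lt_or_ge m n with hm | hm
  · rw [Terms.node_root hm]; exact hm.le
  · rw [Terms.node_of_le hn hm]
    have hi := cubicTerms_i_le (Nat.mod_lt ((m - n) / 4) (card_pos (n := n)))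
    simp only [Terms.child, Terms.query, Terms.fst, Terms.snd]
    split_ifs <;> first | exact cubicTerms_j_le | exact cubicTerms_k_le | exact hi

theorem deadBody_eval (hn0 : 0 < n) (hn : E.var 0 = n) (hx : E.var 2 = x)
    (hv : ∀ y ≤ x / (n + 1), E.nat 2 y = ((cubicTerms n).node n w y).v)
    (h : ∀ y < x, E.nat 3 y = deadSpec n w y) : deadBody.eval E = deadSpec n w x := by
  simp only [deadBody, NExpr.eval, eval_xE, eval_nE, NExpr.eval_div,
    NExpr.eval_mod, NExpr.eval_ofNat, NExpr.eval_iteEq, eval_pinE, eval_parentE, eval_termE,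
    eval_branchE, hx, hn]
  have hu : x % (n + 1) < n + 1 := Nat.mod_lt _ (by omega)
  rw [deadSpec]
  by_cases h1 : x / (n + 1) < n
  · rw [if_pos h1, Terms.node_root h1]
    simp only [mem_Ico]
    split_ifs <;> omega
  · rw [if_neg h1]
    have h2 : n ≤ x / (n + 1) := not_lt.1 h1
    have h3 := parent_lt hn0 h2
    rw [hv _ h3.le, h _ (mul_add_lt_of_lt h3 hu), deadSpec, (mul_add_div_mod hu).1,
      (mul_add_div_mod hu).2, Terms.node_of_le (m := x / (n + 1)) hn0 h2]
    simp only [Terms.child, mem_erase]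
    split_ifs <;> tauto

/-- The partial products of the weights. -/
noncomputable def weightSpec (n N : ℕ) (c : ℕ → ℕ → ℕ → ℝ) (a : ℕ → ℕ → ℝ) (b : ℕ → ℝ)
    (x : ℕ) : ℝ :=
  let τ := x / (N + 1)
  Real.exp (field n b ((cubicTerms n).i τ) ((cubicTerms n).j τ) ((cubicTerms n).k τ)) *
    (1 + coupling n c a ((cubicTerms n).i τ) ((cubicTerms n).j τ) ((cubicTerms n).k τ) / N) ^
      (x % (N + 1))

/-- The input list holds the numbers `e^{b_i}`, `a_ij` and `c_ijk`. -/
structure Encodes (n : ℕ) (c : ℕ → ℕ → ℕ → ℝ) (a : ℕ → ℕ → ℝ) (b : ℕ → ℝ) (inp : List ℝ) :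
    Prop where
  b_eq : ∀ i < n, inp.getD (1 + i) 0 = Real.exp (b i)
  a_eq : ∀ i < n, ∀ j < n, inp.getD (1 + n + (i * n + j)) 0 = a i j
  c_eq : ∀ i < n, ∀ j < n, ∀ k < n, inp.getD (1 + n + n * n + ((i * n + j) * n + k)) 0 = c i j k

theorem fieldE_eval (hn : E.var 0 = n) (hi : Encodes n c a b inp) (t : NExpr) :
    (fieldE t).Ok inp E ∧ (fieldE t).eval inp E = Real.exp (field n b
      ((cubicTerms n).i (t.eval E)) ((cubicTerms n).j (t.eval E))
      ((cubicTerms n).k (t.eval E))) := by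
  simp only [fieldE, RExpr.Ok, RExpr.eval, eval_iE, eval_jE, eval_kE, eval_nE, hn, field,
    NExpr.eval_add, NExpr.eval_ofNat, RExpr.ok_ofNat, RExpr.eval_one]
  split_ifs with h1 h2 h3
  · simp
  · simp
  · exact ⟨trivial, hi.b_eq _ h1⟩
  · simp

theorem couplingE_eval (hn : E.var 0 = n) (hi : Encodes n c a b inp) (t : NExpr) :
    (couplingE t).Ok inp E ∧ (couplingE t).eval inp E = coupling n c a
      ((cubicTerms n).i (t.eval E)) ((cubicTerms n).j (t.eval E))
      ((cubicTerms n).k (t.eval E)) := by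
  simp only [couplingE, RExpr.Ok, RExpr.eval, eval_iE, eval_jE, eval_kE, eval_nE, hn, coupling,
    NExpr.eval_add, NExpr.eval_mul, NExpr.eval_ofNat, RExpr.ok_ofNat, RExpr.eval_zero]
  have hk : (cubicTerms n).k (t.eval E) ≤ n := cubicTerms_k_le
  split_ifs with h1 h2 h3
  · exact ⟨trivial, hi.c_eq _ (by omega) _ (by omega) _ h3⟩
  · exact ⟨trivial, hi.a_eq _ (by omega) _ (by omega)⟩
  · simp
  · simp

theorem weightBody_eval (hn : E.var 0 = n) (he : E.var 1 = e) (hx : E.var 2 = x)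
    (hK : 0 < precision K n e) (hi : Encodes n c a b inp)
    (h : ∀ y < x, E.real 0 y = weightSpec n (precision K n e) c a b y) :
    (weightBody K).Ok inp E ∧
      (weightBody K).eval inp E = weightSpec n (precision K n e) c a b x := by
  have hN := precisionE_eval (K := K) hn he
  have hf := fieldE_eval hn hi (xE / (precisionE K + 1))
  have hc := couplingE_eval hn hi (xE / (precisionE K + 1))
  simp only [weightBody, RExpr.Ok, RExpr.eval, NExpr.eval_mod, NExpr.eval_add, NExpr.eval_div,
    NExpr.eval_ofNat, RExpr.ok_ofNat, RExpr.eval_one, RExpr.ok_div,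
    RExpr.eval_div, NExpr.eval_sub, eval_xE, hx, hN] at hf hc ⊢
  have hx1 := Nat.div_add_mod x (precision K n e + 1)
  split_ifs with h1
  · refine ⟨hf.1, ?_⟩
    rw [hf.2, weightSpec, Nat.lt_one_iff.1 h1]
    simp
  · refine ⟨⟨trivial, trivial, hc.1, trivial, by positivity⟩, ?_⟩
    have h2 : x % (precision K n e + 1) < precision K n e + 1 := Nat.mod_lt x (by omega)
    obtain ⟨r, hr⟩ := Nat.exists_eq_succ_of_ne_zero
      (n := x % (precision K n e + 1)) (by omega)
    have h3 : x - 1 = x / (precision K n e + 1) * (precision K n e + 1) +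
        (x % (precision K n e + 1) - 1) := by rw [mul_comm]; omega
    have h4 := mul_add_div_mod (m := x / (precision K n e + 1))
      (v := x % (precision K n e + 1) - 1) (q := precision K n e + 1) (by omega)
    rw [h _ (by omega), hc.2, weightSpec, weightSpec, h3, h4.1, h4.2]
    simp only [hr, Nat.succ_eq_add_one, Nat.add_sub_cancel, pow_succ]
    ring

/-- The exponentials of the coefficients, node by node. -/
noncomputable def systemSpec (n : ℕ) (w : ℕ → ℝ) (x : ℕ) : ℝ :=
  Real.exp (((cubicTerms n).node n w (x / (cubicTerms n).card)).w (x % (cubicTerms n).card))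

theorem cutE_eval {w' : ℕ → ℝ} {v : ℕ} (hn : E.var 0 = n) (m s : NExpr)
    (hv : E.nat 2 ((m.eval E - n) / 4 / (cubicTerms n).card) = v)
    (hw : E.real 1 ((m.eval E - n) / 4 / (cubicTerms n).card * (cubicTerms n).card + s.eval E) =
      Real.exp (w' (s.eval E))) :
    (cutE m s).Ok inp E ∧ (cutE m s).eval inp E = Real.exp ((cubicTerms n).cut v
      ((m.eval E - n) / 4 % (cubicTerms n).card) w' (s.eval E)) := by
  simp only [cutE, RExpr.eval_iteMem, RExpr.ok_iteMem, RExpr.Ok, RExpr.eval, NExpr.eval,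
    eval_cardE, eval_parentE,
    eval_termE, RExpr.ok_ofNat, RExpr.eval_one, RExpr.ok_div, RExpr.eval_div,
    hn, hv, hw, Terms.cut]
  split_ifs with h1 h2 h3 h4 h5 <;>
    first | omega | simp [Real.exp_neg, Real.exp_ne_zero]

theorem systemBody_eval (hn0 : 0 < n) (hn : E.var 0 = n) (he : E.var 1 = e) (hx : E.var 2 = x)
    (hv : ∀ y ≤ x / (cubicTerms n).card, E.nat 2 y = ((cubicTerms n).node n w y).v)
    (hw : ∀ τ < (cubicTerms n).card,
      E.real 0 (τ * (precision K n e + 1) + precision K n e) = Real.exp (w τ))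
    (h : ∀ y < x, E.real 1 y = systemSpec n w y) :
    (systemBody K).Ok inp E ∧ (systemBody K).eval inp E = systemSpec n w x := by
  have hN := precisionE_eval (K := K) hn he
  have hs := Nat.mod_lt x (card_pos (n := n))
  by_cases h1 : x / (cubicTerms n).card < n
  · simp only [systemBody, RExpr.Ok, RExpr.eval, NExpr.eval_div, NExpr.eval_mod, NExpr.eval_mul,
      NExpr.eval_add, NExpr.eval_ofNat, eval_cardE, eval_xE, eval_nE, hn, hx, hN, if_pos h1]
    rw [hw _ hs, systemSpec, Terms.node_root h1]
    exact ⟨trivial, rfl⟩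
  · have h2 : n ≤ x / (cubicTerms n).card := not_lt.1 h1
    have h3 := parent_lt hn0 h2
    have h4 := mul_add_div_mod (m := (x / (cubicTerms n).card - n) / 4 / (cubicTerms n).card) hs
    have hcut := cutE_eval (inp := inp) (w' := ((cubicTerms n).node n w
      ((x / (cubicTerms n).card - n) / 4 / (cubicTerms n).card)).w) hn (xE / cardE)
      (.mod xE cardE) (by
        simp only [NExpr.eval_div, eval_xE, eval_cardE, hn, hx]; exact hv _ h3.le) (by
        simp only [NExpr.eval_div, NExpr.eval_mod, eval_xE, eval_cardE, hn, hx]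
        rw [h _ (mul_add_lt_of_lt h3 hs), systemSpec, h4.1, h4.2])
    simp only [systemBody, RExpr.Ok, RExpr.eval, NExpr.eval, NExpr.eval_div, NExpr.eval_mod,
      RExpr.ok_iteEq, RExpr.eval_iteEq, RExpr.ok_iteMem, RExpr.eval_iteMem, eval_branchE,
      eval_termE, eval_parentE, eval_pinE, RExpr.ok_div, RExpr.eval_div, RExpr.ok_ofNat,
      RExpr.eval_one, NExpr.eval_ofNat, eval_cardE, eval_xE, eval_nE, hn, hx, if_neg h1,
      hv _ h3.le] at hcut ⊢
    rw [systemSpec, Terms.node_of_le (m := x / (cubicTerms n).card) hn0 h2, hcut.2]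
    simp only [hcut.1, Terms.child, Terms.branch, true_and, ne_eq, Real.exp_ne_zero,
      not_false_eq_true, ite_self]
    split_ifs <;> simp [Real.exp_neg, Terms.flip, *]

end RealRAM

namespace RealRAM

open SpinSystem Finset

variable {inp : List ℝ} {E : Env} {n e x N k₀ K G L : ℕ} {w : ℕ → ℝ}
  {c : ℕ → ℕ → ℕ → ℝ} {a : ℕ → ℕ → ℝ} {b : ℕ → ℝ}

/-- The partial products of the computed odds, node by node in decreasing order. -/
noncomputable def valueSpec (n : ℕ) (w : ℕ → ℝ) (G L x : ℕ) : ℝ :=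
  let T := cubicTerms n
  let m := L - 1 - x / (T.card + 1)
  let P := T.node n w m
  (if P.v ∈ P.A then 1 else 0) * ∏ τ ∈ range (x % (T.card + 1)), if m < G then
    if T.Mem P.v τ then factor (Real.exp (2 * P.w τ))
      (pairOdds fun κ => T.value n w G (T.childIndex n m τ κ)) else 1 else 1

theorem valueSpec_last (hn0 : 0 < n) {m : ℕ} (hm : m < L) :
    valueSpec n w G L ((L - 1 - m) * ((cubicTerms n).card + 1) + (cubicTerms n).card) =
      (cubicTerms n).value n w G m := by
  have h := mul_add_div_mod (m := L - 1 - m) (Nat.lt_succ_self (cubicTerms n).card)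
  simp only [Nat.succ_eq_add_one] at h
  rw [valueSpec, Terms.value, h.1, h.2, show L - 1 - (L - 1 - m) = m by omega]
  by_cases h1 : m < G
  · simp [h1, hn0, card_pos]
  · simp [h1]

theorem valueE_eval (hE : Prepared k₀ n e E) (m : NExpr) : (valueE k₀ m).Ok inp E ∧
    (valueE k₀ m).eval inp E = E.real 2 ((total k₀ n e - 1 - m.eval E) *
      ((cubicTerms n).card + 1) + (cubicTerms n).card) := by
  have h := hE.total_eq
  simp only [valueE, RExpr.Ok, RExpr.eval, NExpr.eval_add, NExpr.eval_mul, NExpr.eval_sub,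
    NExpr.eval_ofNat, eval_cardE, h, hE.n_eq, and_self]

theorem pairOddsE_eval (hE : Prepared k₀ n e E) (m t : NExpr) {o : ℕ → ℝ} (ho : ∀ κ < 4, 0 ≤ o κ)
    (h : ∀ κ < 4, E.real 2 ((total k₀ n e - 1 - (cubicTerms n).childIndex n (m.eval E) (t.eval E) κ)
      * ((cubicTerms n).card + 1) + (cubicTerms n).card) = o κ) :
    (pairOddsE k₀ m t).Ok inp E ∧ (pairOddsE k₀ m t).eval inp E = pairOdds o := by
  have hc : ∀ κ < 4, (childE k₀ m t κ).Ok inp E ∧ (childE k₀ m t κ).eval inp E = o κ := by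
    intro κ hκ
    refine ⟨(valueE_eval hE _).1, (valueE_eval hE _).2.trans ?_⟩
    rw [← h κ hκ]
    simp only [NExpr.eval_add, NExpr.eval_mul, NExpr.eval_ofNat, eval_cardE, eval_nE, hE.n_eq,
      Terms.childIndex]
    rfl
  have h0 := ho 0 (by norm_num)
  have h1 := ho 1 (by norm_num)
  have h2 := ho 2 (by norm_num)
  have h3 := ho 3 (by norm_num)
  simp only [pairOddsE, RExpr.ok_add, RExpr.ok_div, RExpr.ok_mul, RExpr.ok_ofNat,
    RExpr.eval_add, RExpr.eval_div, RExpr.eval_mul, RExpr.eval_one, hc 0 (by norm_num),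
    hc 1 (by norm_num), hc 2 (by norm_num), hc 3 (by norm_num), true_and, pairOdds, and_true]
  constructor <;> positivity

theorem factorE_eval (hE : Prepared k₀ n e E) (m t : NExpr) {o : ℕ → ℝ} (ho : ∀ κ < 4, 0 ≤ o κ)
    (h : ∀ κ < 4, E.real 2 ((total k₀ n e - 1 - (cubicTerms n).childIndex n (m.eval E) (t.eval E) κ)
      * ((cubicTerms n).card + 1) + (cubicTerms n).card) = o κ) {u : ℝ}
    (hu : E.real 1 (m.eval E * (cubicTerms n).card + t.eval E) = Real.exp u) :
    (factorE k₀ m t).Ok inp E ∧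
      (factorE k₀ m t).eval inp E = factor (Real.exp (2 * u)) (pairOdds o) := by
  have hp := pairOddsE_eval (inp := inp) hE m t ho h
  have h1 := pairOdds_nonneg ho
  have h2 : Real.exp u * Real.exp u = Real.exp (2 * u) := by rw [← Real.exp_add]; ring_nf
  have h3 := Real.exp_pos (2 * u)
  simp only [factorE, RExpr.ok_div, RExpr.ok_ofNat,
    RExpr.eval_div, RExpr.eval_one, hp, RExpr.Ok, RExpr.eval,
    NExpr.eval_add, NExpr.eval_mul, eval_cardE, hE.n_eq, hu, h2, true_and, factor, and_true]
  positivity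

theorem valueBody_eval (hn0 : 0 < n) (hE : Prepared k₀ n e E) (hx : E.var 2 = x)
    (hxL : x < total k₀ n e * ((cubicTerms n).card + 1))
    (hv : ∀ y < total k₀ n e, E.nat 2 y = ((cubicTerms n).node n w y).v)
    (hd : ∀ y < total k₀ n e * (n + 1), E.nat 3 y = deadSpec n w y)
    (hs : ∀ y < total k₀ n e * (cubicTerms n).card, E.real 1 y = systemSpec n w y)
    (h : ∀ y < x, E.real 2 y = valueSpec n w (internal k₀ n e) (total k₀ n e) y) :
    (valueBody k₀).Ok inp E ∧
      (valueBody k₀).eval inp E = valueSpec n w (internal k₀ n e) (total k₀ n e) x := by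
  have hL : x / ((cubicTerms n).card + 1) < total k₀ n e := Nat.div_lt_of_lt_mul (by
    rwa [mul_comm])
  obtain ⟨m, hm⟩ : ∃ m, m = total k₀ n e - 1 - x / ((cubicTerms n).card + 1) := ⟨_, rfl⟩
  obtain ⟨s, hs'⟩ : ∃ s, s = x % ((cubicTerms n).card + 1) := ⟨_, rfl⟩
  have hsx : s < (cubicTerms n).card + 1 := hs' ▸ Nat.mod_lt x (by omega)
  have hxs := Nat.div_add_mod x ((cubicTerms n).card + 1)
  have hmL : m < total k₀ n e :=
    hm ▸ (Nat.sub_le _ _).trans_lt (Nat.sub_lt (Nat.zero_lt_of_lt hL) one_pos)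
  let mE : NExpr := totalE k₀ - 1 - xE / (cardE + 1)
  let sE : NExpr := NExpr.mod xE (cardE + 1)
  have hme : mE.eval E = m := by
    simp only [mE, NExpr.eval_sub, NExpr.eval_div, NExpr.eval_add, NExpr.eval_ofNat, eval_xE,
      eval_cardE, hE.total_eq, hE.n_eq, hx, hm]
  have hse : sE.eval E = s := by
    simp only [sE, NExpr.eval_mod, NExpr.eval_add, NExpr.eval_ofNat, eval_xE,
      eval_cardE, hE.n_eq, hx, hs']
  by_cases h1 : s < 1
  · have h0 : s = 0 := by omega
    have hvle := node_v_le (w := w) hn0 m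
    have hdm := mul_add_div_mod (m := m) (Nat.lt_succ_of_le hvle)
    change RExpr.Ok inp E (.ite sE 1 (.ite (.tab 3 (mE * (nE + 1) + .tab 2 mE)) 1 1 0) _) ∧
      RExpr.eval inp E (.ite sE 1 (.ite (.tab 3 (mE * (nE + 1) + .tab 2 mE)) 1 1 0) _) = _
    simp only [RExpr.Ok, RExpr.eval, NExpr.eval_ofNat, hse, if_pos h1, NExpr.eval,
      eval_nE, hE.n_eq, hme, hv m hmL,
      hd _ (mul_add_lt_mul hmL (Nat.lt_succ_of_le hvle)), deadSpec, hdm.1, hdm.2,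
      RExpr.ok_ofNat, RExpr.eval_one, RExpr.eval_zero, ite_self, true_and]
    rw [valueSpec, ← hs', ← hm, h0]
    by_cases h2 : ((cubicTerms n).node n w m).v ∈ ((cubicTerms n).node n w m).A <;> simp [h2]
  · obtain ⟨r, rfl⟩ := Nat.exists_eq_succ_of_ne_zero (n := s) (by omega)
    have hrc : r < (cubicTerms n).card := by omega
    have hre : (sE - 1).eval E = r := by
      simp only [NExpr.eval_sub, hse, NExpr.eval_ofNat, Nat.succ_eq_add_one, Nat.add_sub_cancel]
    have hprev : E.real 2 (x - 1) = (if ((cubicTerms n).node n w m).v ∈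
        ((cubicTerms n).node n w m).A then 1 else 0) * ∏ τ ∈ range r,
        if m < internal k₀ n e then if (cubicTerms n).Mem ((cubicTerms n).node n w m).v τ then
          factor (Real.exp (2 * ((cubicTerms n).node n w m).w τ)) (pairOdds fun κ =>
            (cubicTerms n).value n w (internal k₀ n e) ((cubicTerms n).childIndex n m τ κ))
        else 1 else 1 := by
      have h3 : x - 1 = x / ((cubicTerms n).card + 1) * ((cubicTerms n).card + 1) + r := by
        rw [mul_comm]; omega
      have h4 := mul_add_div_mod (m := x / ((cubicTerms n).card + 1)) (v := r)
        (q := (cubicTerms n).card + 1) (by omega)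
      rw [h _ (by omega), valueSpec, h3, h4.1, h4.2, ← hm]
    have hfac : m < internal k₀ n e → (factorE k₀ mE (sE - 1)).Ok inp E ∧
        (factorE k₀ mE (sE - 1)).eval inp E =
        factor (Real.exp (2 * ((cubicTerms n).node n w m).w r)) (pairOdds fun κ =>
          (cubicTerms n).value n w (internal k₀ n e) ((cubicTerms n).childIndex n m r κ)) := by
      intro hmG
      have h4 := mul_add_div_mod (m := m) hrc
      refine factorE_eval hE mE (sE - 1) (fun κ _ => Terms.value_nonneg) ?_ ?_
      · intro κ hκ
        rw [hme, hre]
        have hlt : (cubicTerms n).childIndex n m r κ < total k₀ n e :=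
          Terms.childIndex_lt hmG hrc hκ
        have hgt : m < (cubicTerms n).childIndex n m r κ := Terms.lt_childIndex hn0 card_pos
        rw [h _ ?_, valueSpec_last hn0 hlt]
        exact mul_add_lt_of_lt (by omega) (Nat.lt_succ_self _)
      · rw [hme, hre, hs _ (mul_add_lt_mul hmL hrc), systemSpec, h4.1, h4.2]
    change RExpr.Ok inp E (.ite sE 1 _ (.tab 2 (xE - 1) * .ite mE (internalE k₀)
        (.iteMem (.tab 2 mE) (sE - 1) (factorE k₀ mE (sE - 1)) 1) 1)) ∧
      RExpr.eval inp E (.ite sE 1 _ (.tab 2 (xE - 1) * .ite mE (internalE k₀)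
        (.iteMem (.tab 2 mE) (sE - 1) (factorE k₀ mE (sE - 1)) 1) 1)) = _
    rw [valueSpec, ← hs', ← hm]
    simp only [RExpr.Ok, RExpr.eval, NExpr.eval_ofNat, hse, if_neg h1,
      NExpr.eval_sub, eval_xE, hx, hprev, hme, hE.internal_eq, RExpr.ok_iteMem,
      RExpr.eval_iteMem, NExpr.eval, hE.n_eq, hv m hmL, RExpr.ok_ofNat, RExpr.eval_one,
      Nat.succ_eq_add_one, prod_range_succ, true_and, mul_assoc, Nat.add_sub_cancel]
    by_cases hmG : m < internal k₀ n e
    · simp only [hmG, if_true, (hfac hmG).1, (hfac hmG).2, ite_self, true_and]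
    · simp only [hmG, if_false, true_and]

/-- The partial products of the result. -/
noncomputable def outSpec (n : ℕ) (w : ℕ → ℝ) (G x : ℕ) : ℝ :=
  ∏ y ∈ range x, if y < (cubicTerms n).card then Real.exp (w y)
    else 1 + (cubicTerms n).value n w G (y - (cubicTerms n).card)

theorem outSpec_last : outSpec n w G ((cubicTerms n).card + n) =
    (∏ τ ∈ range (cubicTerms n).card, Real.exp (w τ)) *
      ∏ r ∈ range n, (1 + (cubicTerms n).value n w G r) := by
  rw [outSpec, prod_range_add]
  congr 1
  · exact prod_congr rfl fun y hy => if_pos (mem_range.1 hy)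
  · exact prod_congr rfl fun y _ => by rw [if_neg (by omega), Nat.add_sub_cancel_left]

theorem outBody_eval (hn0 : 0 < n) (hE : Prepared k₀ n e E) (hx : E.var 2 = x)
    (hxL : x < (cubicTerms n).card + n + 1)
    (hw : ∀ τ < (cubicTerms n).card,
      E.real 0 (τ * (precision K n e + 1) + precision K n e) = Real.exp (w τ))
    (hs : ∀ y < total k₀ n e * ((cubicTerms n).card + 1),
      E.real 2 y = valueSpec n w (internal k₀ n e) (total k₀ n e) y)
    (h : ∀ y < x, E.real 3 y = outSpec n w (internal k₀ n e) y) :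
    (outBody k₀ K).Ok inp E ∧ (outBody k₀ K).eval inp E = outSpec n w (internal k₀ n e) x := by
  have hv := valueE_eval (inp := inp) hE (xE - 1 - cardE)
  simp only [NExpr.eval_sub, NExpr.eval_ofNat, eval_xE, eval_cardE, hE.n_eq, hx] at hv
  simp only [outBody, RExpr.Ok, RExpr.eval, NExpr.eval_ofNat,
    NExpr.eval_sub, NExpr.eval_add, NExpr.eval_mul, eval_xE,
    eval_cardE, RExpr.ok_ofNat, RExpr.eval_one, hE.n_eq, hx, hv,
    precisionE_eval (K := K) hE.n_eq hE.e_eq, ite_self, true_and]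
  cases x with
  | zero => simp [outSpec]
  | succ x =>
    rw [if_neg (by omega), Nat.add_sub_cancel, h x (by omega), outSpec, outSpec, prod_range_succ]
    congr 1
    split_ifs with h1
    · exact hw x h1
    · have h2 : x - (cubicTerms n).card < total k₀ n e := by unfold total; omega
      rw [hs _ (mul_add_lt_mul (by omega) (Nat.lt_succ_self _)), valueSpec_last hn0 h2]

end RealRAM

namespace RealRAM

open SpinSystem Finset

/-! ### The program -/

variable {inp : List ℝ} {E : Env} {n e x k₀ K j M : ℕ} {w : ℕ → ℝ}
  {c : ℕ → ℕ → ℕ → ℝ} {a : ℕ → ℕ → ℝ} {b : ℕ → ℝ} {t : Fin 4}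

/-- The lengths of the tables of natural numbers, as expressions. -/
def natLenE (k₀ : ℕ) : Fin 4 → NExpr := ![logLen, levelLen k₀, vertexLen k₀, deadLen k₀]

/-- The entries of the tables of natural numbers, as expressions. -/
def natBodyE : Fin 4 → NExpr := ![logBody, levelBody, vertexBody, deadBody]

/-- The lengths of the tables of real numbers, as expressions. -/
def realLenE (k₀ K : ℕ) : Fin 4 → NExpr := ![weightLen K, systemLen k₀, valueLen k₀, outLen]

/-- The entries of the tables of real numbers, as expressions. -/
def realBodyE (k₀ K : ℕ) : Fin 4 → RExpr :=
  ![weightBody K, systemBody K, valueBody k₀, outBody k₀ K]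

/-- The lengths of the tables of natural numbers. -/
def natLen (k₀ n e : ℕ) : Fin 4 → ℕ :=
  ![n * e + 1, depth k₀ n e + 1, total k₀ n e, total k₀ n e * (n + 1)]

/-- The lengths of the tables of real numbers. -/
def realLen (k₀ K n e : ℕ) : Fin 4 → ℕ :=
  ![(cubicTerms n).card * (precision K n e + 1), total k₀ n e * (cubicTerms n).card,
    total k₀ n e * ((cubicTerms n).card + 1), (cubicTerms n).card + n + 1]

/-- The contents of the tables of natural numbers. -/
def natSpec (n : ℕ) (w : ℕ → ℝ) : Fin 4 → ℕ → ℕ :=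
  ![Nat.log 2, (cubicTerms n).levelSize n, fun y => ((cubicTerms n).node n w y).v, deadSpec n w]

/-- The contents of the tables of real numbers. -/
noncomputable def realSpec (k₀ K n e : ℕ) (c : ℕ → ℕ → ℕ → ℝ) (a : ℕ → ℕ → ℝ) (b : ℕ → ℝ)
    (w : ℕ → ℝ) : Fin 4 → ℕ → ℝ :=
  ![weightSpec n (precision K n e) c a b, systemSpec n w,
    valueSpec n w (internal k₀ n e) (total k₀ n e), outSpec n w (internal k₀ n e)]

/-- A bound on all lengths of tables and on all natural numbers in the tables. -/
def size (k₀ K n e : ℕ) : ℕ :=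
  (n * e + 1) + (depth k₀ n e + 1) + total k₀ n e * ((cubicTerms n).card + 1) +
    (cubicTerms n).card * (precision K n e + 1) + ((cubicTerms n).card + n + 1)

/-- The first `j` of the eight tables have been filled, those of natural numbers first. -/
structure Filled (k₀ K n e : ℕ) (c : ℕ → ℕ → ℕ → ℝ) (a : ℕ → ℕ → ℝ) (b : ℕ → ℝ) (w : ℕ → ℝ)
    (j : ℕ) (E : Env) : Prop where
  n_eq : E.var 0 = n
  e_eq : E.var 1 = e
  nat_eq : ∀ t : Fin 4, (t : ℕ) < j → ∀ y < natLen k₀ n e t, E.nat t y = natSpec n w t y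
  real_eq : ∀ t : Fin 4, 4 + (t : ℕ) < j → ∀ y < realLen k₀ K n e t,
    E.real t y = realSpec k₀ K n e c a b w t y

theorem Filled.setNat {g : ℕ → ℕ} (h : Filled k₀ K n e c a b w t E) :
    Filled k₀ K n e c a b w t (E.setNat x t g) where
  n_eq := h.n_eq
  e_eq := h.e_eq
  nat_eq u hu y hy := by
    have : u ≠ t := fun h => by subst h; omega
    simp only [Env.setNat, Function.update_of_ne this, h.nat_eq u hu y hy]
  real_eq := h.real_eq

theorem Filled.setReal {g : ℕ → ℝ} (h : Filled k₀ K n e c a b w (4 + t) E) :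
    Filled k₀ K n e c a b w (4 + t) (E.setReal x t g) where
  n_eq := h.n_eq
  e_eq := h.e_eq
  nat_eq := h.nat_eq
  real_eq u hu y hy := by
    have : u ≠ t := fun h => by subst h; omega
    simp only [Env.setReal, Function.update_of_ne this, h.real_eq u hu y hy]

theorem Filled.succ_nat (h : Filled k₀ K n e c a b w t E)
    (ht : ∀ y < natLen k₀ n e t, E.nat t y = natSpec n w t y) :
    Filled k₀ K n e c a b w (t + 1) E where
  n_eq := h.n_eq
  e_eq := h.e_eq
  nat_eq u hu := by
    by_cases hut : u = t
    · subst hut; exact ht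
    · exact h.nat_eq u (by have := Fin.val_ne_of_ne hut; omega)
  real_eq u hu := by omega

theorem Filled.succ_real (h : Filled k₀ K n e c a b w (4 + t) E)
    (ht : ∀ y < realLen k₀ K n e t, E.real t y = realSpec k₀ K n e c a b w t y) :
    Filled k₀ K n e c a b w (4 + t + 1) E where
  n_eq := h.n_eq
  e_eq := h.e_eq
  nat_eq u _ := h.nat_eq u (by omega)
  real_eq u hu := by
    by_cases hut : u = t
    · subst hut; exact ht
    · exact h.real_eq u (by have := Fin.val_ne_of_ne hut; omega)

theorem Filled.depth_eq (h : Filled k₀ K n e c a b w j E) (hj : 0 < j) :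
    (depthE k₀).eval E = depth k₀ n e :=
  depthE_eval h.n_eq h.e_eq (h.nat_eq 0 hj (n * e) (Nat.lt_succ_self _))

theorem Filled.prepared (h : Filled k₀ K n e c a b w j E) (hj : 1 < j) : Prepared k₀ n e E where
  n_eq := h.n_eq
  e_eq := h.e_eq
  internal_eq := by
    change E.nat 1 ((depthE k₀).eval E) = _
    rw [h.depth_eq (by omega)]
    exact h.nat_eq 1 hj _ (Nat.lt_succ_self _)

theorem Filled.natLen_eq (h : Filled k₀ K n e c a b w t E) :
    (natLenE k₀ t).eval E = natLen k₀ n e t := by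
  fin_cases t
  · change E.var 0 * E.var 1 + 1 = _
    rw [h.n_eq, h.e_eq]; rfl
  · change (depthE k₀).eval E + 1 = _
    rw [h.depth_eq (by simp)]; rfl
  · exact (h.prepared (by simp)).total_eq
  · change (totalE k₀).eval E * (E.var 0 + 1) = _
    rw [(h.prepared (by simp)).total_eq, h.n_eq]; rfl

theorem Filled.realLen_eq (h : Filled k₀ K n e c a b w (4 + t) E) :
    (realLenE k₀ K t).eval E = realLen k₀ K n e t := by
  have hp := h.prepared (by omega)
  fin_cases t
  · change (cubicTerms (E.var 0)).card * ((precisionE K).eval E + 1) = _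
    rw [precisionE_eval h.n_eq h.e_eq, h.n_eq]; rfl
  · change (totalE k₀).eval E * (cubicTerms (E.var 0)).card = _
    rw [hp.total_eq, h.n_eq]; rfl
  · change (totalE k₀).eval E * ((cubicTerms (E.var 0)).card + 1) = _
    rw [hp.total_eq, h.n_eq]; rfl
  · change (cubicTerms (E.var 0)).card + E.var 0 + 1 = _
    rw [h.n_eq]; rfl

theorem Filled.natBody_eval (h : Filled k₀ K n e c a b w t E) (hn : 0 < n) (hx : E.var 2 = x)
    (hxL : x < natLen k₀ n e t) (hprev : ∀ y < x, E.nat t y = natSpec n w t y) :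
    (natBodyE t).eval E = natSpec n w t x := by
  fin_cases t
  · exact logBody_eval hx hprev
  · exact levelBody_eval h.n_eq hx hprev
  · exact vertexBody_eval hn h.n_eq hx hprev
  · have hL : x / (n + 1) < total k₀ n e := Nat.div_lt_of_lt_mul (by
      rw [mul_comm]; exact hxL)
    exact deadBody_eval hn h.n_eq hx
      (fun y hy => h.nat_eq 2 (by simp) y (lt_of_le_of_lt hy hL)) hprev

theorem Filled.realBody_eval (h : Filled k₀ K n e c a b w (4 + t) E) (hn : 0 < n)
    (hK : 0 < precision K n e) (hi : Encodes n c a b inp)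
    (hw : ∀ τ < (cubicTerms n).card, Real.exp (w τ) = weight n (precision K n e) c a b τ)
    (hx : E.var 2 = x) (hxL : x < realLen k₀ K n e t)
    (hprev : ∀ y < x, E.real t y = realSpec k₀ K n e c a b w t y) :
    (realBodyE k₀ K t).Ok inp E ∧
      (realBodyE k₀ K t).eval inp E = realSpec k₀ K n e c a b w t x := by
  have hp := h.prepared (by omega)
  have hweight : 0 < (t : ℕ) → ∀ τ < (cubicTerms n).card,
      E.real 0 (τ * (precision K n e + 1) + precision K n e) = Real.exp (w τ) := by
    intro ht τ hτ
    have hm := mul_add_div_mod (m := τ) (Nat.lt_succ_self (precision K n e))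
    simp only [Nat.succ_eq_add_one] at hm
    have h1 := h.real_eq 0 (by simpa using ht) _ (mul_add_lt_mul hτ (Nat.lt_succ_self _))
    refine h1.trans ?_
    change weightSpec n (precision K n e) c a b _ = _
    rw [hw τ hτ, weightSpec, hm.1, hm.2, weight]
  fin_cases t
  · exact weightBody_eval h.n_eq h.e_eq hx hK hi hprev
  · have hL : x / (cubicTerms n).card < total k₀ n e := Nat.div_lt_of_lt_mul (by
      rw [mul_comm]; exact hxL)
    exact systemBody_eval hn h.n_eq h.e_eq hx
      (fun y hy => h.nat_eq 2 (by simp) y (lt_of_le_of_lt hy hL)) (hweight (by simp)) hprev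
  · exact valueBody_eval hn hp hx hxL (fun y hy => h.nat_eq 2 (by simp) y hy)
      (fun y hy => h.nat_eq 3 (by simp) y hy) (fun y hy => h.real_eq 1 (by simp) y hy) hprev
  · exact outBody_eval hn hp hx hxL (hweight (by simp))
      (fun y hy => h.real_eq 2 (by simp) y hy) hprev

theorem total_le_mul : total k₀ n e ≤ total k₀ n e * ((cubicTerms n).card + 1) :=
  Nat.le_mul_of_pos_right _ (by omega)

theorem le_card : n ≤ (cubicTerms n).card := by
  simp only [cubicTerms]
  nlinarith [Nat.zero_le (n * n), Nat.zero_le (n * n * n)]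

theorem natLen_le_size (t : Fin 4) : natLen k₀ n e t ≤ size k₀ K n e := by
  have h1 := total_le_mul (k₀ := k₀) (n := n) (e := e)
  have h2 : total k₀ n e * (n + 1) ≤ total k₀ n e * ((cubicTerms n).card + 1) :=
    Nat.mul_le_mul_left _ (Nat.succ_le_succ le_card)
  unfold size
  fin_cases t <;> simp only [natLen] <;> simp <;> omega

theorem realLen_le_size (t : Fin 4) : realLen k₀ K n e t ≤ size k₀ K n e := by
  have h2 : total k₀ n e * (cubicTerms n).card ≤ total k₀ n e * ((cubicTerms n).card + 1) :=
    Nat.mul_le_mul_left _ (Nat.le_succ _)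
  unfold size
  fin_cases t <;> simp only [realLen] <;> simp <;> omega

theorem natSpec_le_size (hn : 0 < n) (hx : x < natLen k₀ n e t) :
    natSpec n w t x ≤ size k₀ K n e := by
  have h1 := total_le_mul (k₀ := k₀) (n := n) (e := e)
  have h3 : internal k₀ n e ≤ total k₀ n e := by
    unfold total
    have := Nat.le_mul_of_pos_right (internal k₀ n e) (card_pos (n := n))
    omega
  fin_cases t
  · have hx : x < n * e + 1 := hx
    have := Nat.log_le_self 2 x
    change Nat.log 2 x ≤ _
    unfold size; omega
  · have hx : x < depth k₀ n e + 1 := hx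
    have h2 : (cubicTerms n).levelSize n x ≤ internal k₀ n e :=
      Terms.levelSize_mono hn card_pos (Nat.lt_succ_iff.1 hx)
    change (cubicTerms n).levelSize n x ≤ _
    unfold size; omega
  · have := node_v_le (w := w) hn x
    change ((cubicTerms n).node n w x).v ≤ _
    unfold size; omega
  · change deadSpec n w x ≤ _
    unfold size deadSpec
    split_ifs <;> omega

/-- The entry of the last table that holds the result. -/
def resultE : RExpr := .tab 3 (cardE + nE)

/-- The number of registers of each kind that serve as work space; the tables begin there. -/
def workspace (k₀ K : ℕ) : ℕ :=
  10 + resultE.width + ∑ t, ((natLenE k₀ t).width + (natBodyE t).width +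
    (realLenE k₀ K t).width + (realBodyE k₀ K t).width)

theorem width_le_workspace (k₀ K : ℕ) (t : Fin 4) : 10 + ((natLenE k₀ t).width +
    (natBodyE t).width + (realLenE k₀ K t).width + (realBodyE k₀ K t).width) ≤
      workspace k₀ K := by
  have := Finset.single_le_sum (f := fun t => (natLenE k₀ t).width + (natBodyE t).width +
    (realLenE k₀ K t).width + (realBodyE k₀ K t).width) (fun _ _ => Nat.zero_le _) (mem_univ t)
  unfold workspace
  omega

theorem fillNat_filled (k₀ K : ℕ) (t : Fin 4) : ∃ k, ∀ inp M n e c a b w s, 2 ≤ M → 0 < n →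
    size k₀ K n e ≤ M → (envOf (workspace k₀ K) s).Bounded M →
    Filled k₀ K n e c a b w t (envOf (workspace k₀ K) s) →
    Runs inp (fillNat (workspace k₀ K) t (natLenE k₀ t) (natBodyE t)) s (M ^ k) (fun s' =>
      (envOf (workspace k₀ K) s').Bounded M ∧
        Filled k₀ K n e c a b w (t + 1) (envOf (workspace k₀ K) s')) := by
  have hS := width_le_workspace k₀ K t
  obtain ⟨k, hk⟩ := fillNat_runs (S := workspace k₀ K) (by omega) t (len := natLenE k₀ t)
    (body := natBodyE t) (by omega) (by omega)
  refine ⟨k, fun inp M n e c a b w s hM hn hsize hB hF => ?_⟩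
  have hL := hF.natLen_eq
  refine (hk inp M hM s hB (hL ▸ (natLen_le_size t).trans hsize) (natSpec n w t)
    (fun x hx => (natSpec_le_size hn (hL ▸ hx)).trans hsize) fun x hx g hg => ?_).mono le_rfl ?_
  · refine hF.setNat.natBody_eval hn rfl (hL ▸ hx) ?_
    simpa [Env.setNat] using hg
  · rintro s' ⟨g, hs', hg, hB'⟩
    refine ⟨hB', Filled.succ_nat (hs' ▸ hF.setNat) fun y hy => ?_⟩
    rw [hs', ← hg y (hL ▸ hy)]
    simp [Env.setNat]

theorem fillReal_filled (k₀ K : ℕ) (t : Fin 4) : ∃ k, ∀ inp M n e c a b w s, 2 ≤ M → 0 < n →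
    size k₀ K n e ≤ M → 0 < precision K n e → Encodes n c a b inp →
    (∀ τ < (cubicTerms n).card, Real.exp (w τ) = weight n (precision K n e) c a b τ) →
    (envOf (workspace k₀ K) s).Bounded M →
    Filled k₀ K n e c a b w (4 + t) (envOf (workspace k₀ K) s) →
    Runs inp (fillReal (workspace k₀ K) t (realLenE k₀ K t) (realBodyE k₀ K t)) s (M ^ k) (fun s' =>
      (envOf (workspace k₀ K) s').Bounded M ∧
        Filled k₀ K n e c a b w (4 + t + 1) (envOf (workspace k₀ K) s')) := by
  have hS := width_le_workspace k₀ K t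
  obtain ⟨k, hk⟩ := fillReal_runs (S := workspace k₀ K) (by omega) t (len := realLenE k₀ K t)
    (body := realBodyE k₀ K t) (by omega) (by omega)
  refine ⟨k, fun inp M n e c a b w s hM hn hsize hK hi hw hB hF => ?_⟩
  have hL := hF.realLen_eq
  refine (hk inp M hM s hB (hL ▸ (realLen_le_size t).trans hsize) (realSpec k₀ K n e c a b w t)
    fun x hx g hg => ?_).mono le_rfl ?_
  · refine hF.setReal.realBody_eval hn hK hi hw rfl (hL ▸ hx) ?_
    simpa [Env.setReal] using hg
  · rintro s' ⟨g, hs', hg, hB'⟩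
    refine ⟨hB', Filled.succ_real (hs' ▸ hF.setReal) fun y hy => ?_⟩
    rw [hs', ← hg y (hL ▸ hy)]
    simp [Env.setReal]

/-- Fill all tables and put the result into `R[0]`. -/
def tableProgram (k₀ K : ℕ) : Program :=
  let natTable (t : Fin 4) := fillNat (workspace k₀ K) t (natLenE k₀ t) (natBodyE t)
  let realTable (t : Fin 4) := fillReal (workspace k₀ K) t (realLenE k₀ K t) (realBodyE k₀ K t)
  .seq (natTable 0) <| .seq (natTable 1) <| .seq (natTable 2) <| .seq (natTable 3) <|
  .seq (realTable 0) <| .seq (realTable 1) <| .seq (realTable 2) <| .seq (realTable 3) <|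
  resultE.compile (workspace k₀ K) 3 0

theorem tableProgram_runs (k₀ K : ℕ) : ∃ k, ∀ inp M n e c a b w s, 2 ≤ M → 0 < n →
    size k₀ K n e ≤ M → 0 < precision K n e → Encodes n c a b inp →
    (∀ τ < (cubicTerms n).card, Real.exp (w τ) = weight n (precision K n e) c a b τ) →
    (envOf (workspace k₀ K) s).Bounded M → s.nat 0 = n → s.nat 1 = e →
    Runs inp (tableProgram k₀ K) s (M ^ k) (fun s' => s'.real 0 =
      (∏ τ ∈ range (cubicTerms n).card, Real.exp (w τ)) *
        ∏ r ∈ range n, (1 + (cubicTerms n).value n w (internal k₀ n e) r)) := by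
  obtain ⟨k0, h0⟩ := fillNat_filled k₀ K 0
  obtain ⟨k1, h1⟩ := fillNat_filled k₀ K 1
  obtain ⟨k2, h2⟩ := fillNat_filled k₀ K 2
  obtain ⟨k3, h3⟩ := fillNat_filled k₀ K 3
  obtain ⟨k4, h4⟩ := fillReal_filled k₀ K 0
  obtain ⟨k5, h5⟩ := fillReal_filled k₀ K 1
  obtain ⟨k6, h6⟩ := fillReal_filled k₀ K 2
  obtain ⟨k7, h7⟩ := fillReal_filled k₀ K 3
  obtain ⟨k8, h8⟩ := resultE.compile_runs (workspace k₀ K)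
  refine ⟨k0 + (k1 + (k2 + (k3 + (k4 + (k5 + (k6 + (k7 + k8 + 1) + 1) + 1) + 1) + 1) + 1) + 1) + 1,
    fun inp M n e c a b w s hM hn hsize hK hi hw hB hs0 hs1 => ?_⟩
  have hF : Filled k₀ K n e c a b w (0 : Fin 4) (envOf (workspace k₀ K) s) :=
    ⟨hs0, hs1, fun _ h => by simp at h, fun _ h => by simp at h⟩
  refine Runs.of_le (T := M ^ k0 + (M ^ k1 + (M ^ k2 + (M ^ k3 + (M ^ k4 + (M ^ k5 + (M ^ k6 +
    (M ^ k7 + M ^ k8)))))))) ?_ (add_le_pow hM le_rfl <| add_le_pow hM le_rfl <|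
    add_le_pow hM le_rfl <| add_le_pow hM le_rfl <| add_le_pow hM le_rfl <|
    add_le_pow hM le_rfl <| add_le_pow hM le_rfl <| add_le_pow hM le_rfl le_rfl)
  refine (h0 inp M n e c a b w s hM hn hsize hB hF).seq fun s hs => ?_
  refine (h1 inp M n e c a b w s hM hn hsize hs.1 hs.2).seq fun s hs => ?_
  refine (h2 inp M n e c a b w s hM hn hsize hs.1 hs.2).seq fun s hs => ?_
  refine (h3 inp M n e c a b w s hM hn hsize hs.1 hs.2).seq fun s hs => ?_
  refine (h4 inp M n e c a b w s hM hn hsize hK hi hw hs.1 hs.2).seq fun s hs => ?_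
  refine (h5 inp M n e c a b w s hM hn hsize hK hi hw hs.1 hs.2).seq fun s hs => ?_
  refine (h6 inp M n e c a b w s hM hn hsize hK hi hw hs.1 hs.2).seq fun s hs => ?_
  refine (h7 inp M n e c a b w s hM hn hsize hK hi hw hs.1 hs.2).seq fun s hs => ?_
  refine (h8 inp 3 0 le_rfl (by unfold workspace; omega) (by unfold workspace; omega) M hM s hs.1
    trivial).mono le_rfl fun s' hs' => ?_
  rw [hs'.1, ← outSpec_last]
  change (envOf (workspace k₀ K) s).real 3
    ((cubicTerms ((envOf (workspace k₀ K) s).var 0)).card + (envOf (workspace k₀ K) s).var 0) = _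
  rw [hs.2.n_eq]
  exact hs.2.real_eq 3 (by simp) _ (Nat.lt_succ_self _)

end RealRAM

namespace RealRAM

open SpinSystem Finset

variable {inp : List ℝ}

/-- For `N[1] = 1`: increase `N[1]` until `N[1] * ε ≥ 1`. -/
def searchProgram : Program :=
  .seq (.instr (.natConst 3 1)) <| .seq (.instr (.realInput 1 2)) <|
  .seq (.instr (.realConst 2 1)) <| .seq (.instr (.realInput 3 2)) <|
  .loop (.realLt 3 2) (.seq (.instr (.natAdd 1 1 3)) (.instr (.realAdd 3 3 1)))

/-- The number `e^{b_1} + 1 / e^{b_1}`, which is the partition function for `n = 1`. -/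
def singleProgram : Program :=
  .seq (.instr (.realInput 1 1)) <| .seq (.instr (.realConst 2 1)) <|
  .seq (.instr (.realDiv 2 2 1)) (.instr (.realAdd 0 1 2))

/-- The program that approximates the partition function. A single spin is treated separately,
because the time bound is a constant for `n = 1`. -/
def mainProgram (k₀ K : ℕ) : Program :=
  .seq (.instr (.natConst 1 1)) <|
  .ite (.natLe 0 1) singleProgram (.seq searchProgram (tableProgram k₀ K))

theorem singleProgram_runs {s : State} {B : ℝ} (h1 : s.nat 1 = 1) (hB : inp.getD 1 0 = B)
    (hB0 : B ≠ 0) : Runs inp singleProgram s 4 (fun s' => s'.real 0 = B + 1 / B) := by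
  refine Runs.instr_seq (T := 3) trivial (Runs.instr_seq (T := 2) trivial
    (Runs.instr_seq (T := 1) ?_ (Runs.instr trivial ?_)))
  · simpa [Instr.Valid, Instr.run, h1, ← hB] using hB0
  · simp only [Instr.run, h1, hB]
    simp

/-- The machine cannot round, and so the integer `⌈1 / ε⌉` is found by counting,
in time `O(1 / ε)`. -/
theorem searchProgram_runs {s : State} {ε : ℝ} (hε : 0 < ε) (hin : inp.getD 0 0 = ε)
    (h1 : s.nat 1 = 1) (h2 : s.nat 2 = 0) :
    Runs inp searchProgram s (3 * ⌈1 / ε⌉₊ + 5) (fun s' =>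
      s'.nat = Function.update (Function.update s.nat 3 1) 1 ⌈1 / ε⌉₊) := by
  have he : 0 < ⌈1 / ε⌉₊ := Nat.ceil_pos.2 (by positivity)
  refine Runs.of_le (T := 1 + (1 + (1 + (1 + ((⌈1 / ε⌉₊ - 1) * (2 + 1) + 1))))) ?_ (by omega)
  refine Runs.instr_seq trivial (Runs.instr_seq trivial (Runs.instr_seq trivial
    (Runs.instr_seq trivial ?_)))
  refine (Runs.loop (fun i s' => s'.nat = Function.update (Function.update s.nat 3 1) 1 (i + 1) ∧
    s'.real 1 = ε ∧ s'.real 2 = 1 ∧ s'.real 3 = (i + 1) * ε) _ ?_ ?_ ?_).mono le_rfl ?_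
  · refine ⟨?_, ?_, ?_, ?_⟩
    · funext i
      by_cases hi : i = 1
      · subst hi; simp [Instr.run, h1]
      · simp [Instr.run, hi]
    all_goals simp only [Instr.run, Function.update_self, ne_eq,
      OfNat.one_ne_ofNat, not_false_eq_true, Function.update_of_ne]
    · simp [h2, ← hin]
    · simp
    · simp [h2, ← hin]
  · rintro i hi s' ⟨hn, hr1, hr2, hr3⟩
    refine ⟨?_, Runs.instr_seq (T := 1) trivial (Runs.instr trivial ⟨?_, ?_, ?_, ?_⟩)⟩
    · have h3 : ((i + 1 : ℕ) : ℝ) < 1 / ε := Nat.lt_ceil.1 (by omega)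
      rw [lt_div_iff₀ hε] at h3
      simp only [Test.Holds, hr2, hr3]
      exact_mod_cast h3
    · simp [Instr.run, hn]
    · simp [Instr.run, hr1]
    · simp [Instr.run, hr2]
    · simp [Instr.run, hr1, hr3]; ring
  · rintro s' ⟨hn, hr1, hr2, hr3⟩
    have h3 := Nat.le_ceil (1 / ε)
    rw [div_le_iff₀ hε] at h3
    simp only [Test.Holds, hr2, hr3, not_lt]
    rw [Nat.cast_sub he]
    simpa using h3
  · rintro s' ⟨hn, -⟩
    rw [hn, Nat.sub_add_cancel he]

theorem mainProgram_runs_one {B : ℝ} (hB : inp.getD 1 0 = B) (hB0 : B ≠ 0) (k₀ K : ℕ) :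
    Runs inp (mainProgram k₀ K) (init 1) 6 (fun s' => s'.real 0 = B + 1 / B) := by
  refine Runs.instr_seq (T := 5) trivial (Runs.ite (T := 4) (fun _ => ?_) fun h => ?_)
  · exact singleProgram_runs (by simp [Instr.run]) hB hB0
  · simp [Test.Holds, Instr.run, init] at h

/-- The program computes the product formula for the partition function, with the odds replaced by
their truncated recursions, in time polynomial in the size of the tables. -/
theorem mainProgram_runs (k₀ : ℕ) {K : ℕ} (hK : 0 < K) : ∃ k, ∀ inp n ε c a b w, 2 ≤ n →
    0 < ε → inp.getD 0 0 = ε → Encodes n c a b inp →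
    (∀ τ < (cubicTerms n).card, Real.exp (w τ) =
      weight n (precision K n ⌈1 / ε⌉₊) c a b τ) →
    Runs inp (mainProgram k₀ K) (init n) (size k₀ K n ⌈1 / ε⌉₊ ^ k) (fun s' => s'.real 0 =
      (∏ τ ∈ range (cubicTerms n).card, Real.exp (w τ)) *
        ∏ r ∈ range n, (1 + (cubicTerms n).value n w (internal k₀ n ⌈1 / ε⌉₊) r)) := by
  obtain ⟨k, hk⟩ := tableProgram_runs k₀ K
  refine ⟨(1 + 3 + k + 1) + 7 + 1, fun inp n ε c a b w hn hε hin hi hw => ?_⟩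
  have he : 0 < ⌈1 / ε⌉₊ := Nat.ceil_pos.2 (by positivity)
  obtain ⟨e, he'⟩ : ∃ e, e = ⌈1 / ε⌉₊ := ⟨_, rfl⟩
  rw [← he'] at he hw ⊢
  obtain ⟨M, hM'⟩ : ∃ M, M = size k₀ K n e := ⟨_, rfl⟩
  rw [← hM']
  have heM : e ≤ M := by
    have := Nat.le_mul_of_pos_left e (by omega : 0 < n)
    rw [hM']; unfold size; omega
  have hnM : n ≤ M := by rw [hM']; unfold size; omega
  have hM : 2 ≤ M := hn.trans hnM
  have hprec : 0 < precision K n e := by unfold precision; positivity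
  refine Runs.of_le (T := 1 + (1 + ((3 * e + 5) + M ^ k))) ?_ ?_
  · refine Runs.instr_seq trivial (Runs.ite (fun h => ?_) fun _ => ?_)
    · simp [Test.Holds, Instr.run, init] at h
      omega
    · rw [he']
      refine (searchProgram_runs hε hin (by simp [Instr.run])
        (by simp [Instr.run, init])).seq fun s hs => ?_
      rw [← he'] at hs ⊢
      have hs0 : s.nat 0 = n := by simp [hs, Instr.run, init]
      have hs1 : s.nat 1 = e := by simp [hs]
      refine hk inp M n e c a b w s hM (by omega) hM'.ge hprec hi hw ⟨?_, ?_⟩ hs0 hs1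
      · intro i
        fin_cases i
        · exact hs0.trans_le hnM
        · exact hs1.trans_le heM
        · change s.nat 2 ≤ M
          simp [hs, Instr.run, init]
      · intro t x
        change s.nat (workspace k₀ K + (4 * x + t)) ≤ M
        have hS := width_le_workspace k₀ K 0
        obtain ⟨r, hr⟩ : ∃ r, r = workspace k₀ K + (4 * x + t) := ⟨_, rfl⟩
        have h0 : r ≠ 0 := by omega
        have h1 : r ≠ 1 := by omega
        have h3 : r ≠ 3 := by omega
        rw [← hr]
        simp [hs, Instr.run, init, h0, h1, h3]
  · have h1 : e * 3 + M ^ k ≤ M ^ (1 + 3 + k + 1) :=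
      add_le_pow hM (mul_le_pow (by simpa using heM) (const_le_pow hM 3)) le_rfl
    have h2 := add_le_pow hM h1 (const_le_pow hM 7)
    omega

end RealRAM

namespace RealRAM

open SpinSystem Finset Real

/-! ### Accuracy -/

variable {k₀ K n e : ℕ} {ε : ℝ} {c : ℕ → ℕ → ℕ → ℝ} {a : ℕ → ℕ → ℝ} {b : ℕ → ℝ}

theorem relApprox_of_near {t u v : ℝ} (h : Near t u v) (hu : 0 < u) (hv : 0 < v) :
    RelApprox (u : ℂ) (v : ℂ) t := by
  refine ⟨(log u : ℝ), (log v : ℝ), ?_, ?_, ?_⟩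
  · rw [← Complex.ofReal_exp, exp_log hu]
  · rw [← Complex.ofReal_exp, exp_log hv]
  · rw [← Complex.ofReal_sub, Complex.norm_real]
    exact h.abs_log_sub_le hu hv

/-- `k₀` levels halve the error, and so `k₀ (log₂ (n e) + 4)` levels suffice. -/
theorem pow_depth_le {r : ℝ} (hr0 : 0 ≤ r) (hr : r ^ k₀ ≤ 1 / 2) (h : 0 < n * e) :
    r ^ depth k₀ n e ≤ 1 / (8 * (n * e)) := by
  have h1 : n * e < 2 ^ (Nat.log 2 (n * e) + 1) := Nat.lt_pow_succ_log_self (by norm_num) _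
  have h2 : ((n : ℝ) * e) ≤ 2 ^ (Nat.log 2 (n * e) + 1) := by exact_mod_cast h1.le
  have h3 : (0 : ℝ) < n * e := by exact_mod_cast h
  calc r ^ depth k₀ n e = (r ^ k₀) ^ (Nat.log 2 (n * e) + 4) := by rw [depth, pow_mul]
    _ ≤ (1 / 2) ^ (Nat.log 2 (n * e) + 4) := pow_le_pow_left₀ (pow_nonneg hr0 _) hr _
    _ = 1 / (8 * 2 ^ (Nat.log 2 (n * e) + 1)) := by
      rw [one_div_pow]; congr 1; ring
    _ ≤ _ := one_div_le_one_div_of_le (by positivity) (by linarith)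

/-- The number computed by the program. -/
noncomputable def output (k₀ K n e : ℕ) (c : ℕ → ℕ → ℕ → ℝ) (a : ℕ → ℕ → ℝ) (b : ℕ → ℝ) : ℝ :=
  (∏ τ ∈ range (cubicTerms n).card, exp (log (weight n (precision K n e) c a b τ))) *
    ∏ r ∈ range n, (1 + (cubicTerms n).value n
      (fun τ => log (weight n (precision K n e) c a b τ)) (internal k₀ n e) r)

theorem output_pos : 0 < output k₀ K n e c a b :=
  mul_pos (prod_pos fun _ _ => exp_pos _)
    (prod_pos fun _ _ => add_pos_of_pos_of_nonneg one_pos Terms.value_nonneg)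

/-- One half of the error comes from the truncation of the recursion, the other one from the
approximation of the exponential function. -/
theorem near_output {δ : ℝ} (hδ0 : 0 < δ) (hδ1 : δ < 1) (h : Admissible n c a (1 - δ))
    (hn : 0 < n) (hε : 0 < ε) (he : 1 / ε ≤ e) (hK : 4 / δ ≤ K)
    (hk₀ : 0 < k₀) (hr : (1 - δ ^ 2) ^ k₀ ≤ 1 / 2) :
    Near ε (output k₀ K n e c a b) ((cubicTerms n).Z (fun τ =>
        field n b ((cubicTerms n).i τ) ((cubicTerms n).j τ) ((cubicTerms n).k τ) +
        coupling n c a ((cubicTerms n).i τ) ((cubicTerms n).j τ) ((cubicTerms n).k τ))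
        (range n)) := by
  obtain ⟨N, hN⟩ : ∃ N, N = precision K n e := ⟨_, rfl⟩
  have hn1 : (1 : ℝ) ≤ n := by exact_mod_cast hn
  have he0 : (0 : ℝ) < e := lt_of_lt_of_le (by positivity) he
  have he1 : (1 : ℝ) ≤ e := by
    have : 0 < e := by exact_mod_cast he0
    exact_mod_cast this
  have hNcast : (N : ℝ) = K * (n * e) := by rw [hN, precision]; push_cast; ring
  have hne : (1 : ℝ) ≤ n * e := one_le_mul_of_one_le_of_one_le hn1 he1
  have hK4 : (4 : ℝ) ≤ K := by
    refine le_trans ?_ hK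
    rw [le_div_iff₀ hδ0]; linarith
  have hNK : (K : ℝ) ≤ N := by rw [hNcast]; exact le_mul_of_one_le_right (by linarith) hne
  have hN2 : 2 ≤ N := by
    have : (2 : ℝ) ≤ N := by linarith
    exact_mod_cast this
  have hN0 : (0 : ℝ) < N := by linarith
  have hNδ : 2 / (N : ℝ) ≤ δ := by
    rw [div_le_iff₀ hN0]
    rw [div_le_iff₀ hδ0] at hK
    nlinarith
  -- replacing the coefficients by those of the rational weights enlarges them by a factor of
  -- at most `1 + 2 / N ≤ 1 + δ`, and `(1 + δ) (1 - δ)` is still less than `1`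
  have hrate : (1 + 2 / (N : ℝ)) * (1 - δ) ≤ 1 - δ ^ 2 := by nlinarith
  have hrate0 : 0 ≤ (1 + 2 / (N : ℝ)) * (1 - δ) := mul_nonneg (by positivity) h.nonneg
  have h1 := Terms.near_Z hn (card_pos (n := n)) hrate0 (h.weight_good (b := b) hN2)
    (depth k₀ n e - 1)
  have hdepth : depth k₀ n e - 1 + 1 = depth k₀ n e :=
    Nat.sub_add_cancel (Nat.mul_pos hk₀ (Nat.succ_pos _))
  rw [hdepth] at h1
  have h2 := h1.trans (h.near_Z_weight (b := b) hN2)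
  rw [hN] at h2
  have h3 : 0 < n * e := by exact_mod_cast one_pos.trans_le hne
  refine h2.mono output_pos.le Terms.Z_pos.le ?_
  rw [← hN]
  have h4 : ((1 + 2 / (N : ℝ)) * (1 - δ)) ^ depth k₀ n e ≤ 1 / (8 * (n * e)) :=
    (pow_le_pow_left₀ hrate0 hrate _).trans
      (pow_depth_le (hrate0.trans hrate) hr h3)
  -- the truncation error
  have h5 : (n : ℝ) * (4 * ((1 + 2 / (N : ℝ)) * (1 - δ)) ^ depth k₀ n e) ≤ 1 / (2 * e) := by
    calc _ ≤ (n : ℝ) * (4 * (1 / (8 * (n * e)))) := by gcongr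
      _ = 1 / (2 * e) := by field_simp; norm_num
  -- the error of the weights
  have h6 : 2 / (N : ℝ) * (n * (1 - δ)) ≤ 1 / (2 * e) := by
    calc 2 / (N : ℝ) * (n * (1 - δ)) ≤ 2 / (4 * ((n : ℝ) * e)) * (n * 1) := by
          rw [hNcast]
          gcongr
          linarith
      _ = 1 / (2 * (e : ℝ)) := by field_simp; norm_num
  have h7 : 1 / (e : ℝ) ≤ ε := by
    rw [div_le_iff₀ hε] at he
    rw [div_le_iff₀ he0]; linarith
  have h8 : 1 / (2 * (e : ℝ)) + 1 / (2 * e) = 1 / e := by field_simp; norm_num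
  linarith

/-! ### The time bound -/

theorem levelSize_le (hn : 2 ≤ n) (l : ℕ) : (cubicTerms n).levelSize n l ≤ n ^ (9 * l) := by
  have hcard : (cubicTerms n).card * 4 ≤ n ^ 8 := by
    have h1 : n + 1 ≤ n ^ 2 := by nlinarith
    calc (n + 1) * (n + 1) * (n + 1) * 4 ≤ n ^ 2 * n ^ 2 * n ^ 2 * n ^ 2 := by
          gcongr; nlinarith
      _ = n ^ 8 := by ring
  induction l with
  | zero => simp [Terms.levelSize]
  | succ l ih =>
    calc (cubicTerms n).levelSize n (l + 1)
        = n + (cubicTerms n).levelSize n l * ((cubicTerms n).card * 4) := by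
          rw [Terms.levelSize, mul_assoc]
      _ ≤ n ^ 1 * n ^ (9 * l + 7) + n ^ (9 * l) * n ^ 8 := by
          gcongr
          rw [pow_one]
          exact Nat.le_mul_of_pos_right _ (by positivity)
      _ = 2 * n ^ (9 * l + 8) := by ring
      _ ≤ n * n ^ (9 * l + 8) := by gcongr
      _ = n ^ (9 * (l + 1)) := by ring

/-- All tables are of size `n^{O(log (n e))}`. -/
theorem size_le (k₀ K : ℕ) : ∃ q, ∀ n e, 2 ≤ n →
    size k₀ K n e ≤ n ^ (q * (Nat.log 2 (n * e) + 4)) := by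
  refine ⟨19 * k₀ + K + 100, fun n e hn => ?_⟩
  obtain ⟨D, hD⟩ : ∃ D, D = Nat.log 2 (n * e) + 4 := ⟨_, rfl⟩
  have h1 : n * e ≤ n ^ D := by
    refine (Nat.lt_pow_succ_log_self (b := 2) (by norm_num) _).le.trans ?_
    exact (Nat.pow_le_pow_right (by norm_num) (by omega)).trans (Nat.pow_le_pow_left hn D)
  have h2 : depth k₀ n e ≤ n ^ (k₀ * D) := by
    rw [depth, ← hD]; exact const_le_pow hn _
  have hcard : (cubicTerms n).card ≤ n ^ 6 := by
    have h1 : n + 1 ≤ n ^ 2 := by nlinarith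
    calc (n + 1) * (n + 1) * (n + 1) ≤ n ^ 2 * n ^ 2 * n ^ 2 := by gcongr
      _ = n ^ 6 := by ring
  have h3 : total k₀ n e ≤ n ^ (9 * (k₀ * D + 1)) := by
    rw [hD]
    exact levelSize_le hn (depth k₀ n e + 1)
  have hone : 1 ≤ n ^ 1 := const_le_pow hn 1
  have hcard1 : (cubicTerms n).card + 1 ≤ n ^ (6 + 1 + 1) := add_le_pow hn hcard hone
  have hprec : precision K n e ≤ n ^ (K + D) := mul_le_pow (const_le_pow hn K) h1
  have h4 := add_le_pow hn (add_le_pow hn (add_le_pow hn (add_le_pow hn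
    (add_le_pow hn h1 hone) (add_le_pow hn h2 hone)) (mul_le_pow h3 hcard1))
    (mul_le_pow hcard (add_le_pow hn hprec hone)))
    (add_le_pow hn (add_le_pow hn hcard (by simp : n ≤ n ^ 1)) hone)
  refine h4.trans (Nat.pow_le_pow_right (by omega) ?_)
  rw [← hD]
  have hD4 : 4 ≤ D := by omega
  have hKD : K * 4 ≤ K * D := Nat.mul_le_mul_left _ hD4
  have e1 : (19 * k₀ + K + 100) * D = 19 * (k₀ * D) + K * D + 100 * D := by ring
  rw [e1]
  omega

/-- The number of levels is `O(log n - log ε)`; the additive constants are absorbed since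
`log n ≥ log 2`. -/
theorem log_ceil_le (hn : 2 ≤ n) (hε : 0 < ε) (hε1 : ε < 1) :
    ((Nat.log 2 (n * ⌈1 / ε⌉₊) + 4 : ℕ) : ℝ) ≤ 6 / log 2 * (log n - log ε) := by
  have hl2 : 0 < log 2 := log_pos (by norm_num)
  have hn2 : (2 : ℝ) ≤ n := by exact_mod_cast hn
  have hn0 : (0 : ℝ) < n := by linarith
  have h1 : log 2 ≤ log n := log_le_log (by norm_num) hn2
  have h2 : log ε ≤ 0 := log_nonpos hε.le hε1.le
  have he : ((⌈1 / ε⌉₊ : ℕ) : ℝ) ≤ 2 / ε := by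
    have h3 := (Nat.ceil_lt_add_one (a := 1 / ε) (by positivity)).le
    have h4 : 1 ≤ 1 / ε := by rw [le_div_iff₀ hε]; linarith
    have h5 : 2 / ε = 1 / ε + 1 / ε := by ring
    linarith
  have hpos : 0 < n * ⌈1 / ε⌉₊ := Nat.mul_pos (by omega) (Nat.ceil_pos.2 (by positivity))
  have h3 : (2 : ℝ) ^ Nat.log 2 (n * ⌈1 / ε⌉₊) ≤ n * (2 / ε) := by
    have h4 : ((2 ^ Nat.log 2 (n * ⌈1 / ε⌉₊) : ℕ) : ℝ) ≤ ((n * ⌈1 / ε⌉₊ : ℕ) : ℝ) := by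
      exact_mod_cast Nat.pow_log_le_self 2 hpos.ne'
    push_cast at h4
    exact h4.trans (by gcongr)
  have h4 := log_le_log (by positivity) h3
  rw [log_pow, log_mul hn0.ne' (by positivity), log_div (by norm_num) hε.ne'] at h4
  push_cast
  rw [div_mul_eq_mul_div, le_div_iff₀ hl2]
  linarith

end RealRAM

namespace RealRAM

open SpinSystem Finset

/-! ### The inputs -/

theorem getD_flatten {l : List (List ℝ)} {m : ℕ} (h : ∀ x ∈ l, x.length = m) (i : ℕ) {j : ℕ}
    (hj : j < m) : l.flatten.getD (i * m + j) 0 = (l.getD i []).getD j 0 := by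
  induction l generalizing i with
  | nil => simp
  | cons x l ih =>
    have hx : x.length = m := h x (by simp)
    rw [List.flatten_cons]
    cases i with
    | zero => rw [List.getD_append _ _ _ _ (by omega)]; simp
    | succ i =>
      rw [List.getD_append_right _ _ _ _ (by rw [hx]; nlinarith), hx,
        show (i + 1) * m + j - m = i * m + j by rw [Nat.succ_mul]; omega,
        ih (fun y hy => h y (by simp [hy]))]
      simp

theorem length_flatten_ofFn {m k : ℕ} {f : Fin m → List ℝ} (h : ∀ i, (f i).length = k) :
    (List.ofFn f).flatten.length = m * k := by
  rw [List.length_flatten, List.map_ofFn, List.sum_ofFn]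
  simp [h]

variable {n : ℕ} {ε : ℝ} {c : Fin n → Fin n → Fin n → ℝ} {a : Fin n → Fin n → ℝ} {b : Fin n → ℝ}

theorem getD_ofFn {α : Type*} (f : Fin n → α) {i : ℕ} (hi : i < n) (d : α) :
    (List.ofFn f).getD i d = f ⟨i, hi⟩ := by
  rw [List.getD_eq_getElem _ _ (by simpa using hi)]
  simp

theorem length_quadInput : (quadInput ε a b).length = 1 + n + n * n := by
  rw [quadInput, List.length_cons, List.length_append, length_flatten_ofFn (k := n) (by simp)]
  simp
  ring

theorem quadInput_b {i : ℕ} (hi : i < n) :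
    (quadInput ε a b).getD (1 + i) 0 = Real.exp (extend₁ b i) := by
  rw [quadInput, add_comm 1, List.getD_cons_succ, List.getD_append _ _ _ _ (by simpa using hi),
    getD_ofFn _ hi, extend₁, dif_pos hi]

theorem quadInput_a {i j : ℕ} (hi : i < n) (hj : j < n) :
    (quadInput ε a b).getD (1 + n + (i * n + j)) 0 = extend₂ a i j := by
  rw [quadInput, show 1 + n + (i * n + j) = n + (i * n + j) + 1 by ring, List.getD_cons_succ,
    List.getD_append_right _ _ _ _ (by simp), List.length_ofFn, Nat.add_sub_cancel_left,
    getD_flatten (by simp) i hj, getD_ofFn _ hi, getD_ofFn _ hj]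
  simp [extend₂, hi, hj]

theorem encodes_quadInput :
    Encodes n (extend₃ (0 : Fin n → Fin n → Fin n → ℝ)) (extend₂ a) (extend₁ b)
      (quadInput ε a b) where
  b_eq _ hi := quadInput_b hi
  a_eq _ hi _ hj := quadInput_a hi hj
  -- positions beyond the end of the input list read as `0`
  c_eq i hi j hj k hk := by
    rw [List.getD_eq_default _ _ (by rw [length_quadInput]; omega)]
    simp [extend₃]

theorem encodes_cubicInput :
    Encodes n (extend₃ c) (extend₂ a) (extend₁ b) (cubicInput ε c a b) where
  b_eq i hi := by
    rw [cubicInput, List.getD_append _ _ _ _ (by rw [length_quadInput]; nlinarith), quadInput_b hi]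
  a_eq i hi j hj := by
    have := mul_add_lt_mul hi hj
    rw [cubicInput, List.getD_append _ _ _ _ (by rw [length_quadInput]; omega), quadInput_a hi hj]
  c_eq i hi j hj k hk := by
    rw [cubicInput, List.getD_append_right _ _ _ _ (by rw [length_quadInput]; omega),
      length_quadInput, Nat.add_sub_cancel_left]
    have h1 : (i * n + j) * n + k = i * (n * n) + (j * n + k) := by ring
    have h2 := mul_add_lt_mul hj hk
    rw [h1, getD_flatten (m := n * n) (by
      intro x hx
      obtain ⟨i, rfl⟩ := List.mem_ofFn.1 hx
      exact length_flatten_ofFn (by simp)) i h2, getD_ofFn _ hi, getD_flatten (by simp) j hk,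
      getD_ofFn _ hj, getD_ofFn _ hk]
    simp [extend₃, hi, hj, hk]

theorem cubicPoly_zero : cubicPoly 0 a b = quadPoly a b := by
  funext x
  simp [cubicPoly]

theorem partitionFunction_one (c : Fin 1 → Fin 1 → Fin 1 → ℝ) (a : Fin 1 → Fin 1 → ℝ)
    (b : Fin 1 → ℝ) : partitionFunction (cubicPoly c a b) =
      Real.exp (b 0) + 1 / Real.exp (b 0) := by
  rw [partitionFunction, ← (Equiv.funUnique (Fin 1) ℤˣ).symm.sum_comp]
  have h : ∀ x : ℤˣ, cubicPoly c a b ((Equiv.funUnique (Fin 1) ℤˣ).symm x) =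
      b 0 * ((x : ℤ) : ℝ) := by
    intro x
    simp [cubicPoly, quadPoly]
  simp only [h]
  rw [show (univ : Finset ℤˣ) = {1, -1} from rfl, sum_pair (by decide)]
  simp [Real.exp_neg]

/-- The program works for every input list that holds the coefficients of a cubic polynomial
with bounded interactions. -/
theorem exists_program {δ : ℝ} (hδ0 : 0 < δ) (hδ1 : δ < 1) :
    ∃ (P : Program) (C : ℝ), 0 < C ∧
      ∀ (n : ℕ) (ε : ℝ) (c : Fin n → Fin n → Fin n → ℝ) (a : Fin n → Fin n → ℝ)
        (b : Fin n → ℝ) (inp : List ℝ), 1 ≤ n → 0 < ε → ε < 1 →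
        Admissible n (extend₃ c) (extend₂ a) (1 - δ) → inp.getD 0 0 = ε →
        Encodes n (extend₃ c) (extend₂ a) (extend₁ b) inp →
        ∃ (w : ℝ) (t : ℕ), Outputs P n inp w t ∧
          RelApprox (w : ℂ) (partitionFunction (cubicPoly c a b) : ℂ) ε ∧
          (t : ℝ) ≤ C * (n : ℝ) ^ (C * (Real.log n - Real.log ε)) := by
  have hδ2 : 1 - δ ^ 2 < 1 := by nlinarith
  -- `k₀` levels of the recursion halve the error
  obtain ⟨k₀, hk₀⟩ : ∃ k₀, (1 - δ ^ 2) ^ k₀ < 1 / 2 :=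
    exists_pow_lt_of_lt_one (by norm_num) hδ2
  have hk₀pos : 0 < k₀ := by
    rcases Nat.eq_zero_or_pos k₀ with rfl | h
    · norm_num at hk₀
    · exact h
  -- with this `K`, the rational weights satisfy the hypothesis with `1 - δ ^ 2` in place of `1 - δ`
  obtain ⟨K, hK⟩ := exists_nat_ge (4 / δ)
  have hKpos : 0 < K := by
    have : (0 : ℝ) < K := lt_of_lt_of_le (by positivity) hK
    exact_mod_cast this
  obtain ⟨k, hk⟩ := mainProgram_runs k₀ hKpos
  obtain ⟨q, hq⟩ := size_le k₀ K
  have hl2 : 0 < Real.log 2 := Real.log_pos (by norm_num)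
  have hC : 0 ≤ (q : ℝ) * k * (6 / Real.log 2) := by positivity
  refine ⟨mainProgram k₀ K, 6 + q * k * (6 / Real.log 2), by positivity, ?_⟩
  intro n ε c a b inp hn hε hε1 hadm hin henc
  rcases hn.eq_or_lt with rfl | hn2
  -- for `n = 1` the time bound is the constant `C`, whatever `ε` is
  · have hB : inp.getD 1 0 = Real.exp (b 0) := by
      have := henc.b_eq 0 (by norm_num)
      simpa [extend₁] using this
    obtain ⟨s, t, hex, ht, hs⟩ := mainProgram_runs_one hB (Real.exp_pos _).ne' k₀ K
    refine ⟨_, t, ⟨s, hex, rfl⟩, ?_, ?_⟩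
    · rw [hs, partitionFunction_one]
      have : 0 < Real.exp (b 0) + 1 / Real.exp (b 0) := by positivity
      exact relApprox_of_near (Near.refl hε.le this.le) this this
    · have : (t : ℝ) ≤ 6 := by exact_mod_cast ht
      simp only [Nat.cast_one, Real.one_rpow, mul_one]
      linarith
  · have hn2 : 2 ≤ n := hn2
    have hN2 : 2 ≤ precision K n ⌈1 / ε⌉₊ := by
      have he : 0 < ⌈1 / ε⌉₊ := Nat.ceil_pos.2 (by positivity)
      calc 2 ≤ n := hn2
        _ ≤ n * ⌈1 / ε⌉₊ := Nat.le_mul_of_pos_right _ he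
        _ ≤ _ := Nat.le_mul_of_pos_left _ hKpos
    obtain ⟨s, t, hex, ht, hs⟩ := hk inp n ε _ _ _
      (fun τ => Real.log (weight n (precision K n ⌈1 / ε⌉₊) (extend₃ c) (extend₂ a)
        (extend₁ b) τ)) hn2 hε hin henc (fun τ _ => Real.exp_log (hadm.weight_pos hN2 τ))
    refine ⟨_, t, ⟨s, hex, rfl⟩, ?_, ?_⟩
    · rw [hs, ← Z_eq_partitionFunction]
      exact relApprox_of_near (near_output hδ0 hδ1 hadm (by omega) hε (Nat.le_ceil _) hK
        hk₀pos hk₀.le) output_pos Terms.Z_pos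
    · have hnR : (1 : ℝ) ≤ n := by exact_mod_cast hn
      have hΛ : 0 ≤ Real.log n - Real.log ε := by
        have := Real.log_nonneg hnR
        have := Real.log_nonpos hε.le hε1.le
        linarith
      have h1 : t ≤ n ^ (q * (Nat.log 2 (n * ⌈1 / ε⌉₊) + 4) * k) := by
        rw [pow_mul]
        exact ht.trans (Nat.pow_le_pow_left (hq n _ hn2) k)
      have h2 : ((q * (Nat.log 2 (n * ⌈1 / ε⌉₊) + 4) * k : ℕ) : ℝ) ≤
          (6 + q * k * (6 / Real.log 2)) * (Real.log n - Real.log ε) := by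
        have h3 := log_ceil_le hn2 hε hε1
        calc ((q * (Nat.log 2 (n * ⌈1 / ε⌉₊) + 4) * k : ℕ) : ℝ)
            = q * k * ((Nat.log 2 (n * ⌈1 / ε⌉₊) + 4 : ℕ) : ℝ) := by push_cast; ring
          _ ≤ q * k * (6 / Real.log 2 * (Real.log n - Real.log ε)) := by gcongr
          _ ≤ _ := by nlinarith
      calc (t : ℝ) ≤ ((n ^ (q * (Nat.log 2 (n * ⌈1 / ε⌉₊) + 4) * k) : ℕ) : ℝ) := by
            exact_mod_cast h1
        _ = (n : ℝ) ^ ((q * (Nat.log 2 (n * ⌈1 / ε⌉₊) + 4) * k : ℕ) : ℝ) := by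
            rw [Real.rpow_natCast, Nat.cast_pow]
        _ ≤ (n : ℝ) ^ ((6 + q * k * (6 / Real.log 2)) * (Real.log n - Real.log ε)) :=
            Real.rpow_le_rpow_of_exponent_le hnR h2
        _ ≤ _ := le_mul_of_one_le_left (by positivity) (by linarith)

end RealRAM

theorem mainTheorem3 (δ : ℝ) (hδ0 : 0 < δ) (hδ1 : δ < 1) :
    (∃ (P : RealRAM.Program) (C : ℝ), 0 < C ∧
      ∀ (n : ℕ) (ε : ℝ) (a : Fin n → Fin n → ℝ) (b : Fin n → ℝ),
        1 ≤ n → 0 < ε → ε < 1 →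
        (∀ i j, a i j = a j i) →
        (∀ i, ∑ j ∈ Finset.univ.erase i, |a i j| ≤ 1 - δ) →
        ∃ (w : ℝ) (t : ℕ),
          RealRAM.Outputs P n (quadInput ε a b) w t ∧
          RelApprox (w : ℂ) (partitionFunction (quadPoly a b) : ℂ) ε ∧
          (t : ℝ) ≤ C * (n : ℝ) ^ (C * (Real.log n - Real.log ε))) ∧
    (∃ (P : RealRAM.Program) (C : ℝ), 0 < C ∧
      ∀ (n : ℕ) (ε : ℝ) (c : Fin n → Fin n → Fin n → ℝ) (a : Fin n → Fin n → ℝ)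
        (b : Fin n → ℝ),
        1 ≤ n → 0 < ε → ε < 1 →
        (∀ i j, a i j = a j i) →
        (∀ i j k, c i j k = c j i k ∧ c i j k = c i k j) →
        (∀ i, (∑ j ∈ Finset.univ.erase i, ∑ k ∈ (Finset.Ioi j).erase i, |c i j k|)
            + ∑ j ∈ Finset.univ.erase i, |a i j| ≤ 1 - δ) →
        ∃ (w : ℝ) (t : ℕ),
          RealRAM.Outputs P n (cubicInput ε c a b) w t ∧
          RelApprox (w : ℂ) (partitionFunction (cubicPoly c a b) : ℂ) ε ∧
          (t : ℝ) ≤ C * (n : ℝ) ^ (C * (Real.log n - Real.log ε))) := by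
  obtain ⟨P, C, hC, h⟩ := RealRAM.exists_program hδ0 hδ1
  -- one program serves both parts: it reads the absent cubic coefficients as `0`
  refine ⟨⟨P, C, hC, fun n ε a b hn hε hε1 ha hsum => ?_⟩,
    ⟨P, C, hC, fun n ε c a b hn hε hε1 ha hc hsum => ?_⟩⟩
  · rw [← RealRAM.cubicPoly_zero]
    exact h n ε 0 a b _ hn hε hε1 (SpinSystem.admissible_extend (fun _ _ _ => ⟨rfl, rfl⟩) ha
      (by linarith) (by linarith) (by simpa using hsum)) (by simp [quadInput])
      RealRAM.encodes_quadInput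
  · exact h n ε c a b _ hn hε hε1
      (SpinSystem.admissible_extend hc ha (by linarith) (by linarith) hsum)
      (by simp [cubicInput, quadInput]) RealRAM.encodes_cubicInput
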